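/- A graph is \emph{chordal} if it has no induced cycle of length at least $4$. A \emph{treedepth decomposition} of a finite simple graph $G$ is a pair $(F,\psi)$ of a rooted forest $F$ and an injective map $\psi\colon V(G)\to V(F)$ such that for every edge $uv$ of $G$ one of $\psi(u),\psi(v)$ is an ancestor of the other; its height is the maximum number of vertices on a root-to-node path of $F$. The \emph{treedepth} $\mathrm{td}(G)$ is the minimum height of a treedepth decomposition of $G$. There is a single algorithm which, given a chordal graph $G$ on $n$ vertices and an integer $t\ge 0$, decides in time and space $2^{O(t\log t)}\cdot n$ whether $\mathrm{td}(G)\le t$, and, if so, outputs a treedepth decomposition of $G$ of height at most $t$. Here $2^{O(t\log t)}\cdot n$ means at most $C\cdot 2^{C\,t\log_2 t}\cdot n$ for an absolute constant $C$ (with $0\log_2 0=0$, and with $n$ replaced by $1$ if $G$ has no vertices). The algorithm is a program of a word RAM with words of at least $C(t\log_2 t+\log_2 n+1)$ bits and unit-cost operations. The graph is given by $t$, $n$ and its adjacency lists in a read-only random access input; time is the number of executed steps, and space is the size of the working memory, which also holds the output. -/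

import Mathlib

/-! ## Graphs, rooted forests and treedepth -/

/-- A graph is chordal if every cycle of length at least four has a chord,
that is, if it has no induced cycle of length at least four. -/
def IsChordal {V : Type*} (G : SimpleGraph V) : Prop :=
  ∀ k : ℕ, 4 ≤ k → ¬ (SimpleGraph.cycleGraph k).IsIndContained G

/-- One step upwards along parent pointers; `none` means that we have left the forest. -/
def parentStep {N : Type*} (parent : N → Option N) (o : Option N) : Option N :=
  o.bind parent

/-- A rooted forest with node set `N`, given by its parent pointers: the roots have parent `none`,
and from every node one leaves the forest (through a root) after finitely many steps upwards. -/
structure RootedForest (N : Type*) where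
  parent : N → Option N
  reaches_root : ∀ x : N, ∃ k : ℕ, (parentStep parent)^[k] (some x) = none

namespace RootedForest

variable {N : Type*}

/-- `F.IsAncestor x y`: the node `x` is a (proper) ancestor of the node `y`. -/
def IsAncestor (F : RootedForest N) (x y : N) : Prop :=
  Relation.TransGen (fun a b => F.parent b = some a) x y

open Classical in
/-- The depth of a node: the number of nodes on the path between it and the root of its tree, so
that a root has depth one. -/
noncomputable def depth (F : RootedForest N) (x : N) : ℕ :=
  Nat.find (F.reaches_root x)

/-- The height of a finite forest: the maximum depth of a node (zero for the empty forest). -/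
noncomputable def height [Fintype N] (F : RootedForest N) : ℕ :=
  Finset.univ.sup F.depth

end RootedForest

/-- `(F, ψ)` is a treedepth decomposition of `G`: the map `ψ` from vertices to nodes is injective
and of the two images of adjacent vertices one is an ancestor of the other. -/
def IsTreedepthDecomposition {V N : Type*} (G : SimpleGraph V) (F : RootedForest N)
    (ψ : V → N) : Prop :=
  Function.Injective ψ ∧
    ∀ u v : V, G.Adj u v → F.IsAncestor (ψ u) (ψ v) ∨ F.IsAncestor (ψ v) (ψ u)

/-- The treedepth of a finite graph: the minimum height of a treedepth decomposition. (A finite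
forest can be taken to have the node set `Fin N`.) -/
noncomputable def treedepth {V : Type*} (G : SimpleGraph V) : ℕ :=
  sInf {h : ℕ | ∃ (N : ℕ) (F : RootedForest (Fin N)) (ψ : V → Fin N),
    IsTreedepthDecomposition G F ψ ∧ F.height = h}

/-! ## A word RAM with a step count

The machine has finitely many registers (those that occur in the program), a random access
working memory of `S` cells, and a read-only random access input. All of them hold natural
numbers below `2 ^ w`, where `w` is the word length. The program does not depend on `w` or `S`, and
has to respect them: a computation in which a value does not fit into a word, or which uses a
memory cell outside of the `S` available ones, gets stuck. -/

namespace WordRAM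

/-- The arithmetic operations on words: addition, subtraction (truncated at zero),
multiplication, quotient, remainder, and the comparisons `<` and `=` (with values `0` and `1`). -/
inductive Op where
  | add | sub | mul | div | mod | lt | eq

/-- The value of an arithmetic operation. -/
def Op.eval : Op → ℕ → ℕ → ℕ
  | add, a, b => a + b
  | sub, a, b => a - b
  | mul, a, b => a * b
  | div, a, b => a / b
  | mod, a, b => a % b
  | lt, a, b => if a < b then 1 else 0
  | eq, a, b => if a = b then 1 else 0

/-- Expressions: constants, registers, arithmetic, memory cells and input cells (both of them
with a computed address). -/
inductive Expr where
  | lit (k : ℕ)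
  | reg (x : ℕ)
  | op (o : Op) (a b : Expr)
  | mem (a : Expr)
  | input (a : Expr)

/-- The contents of the registers and of the working memory. -/
structure State where
  reg : ℕ → ℕ
  mem : ℕ → ℕ

/-- At the start all registers and memory cells are zero. -/
def State.init : State := ⟨fun _ => 0, fun _ => 0⟩

namespace Expr

/-- The value of an expression (input cells behind the end of the input read as zero). -/
def eval (inp : List ℕ) (s : State) : Expr → ℕ
  | lit k => k
  | reg x => s.reg x
  | op o a b => o.eval (a.eval inp s) (b.eval inp s)
  | mem a => s.mem (a.eval inp s)
  | input a => inp.getD (a.eval inp s) 0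

/-- The number of steps for the evaluation of an expression: one for each constant, each register
access, each arithmetic operation, each memory access and each input access. -/
def cost : Expr → ℕ
  | lit _ => 1
  | reg _ => 1
  | op _ a b => a.cost + b.cost + 1
  | mem a => a.cost + 1
  | input a => a.cost + 1

/-- The value of an expression and of all its subexpressions fit into words of length `w`, and all
memory cells that it reads are among the first `S` ones. -/
def Fits (w S : ℕ) (inp : List ℕ) (s : State) : Expr → Prop
  | lit k => k < 2 ^ w
  | reg x => s.reg x < 2 ^ w
  | op o a b => a.Fits w S inp s ∧ b.Fits w S inp s ∧ o.eval (a.eval inp s) (b.eval inp s) < 2 ^ w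
  | mem a => a.Fits w S inp s ∧ a.eval inp s < S ∧ s.mem (a.eval inp s) < 2 ^ w
  | input a => a.Fits w S inp s ∧ inp.getD (a.eval inp s) 0 < 2 ^ w

end Expr

/-- Programs: assignment to a register, writing to a memory cell with a computed
address, sequential composition, branching and loops (zero means false). -/
inductive Program where
  | skip
  | assign (x : ℕ) (e : Expr)
  | store (a e : Expr)
  | seq (p q : Program)
  | ite (e : Expr) (p q : Program)
  | while (e : Expr) (p : Program)

/-- `Exec w S inp p s T s'`: with word length `w`, with `S` memory cells and on the input `inp`, the
program `p` started in the state `s` halts in the state `s'` after `T` steps. -/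
inductive Exec (w S : ℕ) (inp : List ℕ) : Program → State → ℕ → State → Prop
  | skip (s : State) : Exec w S inp .skip s 1 s
  | assign (s : State) (x : ℕ) (e : Expr) :
      e.Fits w S inp s →
      Exec w S inp (.assign x e) s (e.cost + 1) ⟨Function.update s.reg x (e.eval inp s), s.mem⟩
  | store (s : State) (a e : Expr) :
      a.Fits w S inp s → e.Fits w S inp s → a.eval inp s < S →
      Exec w S inp (.store a e) s (a.cost + e.cost + 1)
        ⟨s.reg, Function.update s.mem (a.eval inp s) (e.eval inp s)⟩
  | seq (s s₁ s₂ : State) (p q : Program) (T₁ T₂ : ℕ) :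
      Exec w S inp p s T₁ s₁ → Exec w S inp q s₁ T₂ s₂ →
      Exec w S inp (.seq p q) s (T₁ + T₂) s₂
  | iteTrue (s s' : State) (e : Expr) (p q : Program) (T : ℕ) :
      e.Fits w S inp s → e.eval inp s ≠ 0 → Exec w S inp p s T s' →
      Exec w S inp (.ite e p q) s (e.cost + 1 + T) s'
  | iteFalse (s s' : State) (e : Expr) (p q : Program) (T : ℕ) :
      e.Fits w S inp s → e.eval inp s = 0 → Exec w S inp q s T s' →
      Exec w S inp (.ite e p q) s (e.cost + 1 + T) s'
  | whileTrue (s s₁ s₂ : State) (e : Expr) (p : Program) (T₁ T₂ : ℕ) :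
      e.Fits w S inp s → e.eval inp s ≠ 0 →
      Exec w S inp p s T₁ s₁ → Exec w S inp (.while e p) s₁ T₂ s₂ →
      Exec w S inp (.while e p) s (e.cost + 1 + T₁ + T₂) s₂
  | whileFalse (s : State) (e : Expr) (p : Program) :
      e.Fits w S inp s → e.eval inp s = 0 →
      Exec w S inp (.while e p) s (e.cost + 1) s

/-- With `S` memory cells, the first cells of the memory hold the word sequence `out`. -/
def Outputs (S : ℕ) (s : State) (out : List ℕ) : Prop :=
  out.length ≤ S ∧ ∀ i : ℕ, ∀ h : i < out.length, s.mem i = out[i]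

end WordRAM

/-! ## Input and output -/

/-- `adj` consists of adjacency lists of `G`: the list `adj v` contains the neighbours of `v`, each
of them once, in an arbitrary order. -/
def IsAdjacencyLists {n : ℕ} (G : SimpleGraph (Fin n)) (adj : Fin n → List (Fin n)) : Prop :=
  ∀ v : Fin n, (adj v).Nodup ∧ ∀ u : Fin n, u ∈ adj v ↔ G.Adj v u

/-- The input of the machine for the parameter `t` and a graph with vertices `0, …, n - 1` in
adjacency list representation: the word `t`, the word `n`, the `n + 1` words `d₀, …, dₙ` where `dᵢ`
is the total length of the adjacency lists of the vertices less than `i`, and then the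
adjacency lists of the vertices `0, …, n - 1` one after the other. So the
list of the vertex `v` occupies the input cells from `n + 3 + dᵥ` up to, but not including,
`n + 3 + dᵥ₊₁`. -/
def encodeInput {n : ℕ} (t : ℕ) (adj : Fin n → List (Fin n)) : List ℕ :=
  [t, n] ++
    (List.range (n + 1)).map (fun i => ∑ v : Fin n, if (v : ℕ) < i then (adj v).length else 0) ++
    (List.ofFn adj).flatten.map (fun u => (u : ℕ))

/-- A pair `(F, ψ)` as a sequence of words: the number `N` of nodes, for every node the word `0` if
it is a root and the word `p + 1` if its parent is `p`, and then for every vertex its image. -/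
def encodeDecomposition {n N : ℕ} (F : RootedForest (Fin N)) (ψ : Fin n → Fin N) : List ℕ :=
  [N] ++ List.ofFn (fun x => (F.parent x).elim 0 (fun p => (p : ℕ) + 1)) ++
    List.ofFn (fun v => (ψ v : ℕ))

/-- The function `C · 2 ^ (C · t log t) · n`; since no computation takes zero steps, `n` is replaced
by `1` for the graph without vertices. (In Lean `0 * log 0 = 0`.) -/
noncomputable def resourceBound (C t n : ℕ) : ℝ :=
  C * (2 : ℝ) ^ (C * (t * Real.logb 2 t)) * max (n : ℝ) 1

/-! Chordality enters through maximum cardinality search only: in a chordal graph the search yields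
an order in which the earlier neighbours of every vertex form a clique
(`IsChordal.adj_of_search_order`). The vertices of a clique lie at distinct depths of a treedepth
decomposition, so a clique has at most `t` vertices if the treedepth is at most `t`
(`card_le_of_isClique`). Hence an unvisited vertex with `t` visited neighbours certifies the answer
no, and so does a degree sum above `2tn` (`sum_degree_le`). Otherwise call `v` together with its
earlier neighbours the bag of `v`. It has at most `t` vertices, and without `v` it is contained in
the bag of the parent of `v`, the latest earlier neighbour. A greedy colouring along the order with
`t` colours is injective on every bag.

Say that a node of depth `d` has height `t - d`. The images of a bag lie on one upward path, so the
way in which the bag sits in a decomposition is described by `t` digits in base `t + 2`: the place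
at height `j` is free (`0`), taken by a forgotten vertex (`1`), or taken by the bag vertex of a
given colour (at least `2`). When the bag of `v` is merged into that of its parent, `v` is
forgotten. Colours of the remaining vertices must agree. A place above a remaining vertex that is
taken by `v` or by an already forgotten vertex must be free in the parent, and becomes a `1`.
Whatever lies below all remaining vertices branches off the path and plays no further role.

Completeness (`exists_reach`): a given decomposition supplies a state for every bag. A conflict in a
merge would be about one vertex, since a node has only one ancestor of a given height, and this
vertex would belong to the subtrees of two siblings, or both to the parent's bag and to the child's
subtree. Soundness (`IsTrace.exists_decomposition`): undoing the merges gives an initial state for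
every bag. The path of a bag consists of `t` nodes, which are identified with those of the parent
bag at the heights above a remaining vertex and are new below. A vertex is mapped to the node at the
place of its colour. Two vertices never share a node, because a place of a bag changes from `0` to
`1` in at most one merge.

There are `(t + 2) ^ t` states, and all triples of states are tested for each merge, so the work is
`n` times the cube of this number times a polynomial in `t`. Since `(t + 2) ^ t ≤ 9 (t ^ t) ^ 2`
(`add_two_pow_le`), this has the form required. The search runs in time `O(tn)` by means of a bucket
queue and a potential argument (`searchStep_spec`). The algorithm is written in a small language of
counting loops over arrays, in which safety and cost are derived by weakest preconditions, and
`AProg.compile_spec` carries both over to the word RAM. -/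

/-! ## A language of counting loops over arrays -/

namespace ArrayMachine

open WordRAM (Op)

/-- Expressions over registers, numbered arrays and the read-only input. -/
inductive AExpr where
  | lit (k : ℕ)
  | reg (x : ℕ)
  | op (o : Op) (a b : AExpr)
  | arr (k : ℕ) (a : AExpr)
  | input (a : AExpr)

/-- Programs with counting loops: `loop x y p` runs `p` for `x = 0, 1, …` below the value of the
register `y`. -/
inductive AProg where
  | skip
  | assign (x : ℕ) (e : AExpr)
  | store (k : ℕ) (a e : AExpr)
  | seq (p q : AProg)
  | ite (e : AExpr) (p q : AProg)
  | loop (x y : ℕ) (p : AProg)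

/-- The contents of registers and arrays. -/
structure AState where
  reg : ℕ → ℕ
  arr : ℕ → ℕ → ℕ

namespace AState

def setReg (s : AState) (x v : ℕ) : AState := ⟨Function.update s.reg x v, s.arr⟩

def setArr (s : AState) (k i v : ℕ) : AState :=
  ⟨s.reg, Function.update s.arr k (Function.update (s.arr k) i v)⟩

@[simp] theorem reg_setReg (s : AState) (x v y : ℕ) :
    (s.setReg x v).reg y = if y = x then v else s.reg y := by
  simp [setReg, Function.update_apply]

@[simp] theorem arr_setReg (s : AState) (x v : ℕ) : (s.setReg x v).arr = s.arr := rfl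

@[simp] theorem reg_setArr (s : AState) (k i v : ℕ) : (s.setArr k i v).reg = s.reg := rfl

@[simp] theorem arr_setArr (s : AState) (k i v k' : ℕ) :
    (s.setArr k i v).arr k' = if k' = k then Function.update (s.arr k) i v else s.arr k' := by
  simp [setArr, Function.update_apply]

def Bdd (B : ℕ) (s : AState) : Prop := (∀ x, s.reg x ≤ B) ∧ ∀ k i, s.arr k i ≤ B

theorem Bdd.setReg {B : ℕ} {s : AState} (h : s.Bdd B) {x v : ℕ} (hv : v ≤ B) :
    (s.setReg x v).Bdd B := by
  refine ⟨fun y => ?_, h.2⟩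
  rw [reg_setReg]
  split_ifs
  exacts [hv, h.1 y]

theorem Bdd.setArr {B : ℕ} {s : AState} (h : s.Bdd B) {k i v : ℕ} (hv : v ≤ B) :
    (s.setArr k i v).Bdd B := by
  refine ⟨h.1, fun k' i' => ?_⟩
  rw [arr_setArr]
  split_ifs
  · rw [Function.update_apply]
    split_ifs
    exacts [hv, h.2 k i']
  · exact h.2 k' i'

/-- The state in which all registers and array cells are zero. -/
def init : AState := ⟨fun _ => 0, fun _ _ => 0⟩

end AState

/-- The input, the sizes of the arrays, and a bound for all values that may be stored. -/
structure Env where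
  inp : List ℕ
  M : ℕ → ℕ
  B : ℕ

namespace AExpr

def eval (E : Env) (s : AState) : AExpr → ℕ
  | lit k => k
  | reg x => s.reg x
  | op o a b => o.eval (a.eval E s) (b.eval E s)
  | arr k a => s.arr k (a.eval E s)
  | input a => E.inp.getD (a.eval E s) 0

/-- All array accesses are within the array bounds. -/
def Safe (E : Env) (s : AState) : AExpr → Prop
  | lit _ => True
  | reg _ => True
  | op _ a b => a.Safe E s ∧ b.Safe E s
  | arr k a => a.Safe E s ∧ a.eval E s < E.M k
  | input a => a.Safe E s

def size : AExpr → ℕ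
  | lit _ => 1
  | reg _ => 1
  | op _ a b => a.size + b.size + 1
  | arr _ a => a.size + 1
  | input a => a.size + 1

/-- Literals and array numbers are below 16. -/
def wf : AExpr → Bool
  | lit k => decide (k < 16)
  | reg _ => true
  | op _ a b => a.wf && b.wf
  | arr k a => decide (k < 16) && a.wf
  | input a => a.wf

/-- Register `0` of the machine is reserved for the address where the interleaved arrays begin,
hence the shift of register numbers. Interleaving with the fixed stride `16` frees the program from
knowing the array sizes, which depend on the input. Array `0` is separate because the output has to
start the memory. -/
def compile : AExpr → WordRAM.Expr
  | lit k => .lit k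
  | reg x => .reg (x + 1)
  | op o a b => .op o a.compile b.compile
  | arr 0 a => .mem a.compile
  | arr (k + 1) a => .mem (.op .add (.reg 0) (.op .add (.op .mul (.lit 16) a.compile) (.lit (k + 1))))
  | input a => .input a.compile

end AExpr

namespace AProg

open AExpr

/-- The number of rounds is fixed on entry to a loop. This agrees with the `while` loop of `compile`
because `wf` forbids the body to write the counter or the bound. -/
def den (E : Env) : AProg → AState → AState
  | skip, s => s
  | assign x e, s => s.setReg x (e.eval E s)
  | store k a e, s => s.setArr k (a.eval E s) (e.eval E s)
  | seq p q, s => q.den E (p.den E s)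
  | ite e p q, s => if e.eval E s ≠ 0 then p.den E s else q.den E s
  | loop x y p, s =>
      (fun s => (p.den E s).setReg x ((p.den E s).reg x + 1))^[s.reg y] (s.setReg x 0)

/-- The state of a loop with counter `x` and body `p` after `i` rounds. -/
def iter (E : Env) (x : ℕ) (p : AProg) (s : AState) (i : ℕ) : AState :=
  (fun s => (p.den E s).setReg x ((p.den E s).reg x + 1))^[i] (s.setReg x 0)

/-- The number of elementary statements executed. -/
def cost (E : Env) : AProg → AState → ℕ
  | skip, _ => 1
  | assign _ _, _ => 1
  | store _ _ _, _ => 1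
  | seq p q, s => p.cost E s + q.cost E (p.den E s)
  | ite e p q, s => if e.eval E s ≠ 0 then p.cost E s + 1 else q.cost E s + 1
  | loop x y p, s => ∑ i ∈ Finset.range (s.reg y), (p.cost E (iter E x p s i) + 2) + 2

/-- Only stored values have to be at most `B`. Intermediate values are controlled by the size of the
expression, see `AExpr.eval_le`. -/
def Ok (E : Env) : AProg → AState → Prop
  | skip, _ => True
  | assign _ e, s => e.Safe E s ∧ e.eval E s ≤ E.B
  | store k a e, s => a.Safe E s ∧ e.Safe E s ∧ a.eval E s < E.M k ∧ e.eval E s ≤ E.B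
  | seq p q, s => p.Ok E s ∧ q.Ok E (p.den E s)
  | ite e p q, s => e.Safe E s ∧ if e.eval E s ≠ 0 then p.Ok E s else q.Ok E s
  | loop x y p, s => ∀ i < s.reg y, p.Ok E (iter E x p s i)

def writesReg : AProg → ℕ → Bool
  | skip, _ => false
  | assign x _, z => z == x
  | store _ _ _, _ => false
  | seq p q, z => p.writesReg z || q.writesReg z
  | ite _ p q, z => p.writesReg z || q.writesReg z
  | loop x _ p, z => z == x || p.writesReg z

def writesArr : AProg → ℕ → Bool
  | skip, _ => false
  | assign _ _, _ => false
  | store k _ _, z => z == k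
  | seq p q, z => p.writesArr z || q.writesArr z
  | ite _ p q, z => p.writesArr z || q.writesArr z
  | loop _ _ p, z => p.writesArr z

/-- Expressions have size below 24, and loop bodies write neither their counter nor their bound. -/
def wf : AProg → Bool
  | skip => true
  | assign _ e => e.wf && decide (e.size < 24)
  | store k a e => decide (k < 16) && a.wf && decide (a.size < 24) && e.wf && decide (e.size < 24)
  | seq p q => p.wf && q.wf
  | ite e p q => e.wf && decide (e.size < 24) && p.wf && q.wf
  | loop x y p => p.wf && !p.writesReg x && !p.writesReg y && !(x == y)

def compile : AProg → WordRAM.Program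
  | skip => .skip
  | assign x e => .assign (x + 1) e.compile
  | store 0 a e => .store a.compile e.compile
  | store (k + 1) a e =>
      .store (.op .add (.reg 0) (.op .add (.op .mul (.lit 16) a.compile) (.lit (k + 1)))) e.compile
  | seq p q => .seq p.compile q.compile
  | ite e p q => .ite e.compile p.compile q.compile
  | loop x y p => .seq (.assign (x + 1) (.lit 0))
      (.while (.op .lt (.reg (x + 1)) (.reg (y + 1)))
        (.seq p.compile (.assign (x + 1) (.op .add (.reg (x + 1)) (.lit 1)))))

theorem iter_zero (E : Env) (x : ℕ) (p : AProg) (s : AState) : iter E x p s 0 = s.setReg x 0 := rfl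

theorem iter_succ (E : Env) (x : ℕ) (p : AProg) (s : AState) (i : ℕ) :
    iter E x p s (i + 1) = (p.den E (iter E x p s i)).setReg x ((p.den E (iter E x p s i)).reg x + 1) := by
  simp only [iter, Function.iterate_succ_apply']

theorem den_loop (E : Env) (x y : ℕ) (p : AProg) (s : AState) :
    (loop x y p).den E s = iter E x p s (s.reg y) := rfl

theorem den_reg_of_not_writes (E : Env) (p : AProg) (z : ℕ) (h : p.writesReg z = false)
    (s : AState) : (p.den E s).reg z = s.reg z := by
  induction p generalizing s with
  | skip => rfl
  | assign x e => simp_all [den, writesReg]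
  | store k a e => simp [den]
  | seq p q ihp ihq =>
    simp only [writesReg, Bool.or_eq_false_iff] at h
    simp only [den]
    rw [ihq h.2, ihp h.1]
  | ite e p q ihp ihq =>
    simp only [writesReg, Bool.or_eq_false_iff] at h
    simp only [den]
    split_ifs
    exacts [ihp h.1 s, ihq h.2 s]
  | loop x y p ih =>
    simp only [writesReg, Bool.or_eq_false_iff, beq_eq_false_iff_ne] at h
    rw [den_loop]
    generalize s.reg y = N
    induction N with
    | zero => simp [iter_zero, h.1]
    | succ N ihN => rw [iter_succ, AState.reg_setReg, if_neg h.1, ih h.2, ihN]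

theorem den_arr_of_not_writes (E : Env) (p : AProg) (z : ℕ) (h : p.writesArr z = false)
    (s : AState) : (p.den E s).arr z = s.arr z := by
  induction p generalizing s with
  | skip => rfl
  | assign x e => rfl
  | store k a e =>
    simp only [writesArr, beq_eq_false_iff_ne] at h
    simp [den, h]
  | seq p q ihp ihq =>
    simp only [writesArr, Bool.or_eq_false_iff] at h
    simp only [den]
    rw [ihq h.2, ihp h.1]
  | ite e p q ihp ihq =>
    simp only [writesArr, Bool.or_eq_false_iff] at h
    simp only [den]
    split_ifs
    exacts [ihp h.1 s, ihq h.2 s]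
  | loop x y p ih =>
    simp only [writesArr] at h
    rw [den_loop]
    generalize s.reg y = N
    induction N with
    | zero => simp [iter_zero]
    | succ N ihN => rw [iter_succ, AState.arr_setReg, ih h, ihN]

theorem iter_reg_counter (E : Env) (x : ℕ) (p : AProg) (hx : p.writesReg x = false) (s : AState)
    (i : ℕ) : (iter E x p s i).reg x = i := by
  induction i with
  | zero => simp [iter_zero]
  | succ i ih => rw [iter_succ, AState.reg_setReg, if_pos rfl, den_reg_of_not_writes E p x hx, ih]

theorem iter_reg (E : Env) (x : ℕ) (p : AProg) (s : AState) (i z : ℕ) (hz : z ≠ x)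
    (h : p.writesReg z = false) : (iter E x p s i).reg z = s.reg z := by
  induction i with
  | zero => simp [iter_zero, hz]
  | succ i ih => rw [iter_succ, AState.reg_setReg, if_neg hz, den_reg_of_not_writes E p z h, ih]

theorem iter_arr (E : Env) (x : ℕ) (p : AProg) (s : AState) (i z : ℕ)
    (h : p.writesArr z = false) : (iter E x p s i).arr z = s.arr z := by
  induction i with
  | zero => simp [iter_zero]
  | succ i ih => rw [iter_succ, AState.arr_setReg, den_arr_of_not_writes E p z h, ih]

/-! ### Weakest preconditions with costs -/

/-- The weakest precondition: `p` runs safely from `s`, and `Q` holds for its cost and its final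
state. -/
def WP (E : Env) (p : AProg) (s : AState) (Q : ℕ → AState → Prop) : Prop :=
  p.Ok E s ∧ Q (p.cost E s) (p.den E s)

section WP

variable {E : Env} {s : AState} {Q : ℕ → AState → Prop}

theorem WP_skip : WP E .skip s Q ↔ Q 1 s := by simp [WP, Ok, den, cost]

theorem WP_assign {x : ℕ} {e : AExpr} : WP E (.assign x e) s Q ↔
    (e.Safe E s ∧ e.eval E s ≤ E.B) ∧ Q 1 (s.setReg x (e.eval E s)) := by
  simp [WP, Ok, den, cost]

theorem WP_store {k : ℕ} {a e : AExpr} : WP E (.store k a e) s Q ↔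
    (a.Safe E s ∧ e.Safe E s ∧ a.eval E s < E.M k ∧ e.eval E s ≤ E.B) ∧
      Q 1 (s.setArr k (a.eval E s) (e.eval E s)) := by
  simp [WP, Ok, den, cost]

theorem WP_seq {p q : AProg} : WP E (.seq p q) s Q ↔
    WP E p s fun c s' => WP E q s' fun c' s'' => Q (c + c') s'' := by
  simp [WP, Ok, den, cost, and_assoc]

theorem WP_ite {e : AExpr} {p q : AProg} : WP E (.ite e p q) s Q ↔
    e.Safe E s ∧ ((e.eval E s ≠ 0 → WP E p s fun c s' => Q (c + 1) s') ∧
      (e.eval E s = 0 → WP E q s fun c s' => Q (c + 1) s')) := by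
  by_cases h : e.eval E s = 0 <;> simp [WP, Ok, den, cost, h, and_assoc]

theorem WP.mono {p : AProg} {Q' : ℕ → AState → Prop} (h : WP E p s Q)
    (hQ : ∀ c s', Q c s' → Q' c s') : WP E p s Q' := ⟨h.1, hQ _ _ h.2⟩

/-- Registers other than `xs` and arrays that `p` does not write are the same in `s` and `s'`. -/
structure Frame (p : AProg) (xs : List ℕ) (s s' : AState) : Prop where
  reg : ∀ z, z ∉ xs → p.writesReg z = false → s'.reg z = s.reg z
  arr : ∀ z, p.writesArr z = false → s'.arr z = s.arr z

/-- That something is not written can be read off the program text. Specifications therefore only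
speak of what changes, and everything else is recovered from here. -/
theorem WP.frame {p : AProg} {Q' : ℕ → AState → Prop} (h : WP E p s Q)
    (hQ : ∀ c s', Frame p [] s s' → Q c s' → Q' c s') : WP E p s Q' :=
  ⟨h.1, hQ _ _ ⟨fun z _ hz => den_reg_of_not_writes E p z hz s,
    fun z hz => den_arr_of_not_writes E p z hz s⟩ h.2⟩

/-- The invariant sees the cost so far, which makes amortised bounds possible; `WP_loop` is the case
of a uniform bound for each round. -/
theorem WP_loop_cost {x y : ℕ} {p : AProg} (I : ℕ → ℕ → AState → Prop)
    (hx : p.writesReg x = false) (hy : p.writesReg y = false) (hxy : x ≠ y)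
    (h0 : I 0 0 (s.setReg x 0))
    (hs : ∀ i c s', i < s.reg y → s'.reg x = i → s'.reg y = s.reg y → Frame p [x] s s' → I i c s' →
      WP E p s' fun c' s'' => I (i + 1) (c + c' + 2) (s''.setReg x (i + 1)))
    (hQ : ∀ c s', s'.reg x = s.reg y → Frame p [x] s s' → I (s.reg y) c s' → Q (c + 2) s') :
    WP E (.loop x y p) s Q := by
  have fr : ∀ i, Frame p [x] s (iter E x p s i) := fun i =>
    ⟨fun z hz h => iter_reg E x p s i z (by simpa using hz) h, fun z h => iter_arr E x p s i z h⟩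
  have key : ∀ i, i ≤ s.reg y → (∀ i' < i, p.Ok E (iter E x p s i')) ∧
      I i (∑ i' ∈ Finset.range i, (p.cost E (iter E x p s i') + 2)) (iter E x p s i) := by
    intro i
    induction i with
    | zero => intro _; simpa [iter_zero] using h0
    | succ i ih =>
      intro hi
      obtain ⟨h1, h2⟩ := ih (by omega)
      have h3 := hs i _ _ (by omega) (iter_reg_counter E x p hx s i)
        (iter_reg E x p s i y hxy.symm hy) (fr i) h2
      refine ⟨fun i' hi' => ?_, ?_⟩
      · rcases Nat.lt_succ_iff_lt_or_eq.mp hi' with h | rfl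
        · exact h1 i' h
        · exact h3.1
      · rw [Finset.sum_range_succ, iter_succ, den_reg_of_not_writes E p x hx,
          iter_reg_counter E x p hx, ← add_assoc]
        exact h3.2
  obtain ⟨h1, h2⟩ := key _ le_rfl
  exact ⟨h1, hQ _ _ (iter_reg_counter E x p hx s _) (fr _) h2⟩

theorem WP_loop {x y : ℕ} {p : AProg} (K : ℕ) (I : ℕ → AState → Prop)
    (hx : p.writesReg x = false) (hy : p.writesReg y = false) (hxy : x ≠ y)
    (h0 : I 0 (s.setReg x 0))
    (hs : ∀ i s', i < s.reg y → s'.reg x = i → s'.reg y = s.reg y → Frame p [x] s s' → I i s' →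
      WP E p s' fun c s'' => c ≤ K ∧ I (i + 1) (s''.setReg x (i + 1)))
    (hQ : ∀ c s', c ≤ s.reg y * (K + 2) + 2 → s'.reg x = s.reg y → Frame p [x] s s' →
      I (s.reg y) s' → Q c s') :
    WP E (.loop x y p) s Q := by
  refine WP_loop_cost (fun i c s' => c ≤ i * (K + 2) ∧ I i s') hx hy hxy ⟨by simp, h0⟩ ?_ ?_
  · rintro i c s' hi h1 h2 h3 ⟨h4, h5⟩
    refine (hs i s' hi h1 h2 h3 h5).mono fun c' s'' h => ⟨?_, h.2⟩
    have := h.1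
    rw [add_mul]
    omega
  · rintro c s' h1 h2 ⟨h3, h4⟩
    exact hQ _ _ (by omega) h1 h2 h4

end WP

end AProg

end ArrayMachine

/-! ### Compilation to the word RAM -/

namespace ArrayMachine

open WordRAM (Op)

/-- Word length `w` and memory size `S` suffice for the environment, with the array `0` at the
start of the memory and the others interleaved from the address `L` on. -/
structure Env.Fits (E : Env) (L w S : ℕ) : Prop where
  B_ge : 16 ≤ E.B
  M_zero : E.M 0 ≤ L
  L_le : L ≤ S
  M_succ : ∀ k, L + (16 * E.M (k + 1) + 16) ≤ S
  S_lt : S < 2 ^ w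
  B_lt : E.B ^ 24 < 2 ^ w
  inp_le : ∀ a, E.inp.getD a 0 ≤ E.B

structure Represents (E : Env) (L : ℕ) (c : WordRAM.State) (s : AState) : Prop where
  base : c.reg 0 = L
  reg : ∀ x, c.reg (x + 1) = s.reg x
  mem_zero : ∀ i < E.M 0, c.mem i = s.arr 0 i
  mem_succ : ∀ k i, k + 1 < 16 → i < E.M (k + 1) → c.mem (L + (16 * i + (k + 1))) = s.arr (k + 1) i

variable {E : Env} {L w S : ℕ}

/-- Multiplication is the worst case, and there exponents add. So the exponent of the bound grows
like the size of an expression. -/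
theorem _root_.WordRAM.Op.eval_le (o : Op) {a b B i j : ℕ} (hB : 2 ≤ B) (hi : 1 ≤ i) (hj : 1 ≤ j)
    (ha : a ≤ B ^ i) (hb : b ≤ B ^ j) : o.eval a b ≤ B ^ (i + j + 1) := by
  have h1 : 2 ≤ B ^ i := hB.trans (Nat.le_self_pow (by omega) B)
  have h2 : 2 ≤ B ^ j := hB.trans (Nat.le_self_pow (by omega) B)
  have h3 : B ^ i + B ^ j ≤ B ^ i * B ^ j := by nlinarith
  have h4 : B ^ i * B ^ j ≤ B ^ (i + j + 1) := by
    rw [← pow_add]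
    exact Nat.pow_le_pow_right (by omega) (by omega)
  have h5 : a * b ≤ B ^ i * B ^ j := Nat.mul_le_mul ha hb
  cases o <;> simp only [Op.eval]
  · omega
  · omega
  · omega
  · exact (Nat.div_le_self a b).trans (by omega)
  · exact (Nat.mod_le a b).trans (by omega)
  · split_ifs <;> omega
  · split_ifs <;> omega

theorem AExpr.size_pos (e : AExpr) : 1 ≤ e.size := by cases e <;> simp [AExpr.size]

theorem AExpr.eval_le (hF : E.Fits L w S) {s : AState} (hs : s.Bdd E.B) (e : AExpr)
    (hw : e.wf = true) : e.eval E s ≤ E.B ^ e.size := by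
  have hB := hF.B_ge
  have hB' : ∀ {i : ℕ}, 1 ≤ i → E.B ≤ E.B ^ i := fun hi => Nat.le_self_pow (by omega) _
  induction e with
  | lit k =>
    simp only [wf, decide_eq_true_eq] at hw
    simp only [eval, size, pow_one]
    omega
  | reg x => simpa [eval, size] using hs.1 x
  | op o a b iha ihb =>
    simp only [wf, Bool.and_eq_true] at hw
    exact Op.eval_le o (by omega) a.size_pos b.size_pos (iha hw.1) (ihb hw.2)
  | arr k a _ => exact (hs.2 _ _).trans (hB' (size_pos _))
  | input a _ => exact (hF.inp_le _).trans (hB' (size_pos _))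

theorem AExpr.lt_word (hF : E.Fits L w S) {s : AState} (hs : s.Bdd E.B) (e : AExpr)
    (hw : e.wf = true) (hsz : e.size < 24) : e.eval E s < 2 ^ w :=
  ((e.eval_le hF hs hw).trans (Nat.pow_le_pow_right (by have := hF.B_ge; omega) hsz.le)).trans_lt
    hF.B_lt

theorem lit_lt_word (hF : E.Fits L w S) {k : ℕ} (hk : k ≤ 16) : k < 2 ^ w :=
  hk.trans_lt (hF.B_ge.trans_lt
    ((Nat.le_self_pow (by norm_num) _).trans_lt hF.B_lt))

/-- An array access takes at most seven steps besides the evaluation of its index, which the factor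
`8` covers. -/
theorem AExpr.compile_spec (hF : E.Fits L w S) {s : AState} (hs : s.Bdd E.B) {c : WordRAM.State}
    (hc : Represents E L c s) (e : AExpr) (hw : e.wf = true) (hsz : e.size < 24)
    (hsafe : e.Safe E s) :
    e.compile.eval E.inp c = e.eval E s ∧ e.compile.Fits w S E.inp c ∧
      e.compile.cost ≤ 8 * e.size := by
  induction e with
  | lit k =>
    simp only [wf, decide_eq_true_eq] at hw
    exact ⟨rfl, lit_lt_word hF hw.le, by simp [compile, WordRAM.Expr.cost, size]⟩
  | reg x =>
    have := lt_word hF hs (.reg x) rfl hsz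
    refine ⟨hc.reg x, ?_, by simp [compile, WordRAM.Expr.cost, size]⟩
    simpa [compile, WordRAM.Expr.Fits, hc.reg x, eval] using this
  | op o a b iha ihb =>
    have hlt := lt_word hF hs _ hw hsz
    simp only [wf, Bool.and_eq_true] at hw
    simp only [size] at hsz
    obtain ⟨h1, h2, h3⟩ := iha hw.1 (by omega) hsafe.1
    obtain ⟨h4, h5, h6⟩ := ihb hw.2 (by omega) hsafe.2
    refine ⟨by simp [compile, WordRAM.Expr.eval, eval, h1, h4], ⟨h2, h5, ?_⟩, ?_⟩
    · rw [h1, h4]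
      exact hlt
    · simp only [compile, WordRAM.Expr.cost, size]
      omega
  | arr k a iha =>
    have hlt := lt_word hF hs _ hw hsz
    simp only [wf, Bool.and_eq_true, decide_eq_true_eq] at hw
    simp only [size] at hsz
    obtain ⟨h1, h2, h3⟩ := iha hw.2 (by omega) hsafe.1
    have hi := hsafe.2
    have hMS := hF.M_succ
    have hSw := hF.S_lt
    have hM0 := hF.M_zero
    have hLS := hF.L_le
    rcases k with _ | k
    · have hm : c.mem (a.eval E s) = s.arr 0 (a.eval E s) := hc.mem_zero _ hi
      refine ⟨by simp [compile, WordRAM.Expr.eval, eval, h1, hm], ⟨h2, ?_, ?_⟩, ?_⟩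
      · rw [h1]
        omega
      · rw [h1, hm]
        exact hlt
      · simp only [compile, WordRAM.Expr.cost, size]
        omega
    · have hm := hc.mem_succ k _ hw.1 hi
      specialize hMS k
      refine ⟨?_, ⟨⟨?_, ⟨⟨lit_lt_word hF le_rfl, h2, ?_⟩, lit_lt_word hF hw.1.le, ?_⟩, ?_⟩, ?_, ?_⟩, ?_⟩ <;>
        simp only [compile, WordRAM.Expr.eval, WordRAM.Expr.Fits, WordRAM.Expr.cost, eval, size,
          Op.eval, h1, hc.base] at *
      · exact hm
      · omega
      · omega
      · omega
      · omega
      · omega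
      · rw [hm]
        exact hlt
      · omega
  | input a iha =>
    have hlt := lt_word hF hs _ hw hsz
    simp only [size] at hsz
    obtain ⟨h1, h2, h3⟩ := iha hw (by omega) hsafe
    refine ⟨by simp [compile, WordRAM.Expr.eval, eval, h1], ⟨h2, ?_⟩, ?_⟩
    · rw [h1]
      exact hlt
    · simp only [compile, WordRAM.Expr.cost, size]
      omega

theorem Represents.setReg {c : WordRAM.State} {s : AState} (hc : Represents E L c s) (x v : ℕ) :
    Represents E L ⟨Function.update c.reg (x + 1) v, c.mem⟩ (s.setReg x v) where
  base := by simpa using hc.base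
  reg y := by
    simp only [Function.update_apply, AState.reg_setReg, add_left_inj]
    split_ifs
    exacts [rfl, hc.reg y]
  mem_zero := hc.mem_zero
  mem_succ := hc.mem_succ

theorem Represents.setArr_zero {c : WordRAM.State} {s : AState} (hF : E.Fits L w S)
    (hc : Represents E L c s) {i : ℕ} (hi : i < E.M 0) (v : ℕ) :
    Represents E L ⟨c.reg, Function.update c.mem i v⟩ (s.setArr 0 i v) where
  base := hc.base
  reg := hc.reg
  mem_zero j hj := by
    simp only [AState.arr_setArr, if_true, Function.update_apply]
    split_ifs
    exacts [rfl, hc.mem_zero j hj]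
  mem_succ k j hk hj := by
    have := hF.M_zero
    simp only [AState.arr_setArr, Function.update_apply]
    rw [if_neg (by omega), if_neg (by omega)]
    exact hc.mem_succ k j hk hj

/-- Relative to `L`, cells of different arrays have different residues modulo `16`, and array `0`
ends before `L`; so only one represented cell is affected. -/
theorem Represents.setArr_succ {c : WordRAM.State} {s : AState} (hF : E.Fits L w S)
    (hc : Represents E L c s) {k : ℕ} (i : ℕ) (hk : k + 1 < 16) (v : ℕ) :
    Represents E L ⟨c.reg, Function.update c.mem (L + (16 * i + (k + 1))) v⟩
      (s.setArr (k + 1) i v) where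
  base := hc.base
  reg := hc.reg
  mem_zero j hj := by
    have := hF.M_zero
    simp only [AState.arr_setArr, Function.update_apply]
    rw [if_neg (by omega), if_neg (by omega)]
    exact hc.mem_zero j hj
  mem_succ k' j hk' hj := by
    simp only [AState.arr_setArr, Function.update_apply]
    by_cases h : k' = k
    · subst h
      simp only [if_true, Function.update_apply]
      by_cases h' : j = i
      · simp [h']
      · rw [if_neg (by omega), if_neg h']
        exact hc.mem_succ k' j hk' hj
    · rw [if_neg (by omega), if_neg (by omega)]
      exact hc.mem_succ k' j hk' hj

open AProg in
-- A statement evaluates at most two expressions of size at most `23`, at `8` steps for each unit of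
-- size. With the address computation of a store this stays below `400`.
theorem AProg.compile_spec (hF : E.Fits L w S) (p : AProg) (hw : p.wf = true) (s : AState)
    (hs : s.Bdd E.B) (c : WordRAM.State) (hc : Represents E L c s) (hok : p.Ok E s) :
    (∃ T c', WordRAM.Exec w S E.inp p.compile c T c' ∧ T ≤ 400 * p.cost E s ∧
      Represents E L c' (p.den E s)) ∧ (p.den E s).Bdd E.B := by
  have hB := hF.B_ge
  induction p generalizing s c with
  | skip => exact ⟨⟨1, c, .skip c, by simp [cost], hc⟩, hs⟩
  | assign x e =>
    simp only [wf, Bool.and_eq_true, decide_eq_true_eq] at hw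
    obtain ⟨h1, h2, h3⟩ := e.compile_spec hF hs hc hw.1 hw.2 hok.1
    refine ⟨⟨_, _, .assign c (x + 1) e.compile h2, ?_, ?_⟩, hs.setReg hok.2⟩
    · simp only [cost]
      omega
    · rw [h1]
      exact hc.setReg x _
  | store k a e =>
    simp only [wf, Bool.and_eq_true, decide_eq_true_eq] at hw
    obtain ⟨⟨⟨⟨hk, hwa⟩, hsa⟩, hwe⟩, hse⟩ := hw
    obtain ⟨hok1, hok2, hok3, hok4⟩ := hok
    obtain ⟨h1, h2, h3⟩ := a.compile_spec hF hs hc hwa hsa hok1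
    obtain ⟨h4, h5, h6⟩ := e.compile_spec hF hs hc hwe hse hok2
    refine ⟨?_, hs.setArr hok4⟩
    have hMS := hF.M_succ
    have hSw := hF.S_lt
    have hM0 := hF.M_zero
    have hLS := hF.L_le
    rcases k with _ | k
    · refine ⟨_, _, .store c a.compile e.compile h2 h5 (by rw [h1]; omega), ?_, ?_⟩
      · simp only [cost]
        omega
      · rw [h1, h4]
        exact hc.setArr_zero hF hok3 _
    · specialize hMS k
      refine ⟨_, _, .store c _ e.compile
        ⟨?_, ⟨⟨lit_lt_word hF le_rfl, h2, ?_⟩, lit_lt_word hF hk.le, ?_⟩, ?_⟩ h5 ?_, ?_, ?_⟩ <;>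
        simp only [WordRAM.Expr.eval, WordRAM.Expr.Fits, WordRAM.Expr.cost, cost,
          Op.eval, h1, h4, hc.base]
      · omega
      · omega
      · omega
      · omega
      · omega
      · omega
      · exact hc.setArr_succ hF _ hk _
  | seq p q ihp ihq =>
    simp only [wf, Bool.and_eq_true] at hw
    obtain ⟨⟨T1, c1, hx1, hT1, hr1⟩, hb1⟩ := ihp hw.1 s hs c hc hok.1
    obtain ⟨⟨T2, c2, hx2, hT2, hr2⟩, hb2⟩ := ihq hw.2 _ hb1 c1 hr1 hok.2
    refine ⟨⟨_, c2, .seq _ _ _ _ _ _ _ hx1 hx2, ?_, hr2⟩, hb2⟩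
    simp only [cost]
    omega
  | ite e p q ihp ihq =>
    simp only [wf, Bool.and_eq_true, decide_eq_true_eq] at hw
    obtain ⟨⟨⟨hwe, hse⟩, hwp⟩, hwq⟩ := hw
    obtain ⟨hok1, hok2⟩ := hok
    obtain ⟨h1, h2, h3⟩ := e.compile_spec hF hs hc hwe hse hok1
    simp only [den, cost, ne_eq, ite_not] at hok2 ⊢
    by_cases h : e.eval E s = 0
    · simp only [h, if_true] at hok2 ⊢
      obtain ⟨⟨T1, c1, hx1, hT1, hr1⟩, hb1⟩ := ihq hwq s hs c hc hok2
      exact ⟨⟨_, c1, .iteFalse _ _ _ _ _ _ h2 (by rw [h1, h]) hx1, by omega, hr1⟩, hb1⟩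
    · simp only [h, if_false] at hok2 ⊢
      obtain ⟨⟨T1, c1, hx1, hT1, hr1⟩, hb1⟩ := ihp hwp s hs c hc hok2
      exact ⟨⟨_, c1, .iteTrue _ _ _ _ _ _ h2 (by rwa [h1]) hx1, by omega, hr1⟩, hb1⟩
  | loop x y p ih =>
    simp only [wf, Bool.and_eq_true, Bool.not_eq_true', beq_eq_false_iff_ne] at hw
    obtain ⟨⟨⟨hwp, hx⟩, hy⟩, hxy⟩ := hw
    have h1w : 1 < 2 ^ w := lit_lt_word hF (by norm_num)
    have hBw : E.B < 2 ^ w := (Nat.le_self_pow (by norm_num) _).trans_lt hF.B_lt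
    have hbi : ∀ i ≤ s.reg y, (iter E x p s i).Bdd E.B ∧ ∀ c, Represents E L c (iter E x p s i) →
        i < s.reg y → ∃ T c', WordRAM.Exec w S E.inp p.compile c T c' ∧
          T ≤ 400 * p.cost E (iter E x p s i) ∧ Represents E L c' (p.den E (iter E x p s i)) := by
      -- The induction hypothesis gives boundedness of the new state only in the presence of a
      -- machine state, so one is made up for each abstract state.
      have hrep : ∀ s : AState, ∃ c, Represents E L c s := fun s =>
        ⟨⟨fun x => x.casesOn L s.reg, fun a => if a < L then s.arr 0 a else
          s.arr ((a - L) % 16) ((a - L) / 16)⟩, rfl, fun _ => rfl, fun i hi => by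
            simp [hi.trans_le hF.M_zero], fun k i hk hi => by
              have h1 : (16 * i + (k + 1)) % 16 = k + 1 := by omega
              have h2 : (16 * i + (k + 1)) / 16 = i := by omega
              simp [h1, h2]⟩
      intro i
      induction i with
      | zero =>
        intro _
        have hb : (iter E x p s 0).Bdd E.B := by
          rw [iter_zero]
          exact hs.setReg (Nat.zero_le _)
        exact ⟨hb, fun c hc h0 => (ih hwp _ hb c hc (hok 0 h0)).1⟩
      | succ i ihi =>
        intro hi
        have hb : (iter E x p s (i + 1)).Bdd E.B := by
          rw [iter_succ, den_reg_of_not_writes E p x hx, iter_reg_counter E x p hx]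
          obtain ⟨c, hc⟩ := hrep (iter E x p s i)
          exact (ih hwp _ (ihi (by omega)).1 c hc (hok i hi)).2.setReg (hi.trans (hs.1 y))
        exact ⟨hb, fun c hc h0 => (ih hwp _ hb c hc (hok _ h0)).1⟩
    refine ⟨?_, (hbi _ le_rfl).1⟩
    -- Induction on the number `m` of remaining rounds; the summand `4` pays for the final, failing
    -- test.
    have hloop : ∀ m i, i + m = s.reg y → ∀ c, Represents E L c (iter E x p s i) →
        ∃ T c', WordRAM.Exec w S E.inp (.while (.op .lt (.reg (x + 1)) (.reg (y + 1)))
          (.seq p.compile (.assign (x + 1) (.op .add (.reg (x + 1)) (.lit 1))))) c T c' ∧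
          T ≤ 400 * ∑ j ∈ Finset.range m, (p.cost E (iter E x p s (i + j)) + 2) + 4 ∧
          Represents E L c' (iter E x p s (s.reg y)) := by
      intro m
      induction m with
      | zero =>
        intro i hi c hc
        have hrx : c.reg (x + 1) = i := by rw [hc.reg, iter_reg_counter E x p hx]
        have hry : c.reg (y + 1) = s.reg y := by
          rw [hc.reg, iter_reg E x p s i y (fun h => hxy h.symm) hy]
        have hiB : s.reg y ≤ E.B := hs.1 y
        refine ⟨_, c, .whileFalse c _ _ ?_ ?_, ?_, ?_⟩
        · simp only [WordRAM.Expr.Fits, WordRAM.Expr.eval, hrx, hry, Op.eval]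
          rw [if_neg (by omega)]
          omega
        · simp only [WordRAM.Expr.eval, hrx, hry, Op.eval]
          rw [if_neg (by omega)]
        · simp only [WordRAM.Expr.cost]
          omega
        · rw [add_zero] at hi
          rwa [← hi]
      | succ m ihm =>
        intro i hi c hc
        have hrx : c.reg (x + 1) = i := by rw [hc.reg, iter_reg_counter E x p hx]
        have hry : c.reg (y + 1) = s.reg y := by
          rw [hc.reg, iter_reg E x p s i y (fun h => hxy h.symm) hy]
        have hiB : s.reg y ≤ E.B := hs.1 y
        obtain ⟨T1, c1, hx1, hT1, hr1⟩ := (hbi i (by omega)).2 c hc (by omega)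
        have hrx1 : c1.reg (x + 1) = i := by
          rw [hr1.reg, den_reg_of_not_writes E p x hx, iter_reg_counter E x p hx]
        have hr2 := hr1.setReg x (i + 1)
        have heq : iter E x p s (i + 1) = (p.den E (iter E x p s i)).setReg x (i + 1) := by
          rw [iter_succ, den_reg_of_not_writes E p x hx, iter_reg_counter E x p hx]
        rw [← heq] at hr2
        obtain ⟨T2, c2, hx2, hT2, hr2⟩ := ihm (i + 1) (by omega) _ hr2
        have hass : WordRAM.Exec w S E.inp (.assign (x + 1) (.op .add (.reg (x + 1)) (.lit 1))) c1 4
            ⟨Function.update c1.reg (x + 1) (i + 1), c1.mem⟩ := by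
          have := WordRAM.Exec.assign (w := w) (S := S) (inp := E.inp) c1 (x + 1)
            (.op .add (.reg (x + 1)) (.lit 1)) (by
              simp only [WordRAM.Expr.Fits, WordRAM.Expr.eval, hrx1, Op.eval]
              omega)
          simpa only [WordRAM.Expr.eval, hrx1, Op.eval, WordRAM.Expr.cost] using this
        refine ⟨_, c2, .whileTrue c _ c2 _ _ _ _ ?_ ?_ (.seq _ _ _ _ _ _ _ hx1 hass) hx2, ?_, hr2⟩
        · simp only [WordRAM.Expr.Fits, WordRAM.Expr.eval, hrx, hry, Op.eval]
          rw [if_pos (by omega)]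
          omega
        · simp only [WordRAM.Expr.eval, hrx, hry, Op.eval]
          rw [if_pos (by omega)]
          omega
        · rw [Finset.sum_range_succ']
          have hsum : ∑ j ∈ Finset.range m, (p.cost E (iter E x p s (i + (j + 1))) + 2) =
              ∑ j ∈ Finset.range m, (p.cost E (iter E x p s (i + 1 + j)) + 2) :=
            Finset.sum_congr rfl fun j _ => by rw [show i + (j + 1) = i + 1 + j by omega]
          rw [hsum, add_zero]
          simp only [WordRAM.Expr.cost]
          omega
    have hr0 : Represents E L ⟨Function.update c.reg (x + 1) 0, c.mem⟩ (iter E x p s 0) :=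
      hc.setReg x 0
    obtain ⟨T, c', hx', hT, hr⟩ := hloop (s.reg y) 0 (by omega) _ hr0
    refine ⟨_, c', .seq _ _ _ _ _ _ _ (.assign c (x + 1) (.lit 0) ?_) hx', ?_, hr⟩
    · exact lit_lt_word hF (by norm_num)
    · simp only [zero_add] at hT
      simp only [WordRAM.Expr.cost, cost]
      omega

end ArrayMachine

/-! ### Search orders and induced paths in chordal graphs -/

section Chordal

/-- The first `k + 1` vertices of `p` form an induced path of length `k`. -/
def SimpleGraph.IsInducedPath {V : Type*} (G : SimpleGraph V) (k : ℕ) (p : ℕ → V) : Prop :=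
  ∀ i j, i < j → j ≤ k → p i ≠ p j ∧ (G.Adj (p i) (p j) ↔ j = i + 1)

theorem SimpleGraph.IsInducedPath.reverse {V : Type*} {G : SimpleGraph V} {k : ℕ} {p : ℕ → V}
    (h : G.IsInducedPath k p) : G.IsInducedPath k fun i => p (k - i) := by
  intro i j hij hj
  obtain ⟨h1, h2⟩ := h (k - j) (k - i) (by omega) (by omega)
  refine ⟨h1.symm, ?_⟩
  rw [G.adj_comm, h2]
  omega

/-- The path is closed up through `d`: the vertex `0` of the cycle goes to `d`, the vertex `i + 1`
to `p i`. -/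
theorem SimpleGraph.IsInducedPath.cycleGraph_isIndContained {V : Type*} {G : SimpleGraph V} {k : ℕ}
    {p : ℕ → V} (h : G.IsInducedPath k p) (d : V) (hd : ∀ i ≤ k, d ≠ p i)
    (hadj : ∀ i ≤ k, G.Adj d (p i) ↔ i = 0 ∨ i = k) :
    (SimpleGraph.cycleGraph (k + 2)).IsIndContained G := by
  let f : Fin (k + 2) → V := fun i => if (i : ℕ) = 0 then d else p (i - 1)
  have hlt : ∀ i j : Fin (k + 2), i < j →
      f i ≠ f j ∧ (G.Adj (f i) (f j) ↔ (SimpleGraph.cycleGraph (k + 2)).Adj i j) := by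
    intro i j hij
    have hij' : (i : ℕ) < j := hij
    have hj := j.isLt
    rw [SimpleGraph.cycleGraph_adj', Fin.val_sub, Fin.val_sub]
    have e1 : (k + 2 - (j : ℕ) + i) % (k + 2) = k + 2 - j + i := Nat.mod_eq_of_lt (by omega)
    have e2 : (k + 2 - (i : ℕ) + j) % (k + 2) = j - i := by
      rw [show k + 2 - (i : ℕ) + j = (j - i) + (k + 2) by omega, Nat.add_mod_right]
      exact Nat.mod_eq_of_lt (by omega)
    rw [e1, e2]
    by_cases hi : (i : ℕ) = 0
    · simp only [f, hi, if_true, if_neg (show ¬ (j : ℕ) = 0 by omega)]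
      refine ⟨hd _ (by omega), (hadj _ (by omega)).trans ?_⟩
      omega
    · simp only [f, if_neg hi, if_neg (show ¬ (j : ℕ) = 0 by omega)]
      obtain ⟨h1, h2⟩ := h (i - 1) (j - 1) (by omega) (by omega)
      refine ⟨h1, h2.trans ?_⟩
      omega
  have hinj : Function.Injective f := by
    intro i j hf
    by_contra hne
    rcases lt_or_gt_of_ne hne with h' | h'
    · exact (hlt i j h').1 hf
    · exact (hlt j i h').1 hf.symm
  refine ⟨⟨⟨f, hinj⟩, ?_⟩⟩
  intro i j
  simp only [Function.Embedding.coeFn_mk]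
  rcases lt_trichotomy i j with h' | rfl | h'
  · exact (hlt i j h').2
  · simp
  · rw [G.adj_comm, (hlt j i h').2, SimpleGraph.adj_comm]

/-- In a chordal graph, a search that never prefers a vertex to one with more visited neighbours
visits the vertices in an order in which the earlier neighbours of every vertex form a clique.
Unvisited vertices may share a common largest rank. -/
theorem IsChordal.adj_of_search_order {V : Type*} {G : SimpleGraph V} (hG : IsChordal G)
    (r : V → ℕ) (hinj : ∀ a b c, r a = r b → r a < r c → a = b)
    (hr : ∀ a b c, r a < r b → r b < r c → G.Adj a c → ¬ G.Adj a b →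
      ∃ d, r d < r b ∧ G.Adj d b ∧ ¬ G.Adj d c)
    {a b c : V} (hab : a ≠ b) (ha : r a < r c) (hb : r b < r c) (hac : G.Adj a c)
    (hbc : G.Adj b c) : G.Adj a b := by
  -- There is no induced path of length at least two whose ends both precede all inner vertices. The
  -- proof is by descent on the larger rank `m` of the two ends.
  have key : ∀ m k p, 2 ≤ k → G.IsInducedPath k p → r (p 0) ≤ m → r (p k) ≤ m →
      (∀ i, 0 < i → i < k → r (p 0) < r (p i) ∧ r (p k) < r (p i)) → False := by
    intro m
    induction m using Nat.strong_induction_on with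
    | _ m ih =>
      have main : ∀ k p, 2 ≤ k → G.IsInducedPath k p → r (p k) ≤ m → r (p 0) < r (p k) →
          (∀ i, 0 < i → i < k → r (p k) < r (p i)) → False := by
        intro k p hk hp hm h0 hint
        -- Since `p k` was preferred to `p 1`, although `p 0` is a neighbour of `p 1` only, some
        -- earlier `d` is a neighbour of `p k` only.
        obtain ⟨d, hd1, hd2, hd3⟩ := hr (p 0) (p k) (p 1) h0 (hint 1 one_pos (by omega))
          ((hp 0 1 one_pos (by omega)).2.2 rfl)
          (fun h => by have := (hp 0 k (by omega) le_rfl).2.1 h; omega)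
        have hdne : ∀ i ≤ k, d ≠ p i := by
          rintro i hi rfl
          rcases Nat.eq_zero_or_pos i with rfl | hi0
          · have := (hp 0 k (by omega) le_rfl).2.1 hd2
            omega
          · rcases hi.eq_or_lt with rfl | hik
            · exact G.irrefl hd2
            · exact absurd hd1 (hint i hi0 hik).not_gt
        classical
        -- The first neighbour `p j` of `d` after `p 0` has `j ≥ 2`. If `d` is adjacent to `p 0`
        -- too, then `d, p 0, …, p j` is an induced cycle of length `j + 2 ≥ 4`.
        have hex : ∃ j, 1 ≤ j ∧ G.Adj d (p j) := ⟨k, by omega, hd2⟩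
        obtain ⟨hj1, hj2⟩ := Nat.find_spec hex
        have hjmin : ∀ i, 1 ≤ i → i < Nat.find hex → ¬ G.Adj d (p i) := fun i h1 h2 h3 =>
          Nat.find_min hex h2 ⟨h1, h3⟩
        have hjk : Nat.find hex ≤ k := Nat.find_min' hex ⟨by omega, hd2⟩
        generalize Nat.find hex = j at hj1 hj2 hjmin hjk
        have hj : 2 ≤ j := by
          by_contra hlt
          have : j = 1 := by omega
          exact hd3 (this ▸ hj2)
        have hpj : G.IsInducedPath j p := fun i i' h1 h2 => hp i i' h1 (by omega)
        by_cases hd0 : G.Adj d (p 0)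
        · refine hG (j + 2) (by omega) (hpj.cycleGraph_isIndContained d
            (fun i hi => hdne i (by omega)) fun i hi => ⟨fun h => ?_, ?_⟩)
          · by_contra hcon
            exact hjmin i (by omega) (by omega) h
          · rintro (rfl | rfl)
            exacts [hd0, hj2]
        -- Otherwise `p 0, …, p j, d` is an induced path of the same kind, and both its ends precede
        -- `p k`.
        · refine ih (max (r (p 0)) (r d)) (by omega) (j + 1) (fun i => if i ≤ j then p i else d)
            (by omega) ?_ (by simp) (by simp) ?_
          · intro i i' h1 h2
            simp only [if_pos (show i ≤ j by omega)]
            split_ifs with h3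
            · exact hpj i i' h1 h3
            · refine ⟨(hdne i (by omega)).symm, ?_⟩
              rw [G.adj_comm]
              refine ⟨fun h => ?_, fun h => ?_⟩
              · by_contra hcon
                rcases Nat.eq_zero_or_pos i with rfl | hi0
                · exact hd0 h
                · exact hjmin i hi0 (by omega) h
              · have : i = j := by omega
                exact this ▸ hj2
          · intro i hi0 hi
            simp only [if_pos (show i ≤ j by omega), Nat.zero_le, if_true,
              if_neg (show ¬ j + 1 ≤ j by omega)]
            have : r (p k) ≤ r (p i) := by
              rcases (show i ≤ k by omega).eq_or_lt with rfl | hik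
              · exact le_rfl
              · exact (hint i hi0 hik).le
            omega
      intro k p hk hp hm0 hmk hint
      rcases lt_trichotomy (r (p 0)) (r (p k)) with h | h | h
      · exact main k p hk hp hmk h fun i h1 h2 => (hint i h1 h2).2
      · exact (hp 0 k (by omega) le_rfl).1 (hinj _ _ (p 1) h (hint 1 one_pos (by omega)).1)
      · refine main k _ hk hp.reverse (by simpa using hm0) (by simpa using h) fun i h1 h2 => ?_
        simpa using (hint (k - i) (by omega) (by omega)).1
  by_contra hnab
  -- If `a` and `b` were not adjacent, `a, c, b` would be such a path.
  refine key (max (r a) (r b)) 2 (fun i => if i = 0 then a else if i = 1 then c else b) le_rfl ?_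
    (by simp) (by simp) ?_
  · intro i j hij hj
    obtain ⟨rfl, rfl⟩ | ⟨rfl, rfl⟩ | ⟨rfl, rfl⟩ :
      (i = 0 ∧ j = 1) ∨ (i = 0 ∧ j = 2) ∨ (i = 1 ∧ j = 2) := by omega
    · simpa [hac] using hac.ne
    · simp [hab, hnab]
    · simpa [hbc.symm] using hbc.ne.symm
  · intro i h1 h2
    have : i = 1 := by omega
    simp [this, ha, hb]

end Chordal

/-! ## Facts about treedepth -/

namespace RootedForest

variable {N : Type*} (F : RootedForest N)

theorem depth_spec (x : N) : (parentStep F.parent)^[F.depth x] (some x) = none := by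
  unfold depth
  exact Nat.find_spec (F.reaches_root x)

theorem depth_le {x : N} {k : ℕ} (h : (parentStep F.parent)^[k] (some x) = none) :
    F.depth x ≤ k := by
  unfold depth
  exact Nat.find_min' (F.reaches_root x) h

theorem depth_of_parent_eq_none {x : N} (h : F.parent x = none) : F.depth x = 1 := by
  apply le_antisymm
  · exact F.depth_le (by simpa [parentStep] using h)
  · by_contra hlt
    have h0 : F.depth x = 0 := by omega
    have := F.depth_spec x
    simp [h0] at this

theorem depth_of_parent_eq_some {x y : N} (h : F.parent x = some y) :
    F.depth x = F.depth y + 1 := by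
  have hs : parentStep F.parent (some x) = some y := by simpa [parentStep] using h
  apply le_antisymm
  · apply F.depth_le
    rw [Function.iterate_succ_apply, hs]
    exact F.depth_spec y
  · have h1 := F.depth_spec x
    rcases hd : F.depth x with _ | k
    · simp [hd] at h1
    · rw [hd, Function.iterate_succ_apply, hs] at h1
      have := F.depth_le h1
      omega

theorem depth_pos (x : N) : 1 ≤ F.depth x := by
  rcases h : F.parent x with _ | y
  · rw [F.depth_of_parent_eq_none h]
  · rw [F.depth_of_parent_eq_some h]
    omega

variable {F}

theorem IsAncestor.depth_lt {x y : N} (h : F.IsAncestor x y) : F.depth x < F.depth y := by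
  unfold IsAncestor at h
  induction h with
  | single h =>
    rw [F.depth_of_parent_eq_some h]
    omega
  | tail _ h ih =>
    rw [F.depth_of_parent_eq_some h]
    omega

theorem IsAncestor.trans {x y z : N} (h : F.IsAncestor x y) (h' : F.IsAncestor y z) :
    F.IsAncestor x z := Relation.TransGen.trans h h'

/-- Two ancestors of a node are comparable. -/
theorem IsAncestor.total {x y z : N} (hx : F.IsAncestor x z) (hy : F.IsAncestor y z) :
    x = y ∨ F.IsAncestor x y ∨ F.IsAncestor y x := by
  unfold IsAncestor at hx hy
  induction hx generalizing y with
  | single h =>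
    cases hy with
    | single h' => exact .inl (Option.some_injective _ (h.symm.trans h'))
    | tail h1 h' =>
      obtain rfl := Option.some_injective _ (h.symm.trans h')
      exact .inr (.inr h1)
  | tail h1 h ih =>
    cases hy with
    | single h' =>
      obtain rfl := Option.some_injective _ (h.symm.trans h')
      exact .inr (.inl h1)
    | tail h2 h' =>
      obtain rfl := Option.some_injective _ (h.symm.trans h')
      exact ih h2

/-- The nodes `x` and `y` lie on a common path upwards. -/
def Comparable (F : RootedForest N) (x y : N) : Prop := x = y ∨ F.IsAncestor x y ∨ F.IsAncestor y x

theorem Comparable.eq_of_depth_eq {x y : N} (h : F.Comparable x y) (hd : F.depth x = F.depth y) :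
    x = y := by
  rcases h with h | h | h
  · exact h
  · have := h.depth_lt
    omega
  · have := h.depth_lt
    omega

theorem Comparable.isAncestor_of_depth_lt {x y : N} (h : F.Comparable x y)
    (hd : F.depth x < F.depth y) : F.IsAncestor x y := by
  rcases h with rfl | h | h
  · omega
  · exact h
  · have := h.depth_lt
    omega

/-- A node that is an ancestor of one of two comparable nodes is comparable with the other one. -/
theorem IsAncestor.comparable {x y z : N} (h : F.IsAncestor x y) (h' : F.Comparable y z) :
    F.Comparable x z := by
  rcases h' with rfl | h' | h'
  · exact .inr (.inl h)
  · exact .inr (.inl (h.trans h'))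
  · exact h.total h'

theorem depth_le_height [Fintype N] (F : RootedForest N) (x : N) : F.depth x ≤ F.height :=
  Finset.le_sup (f := F.depth) (Finset.mem_univ x)

end RootedForest

theorem IsTreedepthDecomposition.comparable {V N : Type*} {G : SimpleGraph V} {F : RootedForest N}
    {ψ : V → N} (h : IsTreedepthDecomposition G F ψ) {u v : V} (huv : G.Adj u v) :
    F.Comparable (ψ u) (ψ v) := .inr (h.2 u v huv)

theorem IsTreedepthDecomposition.depth_ne {V N : Type*} {G : SimpleGraph V} {F : RootedForest N}
    {ψ : V → N} (h : IsTreedepthDecomposition G F ψ) {u v : V} (huv : G.Adj u v) :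
    F.depth (ψ u) ≠ F.depth (ψ v) := fun hd =>
  huv.ne (h.1 ((h.comparable huv).eq_of_depth_eq hd))

/-- The path on the vertices `0, …, n - 1`, rooted in `0`. -/
def RootedForest.path (n : ℕ) : RootedForest (Fin n) where
  parent x := if h : (x : ℕ) = 0 then none else some ⟨x - 1, by omega⟩
  reaches_root := by
    intro x
    obtain ⟨k, hk⟩ := x
    induction k with
    | zero => exact ⟨1, by simp [parentStep]⟩
    | succ k ih =>
      obtain ⟨m, hm⟩ := ih (by omega)
      refine ⟨m + 1, ?_⟩
      rw [Function.iterate_succ_apply]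
      simpa [parentStep] using hm

/-- The infimum is attained because some decomposition exists: on a path all nodes are comparable.
For an empty set `sInf` would be `0`. -/
theorem treedepth_le_iff {n : ℕ} {G : SimpleGraph (Fin n)} {t : ℕ} : treedepth G ≤ t ↔
    ∃ (N : ℕ) (F : RootedForest (Fin N)) (ψ : Fin n → Fin N),
      IsTreedepthDecomposition G F ψ ∧ F.height ≤ t := by
  constructor
  · intro h
    have hne : {h : ℕ | ∃ (N : ℕ) (F : RootedForest (Fin N)) (ψ : Fin n → Fin N),
        IsTreedepthDecomposition G F ψ ∧ F.height = h}.Nonempty := by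
      refine ⟨_, n, RootedForest.path n, id, ⟨Function.injective_id, fun u v huv => ?_⟩, rfl⟩
      have hanc : ∀ d (u v : Fin n), (v : ℕ) = u + d + 1 → (RootedForest.path n).IsAncestor u v := by
        intro d
        induction d with
        | zero =>
          intro u v h
          refine Relation.TransGen.single ?_
          simp only [RootedForest.path]
          rw [dif_neg (by omega)]
          exact congrArg some (Fin.ext (by simp only; omega))
        | succ d ih =>
          intro u v h
          refine Relation.TransGen.tail (ih u ⟨v - 1, by omega⟩ (by simp only; omega)) ?_
          simp only [RootedForest.path]
          rw [dif_neg (by omega)]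
      rcases lt_or_gt_of_ne huv.ne with h | h
      · exact .inl (hanc (v - u - 1) u v (by have : (u : ℕ) < v := h; omega))
      · exact .inr (hanc (u - v - 1) v u (by have : (v : ℕ) < u := h; omega))
    obtain ⟨N, F, ψ, h1, h2⟩ := Nat.sInf_mem hne
    exact ⟨N, F, ψ, h1, h2.le.trans h⟩
  · rintro ⟨N, F, ψ, h1, h2⟩
    have hmem : F.height ∈ {h : ℕ | ∃ (N : ℕ) (F : RootedForest (Fin N)) (ψ : Fin n → Fin N),
        IsTreedepthDecomposition G F ψ ∧ F.height = h} := ⟨N, F, ψ, h1, rfl⟩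
    exact (Nat.sInf_le hmem).trans h2

/-- Adjacent vertices have distinct comparable images, hence distinct depths, and only `1, …, t` are
available. -/
theorem card_le_of_isClique {n : ℕ} {G : SimpleGraph (Fin n)} {t : ℕ} (h : treedepth G ≤ t)
    (A : Finset (Fin n)) (hA : ∀ u ∈ A, ∀ v ∈ A, u ≠ v → G.Adj u v) : A.card ≤ t := by
  obtain ⟨N, F, ψ, h1, h2⟩ := treedepth_le_iff.1 h
  have : A.card ≤ (Finset.Icc 1 t).card := by
    refine Finset.card_le_card_of_injOn (fun v => F.depth (ψ v)) (fun v _ => ?_) ?_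
    · simpa using And.intro (F.depth_pos _) ((F.depth_le_height _).trans h2)
    · intro u hu v hv huv
      by_contra hne
      exact h1.depth_ne (hA u hu v hv hne) huv
  simpa using this

open Classical in
-- Each edge is charged to its lower end. The neighbours above a vertex lie on its path to the root
-- and have distinct depths, so each vertex is charged at most `t` times.
theorem sum_degree_le {n : ℕ} {G : SimpleGraph (Fin n)} {t : ℕ} (h : treedepth G ≤ t) :
    ∑ v, (Finset.univ.filter fun u => G.Adj v u).card ≤ 2 * (t * n) := by
  obtain ⟨N, F, ψ, h1, h2⟩ := treedepth_le_iff.1 h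
  have hup : ∀ v, (Finset.univ.filter fun u => G.Adj v u ∧ F.IsAncestor (ψ u) (ψ v)).card ≤ t := by
    intro v
    have : (Finset.univ.filter fun u => G.Adj v u ∧ F.IsAncestor (ψ u) (ψ v)).card ≤
        (Finset.Icc 1 t).card := by
      refine Finset.card_le_card_of_injOn (fun v => F.depth (ψ v)) (fun v _ => ?_) ?_
      · simpa using And.intro (F.depth_pos _) ((F.depth_le_height _).trans h2)
      · intro u hu u' hu' huu
        simp only [Finset.coe_filter, Finset.mem_univ, true_and, Set.mem_ofPred_eq] at hu hu'
        exact h1.1 (RootedForest.Comparable.eq_of_depth_eq (hu.2.total hu'.2) huu)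
    simpa using this
  have hsplit : ∀ v, (Finset.univ.filter fun u => G.Adj v u).card ≤
      (Finset.univ.filter fun u => G.Adj v u ∧ F.IsAncestor (ψ u) (ψ v)).card +
      (Finset.univ.filter fun u => G.Adj u v ∧ F.IsAncestor (ψ v) (ψ u)).card := by
    intro v
    refine le_trans (Finset.card_le_card fun u hu => ?_) (Finset.card_union_le _ _)
    simp only [Finset.mem_filter, Finset.mem_univ, true_and, Finset.mem_union] at hu ⊢
    rcases h1.2 v u hu with h | h
    · exact .inr ⟨hu.symm, h⟩
    · exact .inl ⟨hu, h⟩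
  have hswap : ∑ v, (Finset.univ.filter fun u => G.Adj u v ∧ F.IsAncestor (ψ v) (ψ u)).card =
      ∑ v, (Finset.univ.filter fun u => G.Adj v u ∧ F.IsAncestor (ψ u) (ψ v)).card := by
    simp only [Finset.card_filter]
    rw [Finset.sum_comm]
  calc _ ≤ _ := Finset.sum_le_sum fun v _ => hsplit v
    _ = 2 * ∑ v, (Finset.univ.filter fun u => G.Adj v u ∧ F.IsAncestor (ψ u) (ψ v)).card := by
      rw [Finset.sum_add_distrib, hswap]
      ring
    _ ≤ 2 * ∑ _v : Fin n, t := by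
      gcongr with v
      exact hup v
    _ = 2 * (t * n) := by simp [mul_comm]

/-! ## The dynamic program over an elimination order -/

/-- The digit number `j` of `x` in base `b`. -/
def digit (b x j : ℕ) : ℕ := x / b ^ j % b

theorem digit_lt {b : ℕ} (hb : 0 < b) (x j : ℕ) : digit b x j < b := Nat.mod_lt _ hb

theorem exists_digit_eq {b : ℕ} (t : ℕ) (f : ℕ → ℕ) (hf : ∀ j < t, f j < b) :
    ∃ x < b ^ t, ∀ j < t, digit b x j = f j := by
  induction t generalizing f with
  | zero => exact ⟨0, by simp, by simp⟩
  | succ t ih =>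
    obtain ⟨x, hx, h⟩ := ih (fun j => f (j + 1)) fun j hj => hf (j + 1) (by omega)
    have h0 := hf 0 (by omega)
    refine ⟨f 0 + b * x, ?_, fun j hj => ?_⟩
    · calc f 0 + b * x < b * (x + 1) := by rw [mul_add]; omega
        _ ≤ b * b ^ t := Nat.mul_le_mul_left b hx
        _ = b ^ (t + 1) := by ring
    · rcases j with _ | j
      · simp [digit, Nat.mod_eq_of_lt h0]
      · rw [← h j (by omega), digit, digit, pow_succ', ← Nat.div_div_eq_div_mul,
          Nat.add_mul_div_left _ _ (by omega), Nat.div_eq_of_lt h0, zero_add]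

/-- The positions `0, …, n - 1` with the graph `A` on them form an elimination order: the smaller
neighbours of `v` form a clique, the largest of them is `par v`, `col` is a proper colouring with
the colours `2, …, t + 1`, and `cs v` is the indicator function of the colours of `v` and of
its smaller neighbours. -/
structure IsElimination (n t : ℕ) (A : ℕ → ℕ → Prop) (par col : ℕ → ℕ) (cs : ℕ → ℕ → ℕ) :
    Prop where
  symm : ∀ u v, A u v → A v u
  irrefl : ∀ u, ¬ A u u
  par_lt : ∀ v, 0 < v → v < n → par v < v
  par_spec : ∀ u v, v < n → u < v → A u v → u = par v ∨ (u < par v ∧ A u (par v))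
  clique : ∀ u u' v, v < n → u < v → u' < v → u ≠ u' → A u v → A u' v → A u u'
  two_le_col : ∀ v < n, 2 ≤ col v
  col_lt : ∀ v < n, col v < t + 2
  col_ne : ∀ u v, u < v → v < n → A u v → col u ≠ col v
  cs_eq_one : ∀ v < n, ∀ d < t + 2, (d = col v ∨ ∃ u < v, A u v ∧ col u = d) → cs v d = 1
  cs_eq_zero : ∀ v < n, ∀ d < t + 2, ¬ (d = col v ∨ ∃ u < v, A u v ∧ col u = d) → cs v d = 0

section DynamicProgram

/-- A state in which the positive digits are exactly the colours in `cs`, each of them once. -/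
def IsInitState (t : ℕ) (cs : ℕ → ℕ) (x : ℕ) : Prop :=
  ∀ d, 1 ≤ d → d < t + 2 →
    ((Finset.range t).filter fun j => digit (t + 2) x j = d).card = cs d

/-- A colour other than `c` occurs among the digits `0, …, j` of `y`. -/
def Seen (b c y j : ℕ) : Prop := ∃ i ≤ j, 2 ≤ digit b y i ∧ digit b y i ≠ c

/-- The state `z` of a bag arises from its state `x` and the state `y` of a child bag, in which the
vertex of colour `c` is forgotten. -/
def Merge (t c x y z : ℕ) : Prop :=
  ∀ j < t,
    (2 ≤ digit (t + 2) y j ∧ digit (t + 2) y j ≠ c →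
      digit (t + 2) x j = digit (t + 2) y j ∧ digit (t + 2) z j = digit (t + 2) y j) ∧
    (¬ (2 ≤ digit (t + 2) y j ∧ digit (t + 2) y j ≠ c) → digit (t + 2) y j ≠ 0 →
      Seen (t + 2) c y j → digit (t + 2) x j = 0 ∧ digit (t + 2) z j = 1) ∧
    (¬ (2 ≤ digit (t + 2) y j ∧ digit (t + 2) y j ≠ c) →
      ¬ (digit (t + 2) y j ≠ 0 ∧ Seen (t + 2) c y j) → digit (t + 2) z j = digit (t + 2) x j)

/-- The state `x` of the bag of `v` is reachable when `i` children, those from `n - i` on, have been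
merged into their parents. -/
def Reach (n t : ℕ) (par col : ℕ → ℕ) (cs : ℕ → ℕ → ℕ) : ℕ → ℕ → ℕ → Prop
  | 0, v, x => IsInitState t (cs v) x
  | i + 1, v, z =>
    if v = par (n - 1 - i) then
      ∃ x < (t + 2) ^ t, ∃ y < (t + 2) ^ t, Reach n t par col cs i v x ∧
        Reach n t par col cs i (n - 1 - i) y ∧ Merge t (col (n - 1 - i)) x y z
    else Reach n t par col cs i v z

/-- A way back through the dynamic program: `cur r v` is the state of `v ≤ r` when the merges of
the children `1, …, r` have been undone. -/
structure IsTrace (n t : ℕ) (par col : ℕ → ℕ) (cs : ℕ → ℕ → ℕ) (cur : ℕ → ℕ → ℕ) : Prop where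
  merge : ∀ k, k + 1 < n →
    Merge t (col (k + 1)) (cur (k + 1) (par (k + 1))) (cur (k + 1) (k + 1)) (cur k (par (k + 1)))
  keep : ∀ k, k + 1 < n → ∀ v ≤ k, v ≠ par (k + 1) → cur (k + 1) v = cur k v
  init : ∀ v < n, IsInitState t (cs v) (cur (n - 1) v)

variable {n t : ℕ} {A : ℕ → ℕ → Prop} {par col : ℕ → ℕ} {cs : ℕ → ℕ → ℕ}

/-- The three cases of `Merge` are exhaustive, and only the second one changes a digit of `x`: a
free place becomes one taken by a forgotten vertex. -/
theorem Merge.digit_cases {c x y z : ℕ} (h : Merge t c x y z) {j : ℕ} (hj : j < t) :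
    digit (t + 2) z j = digit (t + 2) x j ∨ (digit (t + 2) x j = 0 ∧ digit (t + 2) z j = 1) := by
  obtain ⟨h1, h2, h3⟩ := h j hj
  by_cases hc : 2 ≤ digit (t + 2) y j ∧ digit (t + 2) y j ≠ c
  · exact .inl ((h1 hc).2.trans (h1 hc).1.symm)
  · by_cases hs : digit (t + 2) y j ≠ 0 ∧ Seen (t + 2) c y j
    · exact .inr (h2 hc hs.1 hs.2)
    · exact .inl (h3 hc hs)

/-! ### Soundness: a trace yields a decomposition -/

section Soundness

variable {cur : ℕ → ℕ → ℕ}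

/-- A place changes at most once, since a change needs a `0` and leaves a `1`. Merges happen in
decreasing order of the first argument of `cur`, so `r` is the later stage. -/
theorem IsTrace.digit_cases (hT : IsTrace n t par col cs cur) {v r r' j : ℕ} (hj : j < t)
    (hv : v ≤ r) (hr : r ≤ r') (hn : r' < n) :
    digit (t + 2) (cur r v) j = digit (t + 2) (cur r' v) j ∨
      (digit (t + 2) (cur r' v) j = 0 ∧ digit (t + 2) (cur r v) j = 1) := by
  induction r', hr using Nat.le_induction with
  | base => exact .inl rfl
  | succ k hk ih =>
    have ih' := ih (by omega)
    by_cases hp : v = par (k + 1)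
    · have := (hT.merge k hn).digit_cases hj
      rw [← hp] at this
      omega
    · rw [hT.keep k hn v (by omega) hp]
      exact ih'

/-- The digit of `v` in the final state of `v`. -/
theorem IsTrace.digit_eq_of_two_le (hT : IsTrace n t par col cs cur) {v r r' j : ℕ} (hj : j < t)
    (hv : v ≤ r) (hr : r ≤ r') (hn : r' < n) (h : 2 ≤ digit (t + 2) (cur r v) j ∨
      2 ≤ digit (t + 2) (cur r' v) j) :
    digit (t + 2) (cur r v) j = digit (t + 2) (cur r' v) j := by
  have := hT.digit_cases hj hv hr hn
  omega

variable (hE : IsElimination n t A par col cs) (hT : IsTrace n t par col cs cur)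

include hT in
-- Only digits that are colours matter for `Seen`, and merges into a bag never alter these.
theorem IsTrace.seen_iff {v j : ℕ} (hv : v < n) (hj : j < t) (c : ℕ) :
    Seen (t + 2) c (cur v v) j ↔ Seen (t + 2) c (cur (n - 1) v) j := by
  refine exists_congr fun i => and_congr_right fun hi => ?_
  constructor
  · rintro ⟨h1, h2⟩
    have := hT.digit_eq_of_two_le (show i < t by omega) le_rfl (show v ≤ n - 1 by omega)
      (by omega) (.inl h1)
    rw [← this]
    exact ⟨h1, h2⟩
  · rintro ⟨h1, h2⟩
    have := hT.digit_eq_of_two_le (show i < t by omega) le_rfl (show v ≤ n - 1 by omega)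
      (by omega) (.inr h1)
    rw [this]
    exact ⟨h1, h2⟩

include hE hT in
theorem IsTrace.digit_unique {v d i j : ℕ} (hv : v < n) (hd : 1 ≤ d) (hdt : d < t + 2) (hi : i < t)
    (hj : j < t) (h1 : digit (t + 2) (cur (n - 1) v) i = d)
    (h2 : digit (t + 2) (cur (n - 1) v) j = d) : i = j := by
  have h := hT.init v hv d hd hdt
  have hle : cs v d ≤ 1 := by
    by_cases hc : d = col v ∨ ∃ u < v, A u v ∧ col u = d
    · rw [hE.cs_eq_one v hv d hdt hc]
    · rw [hE.cs_eq_zero v hv d hdt hc]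
      omega
  rw [← h] at hle
  exact Finset.card_le_one.1 hle i (by simp [hi, h1]) j (by simp [hj, h2])

include hE hT in
theorem IsTrace.exists_digit {v d : ℕ} (hv : v < n) (hdt : d < t + 2) (hd : 1 ≤ d)
    (h : d = col v ∨ ∃ u < v, A u v ∧ col u = d) :
    ∃ j < t, digit (t + 2) (cur (n - 1) v) j = d := by
  have h' := hT.init v hv d hd hdt
  rw [hE.cs_eq_one v hv d hdt h] at h'
  obtain ⟨j, hj⟩ := Finset.card_pos.1 (h'.symm ▸ one_pos)
  simp only [Finset.mem_filter, Finset.mem_range] at hj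
  exact ⟨j, hj⟩

include hE hT in
theorem IsTrace.mem_colours {v j : ℕ} (hv : v < n) (hj : j < t)
    (h : 1 ≤ digit (t + 2) (cur (n - 1) v) j) :
    digit (t + 2) (cur (n - 1) v) j = col v ∨
      ∃ u < v, A u v ∧ col u = digit (t + 2) (cur (n - 1) v) j := by
  by_contra hcon
  have hlt := digit_lt (show 0 < t + 2 by omega) (cur (n - 1) v) j
  have h' := hT.init v hv _ h hlt
  rw [hE.cs_eq_zero v hv _ hlt hcon, Finset.card_eq_zero, Finset.filter_eq_empty_iff] at h'
  exact h' (Finset.mem_range.2 hj) rfl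

include hE hT in
-- The bag of `0` has no further vertices, so nothing remains when `0` is forgotten. Thus `rep 0`
-- never refers to the meaningless `par 0`.
theorem IsTrace.not_seen_zero (hn : 0 < n) {j : ℕ} (hj : j < t) :
    ¬ Seen (t + 2) (col 0) (cur (n - 1) 0) j := by
  rintro ⟨i, hi, h1, h2⟩
  rcases hT.mem_colours hE hn (show i < t by omega) (by omega) with h | ⟨u, hu, _⟩
  · exact h2 h
  · omega

include hE hT in
/-- The colour of a neighbour is at the same place in the states of all bags on the way to it. -/
theorem IsTrace.digit_par {u v j : ℕ} (hv : v < n) (hu : u < v) (hA : A u v) (hj : j < t)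
    (h : digit (t + 2) (cur (n - 1) v) j = col u) :
    Seen (t + 2) (col v) (cur (n - 1) v) j ∧ digit (t + 2) (cur (n - 1) (par v)) j = col u := by
  have h2 := hE.two_le_col u (by omega)
  have hne := hE.col_ne u v hu hv hA
  have hpv := hE.par_lt v (by omega) hv
  refine ⟨⟨j, le_rfl, by omega, by omega⟩, ?_⟩
  have h3 : digit (t + 2) (cur v v) j = col u :=
    (hT.digit_eq_of_two_le hj le_rfl (show v ≤ n - 1 by omega) (by omega) (.inr (by omega))).trans h
  obtain ⟨k, rfl⟩ : ∃ k, v = k + 1 := ⟨v - 1, by omega⟩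
  have h4 := ((hT.merge k hv j hj).1 (by omega)).1
  rw [← hT.digit_eq_of_two_le hj (show par (k + 1) ≤ k + 1 by omega)
    (show k + 1 ≤ n - 1 by omega) (by omega) (.inl (by omega)), h4, h3]

/-- `x` reaches its ancestor `v` along bags in which the height `j` is above a remaining vertex. -/
inductive Climbs (n t : ℕ) (par col a : ℕ → ℕ) (j x : ℕ) : ℕ → Prop
  | refl : Climbs n t par col a j x x
  | step (w : ℕ) : Climbs n t par col a j x w → 0 < w → w < n → Seen (t + 2) (col w) (a w) j →
      Climbs n t par col a j x (par w)

include hE hT in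
-- At `x` itself the place carries the colour of `x`. Each step of the climb is a merge by the
-- second case of `Merge`, which writes a `1` into the parent's state, and this `1` survives the
-- later merges.
theorem IsTrace.climbs_cases {j x v : ℕ} (hj : j < t) (hx : x < n)
    (hs : digit (t + 2) (cur (n - 1) x) j = col x)
    (h : Climbs n t par col (cur (n - 1)) j x v) :
    (v = x ∧ digit (t + 2) (cur v v) j = col v) ∨ (v < x ∧ digit (t + 2) (cur v v) j = 1) := by
  induction h with
  | refl =>
    refine .inl ⟨rfl, ?_⟩
    rw [hT.digit_eq_of_two_le hj le_rfl (show x ≤ n - 1 by omega) (by omega)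
      (.inr (by have := hE.two_le_col x hx; omega)), hs]
  | step w _ hw0 hwn hseen ih =>
    have hpw := hE.par_lt w hw0 hwn
    refine .inr ⟨by omega, ?_⟩
    obtain ⟨k, rfl⟩ : ∃ k, w = k + 1 := ⟨w - 1, by omega⟩
    have h2 := hE.two_le_col _ hwn
    have h1 := ((hT.merge k hwn j hj).2.1 (by omega) (by omega) ((hT.seen_iff hwn hj _).2 hseen)).2
    have := hT.digit_cases hj (le_refl (par (k + 1))) (show par (k + 1) ≤ k by omega) (by omega)
    omega

include hE hT in
theorem IsTrace.climbs_step {j x w : ℕ} (hj : j < t) (hx : x < n)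
    (hs : digit (t + 2) (cur (n - 1) x) j = col x)
    (h : Climbs n t par col (cur (n - 1)) j x w) (hw0 : 0 < w) (hwn : w < n)
    (hseen : Seen (t + 2) (col w) (cur (n - 1) w) j) :
    digit (t + 2) (cur w (par w)) j = 0 ∧ digit (t + 2) (cur (w - 1) (par w)) j = 1 := by
  have hc := hT.climbs_cases hE hj hx hs h
  obtain ⟨k, rfl⟩ : ∃ k, w = k + 1 := ⟨w - 1, by omega⟩
  have h2 := hE.two_le_col _ hwn
  exact (hT.merge k hwn j hj).2.1 (by omega) (by omega) ((hT.seen_iff hwn hj _).2 hseen)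

include hE hT in
-- The source of injectivity: two climbs at the same height that meet in a bag came through the same
-- child, and so on down to their common start.
theorem IsTrace.eq_of_climbs {j x y v : ℕ} (hj : j < t) (hx : x < n) (hy : y < n)
    (hsx : digit (t + 2) (cur (n - 1) x) j = col x)
    (hsy : digit (t + 2) (cur (n - 1) y) j = col y)
    (h : Climbs n t par col (cur (n - 1)) j x v)
    (h' : Climbs n t par col (cur (n - 1)) j y v) : x = y := by
  induction h with
  | refl =>
    have h1 := hT.climbs_cases hE hj hx hsx .refl
    have h2 := hT.climbs_cases hE hj hy hsy h'
    have := hE.two_le_col x hx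
    omega
  | step w hw hw0 hwn hseen ih =>
    have hpw := hE.par_lt w hw0 hwn
    have h1 := hT.climbs_cases hE hj hx hsx (.step w hw hw0 hwn hseen)
    have h2 := hT.climbs_cases hE hj hy hsy h'
    have hf := hT.climbs_step hE hj hx hsx hw hw0 hwn hseen
    generalize hp : par w = p at *
    cases h' with
    | refl =>
      have := hE.two_le_col y hy
      have := hT.climbs_cases hE hj hx hsx hw
      omega
    | step w' hw' hw0' hwn' hseen' =>
      have hf' := hT.climbs_step hE hj hy hsy hw' hw0' hwn' hseen'
      have hpw' := hE.par_lt w' hw0' hwn'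
      -- The child with the larger number is merged first and leaves a `1` in the parent, where the
      -- merge of the other child would need a `0`.
      rcases lt_trichotomy w w' with hlt | rfl | hlt
      · have := hT.digit_cases hj (show par w' ≤ w by omega) (show w ≤ w' - 1 by omega) (by omega)
        omega
      · exact ih hw'
      · have := hT.digit_cases hj (show par w' ≤ w' by omega) (show w' ≤ w - 1 by omega) (by omega)
        omega

variable {rep : ℕ → ℕ → ℕ}

/-- `rep v j` is the node on height `j` of the path through the bag of `v`: it is inherited from the
parent above the vertices in the common bag, and new below. -/
def IsRep (n t : ℕ) (par col a : ℕ → ℕ) (rep : ℕ → ℕ → ℕ) : Prop :=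
  ∀ v < n, ∀ j < t, (Seen (t + 2) (col v) (a v) j → rep v j = rep (par v) j) ∧
    (¬ Seen (t + 2) (col v) (a v) j → rep v j = v * t + j)

theorem Seen.mono {b c y i j : ℕ} (h : Seen b c y i) (hij : i ≤ j) : Seen b c y j := by
  obtain ⟨k, hk, h⟩ := h
  exact ⟨k, hk.trans hij, h⟩

theorem Climbs.head {a : ℕ → ℕ} {j w v : ℕ} (hw0 : 0 < w) (hwn : w < n)
    (hseen : Seen (t + 2) (col w) (a w) j) (h : Climbs n t par col a j (par w) v) :
    Climbs n t par col a j w v := by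
  induction h with
  | refl => exact .step w .refl hw0 hwn hseen
  | step w' _ h1 h2 h3 ih => exact .step w' ih h1 h2 h3

include hE hT in
-- Going up as long as the height `j` is inherited ends in the bag `w` where the node is new. As
-- `Seen` is monotone in the height, all greater heights are inherited along the same way, so from
-- `j` on the paths of `v` and `w` coincide.
theorem IsTrace.rep_spec (hR : IsRep n t par col (cur (n - 1)) rep) {v j : ℕ} (hv : v < n)
    (hj : j < t) : ∃ w ≤ v, rep v j = w * t + j ∧ Climbs n t par col (cur (n - 1)) j v w ∧
      ∀ j', j ≤ j' → j' < t → rep v j' = rep w j' := by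
  induction v using Nat.strong_induction_on with
  | _ v ih =>
    by_cases hs : Seen (t + 2) (col v) (cur (n - 1) v) j
    · have hv0 : 0 < v := by
        rcases Nat.eq_zero_or_pos v with rfl | h
        · exact absurd hs (hT.not_seen_zero hE hv hj)
        · exact h
      have hpv := hE.par_lt v hv0 hv
      obtain ⟨w, hw, h1, h2, h3⟩ := ih (par v) hpv (by omega)
      refine ⟨w, by omega, ?_, h2.head hv0 hv hs, fun j' hj1 hj2 => ?_⟩
      · rw [((hR v hv j hj).1 hs), h1]
      · rw [((hR v hv j' hj2).1 (hs.mono hj1)), h3 j' hj1 hj2]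
    · exact ⟨v, le_rfl, (hR v hv j hj).2 hs, .refl, fun _ _ _ => rfl⟩

theorem rep_lt_card (h : ∀ v < n, ∀ j < t, ∃ w < n, rep v j = w * t + j) {v j : ℕ} (hv : v < n)
    (hj : j < t) : rep v j < n * t := by
  obtain ⟨w, hw, he⟩ := h v hv j hj
  rw [he]
  calc w * t + j < w * t + t := by omega
    _ = (w + 1) * t := by ring
    _ ≤ n * t := Nat.mul_le_mul_right t hw

/-- The parent of the node `i = v * t + j` is `rep v (j + 1)`. -/
def repParent (n t : ℕ) (rep : ℕ → ℕ → ℕ) (h : ∀ v < n, ∀ j < t, ∃ w < n, rep v j = w * t + j)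
    (i : Fin (n * t)) : Option (Fin (n * t)) :=
  if hi : (i : ℕ) % t + 1 < t then
    some ⟨rep (i / t) (i % t + 1), rep_lt_card h (Nat.div_lt_of_lt_mul (by simp [mul_comm])) hi⟩
  else none

/-- The remainder modulo `t` is the height of a node. It grows by one with each step upwards and
stays below `t`. -/
theorem repParent_reaches_root (h : ∀ v < n, ∀ j < t, ∃ w < n, rep v j = w * t + j) (m : ℕ)
    (i : Fin (n * t)) (hi : t ≤ (i : ℕ) % t + m) :
    (parentStep (repParent n t rep h))^[m] (some i) = none := by
  induction m generalizing i with
  | zero =>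
    have : 0 < t := by
      rcases Nat.eq_zero_or_pos t with rfl | h
      · exact absurd i.isLt (by simp)
      · exact h
    have := Nat.mod_lt i this
    omega
  | succ m ih =>
    rw [Function.iterate_succ_apply]
    by_cases hlt : (i : ℕ) % t + 1 < t
    · obtain ⟨w, hw, he⟩ := h (i / t) (Nat.div_lt_of_lt_mul (by simp [mul_comm])) _ hlt
      have hmod : (w * t + ((i : ℕ) % t + 1)) % t = (i : ℕ) % t + 1 := by
        rw [mul_comm, Nat.mul_add_mod, Nat.mod_eq_of_lt hlt]
      simp only [parentStep, Option.bind_some, repParent, dif_pos hlt, he]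
      refine ih _ ?_
      simp only [hmod]
      omega
    · have : parentStep (repParent n t rep h) (some i) = none := by
        simp [parentStep, repParent, hlt]
      rw [this]
      exact Function.iterate_fixed rfl m

/-- The forest whose nodes `v * t + j` are on the height `j`, with parents given by `rep`. -/
def repForest (n t : ℕ) (rep : ℕ → ℕ → ℕ)
    (h : ∀ v < n, ∀ j < t, ∃ w < n, rep v j = w * t + j) : RootedForest (Fin (n * t)) where
  parent := repParent n t rep h
  reaches_root i := ⟨t, repParent_reaches_root h t i (by omega)⟩

theorem repForest_height_le (h : ∀ v < n, ∀ j < t, ∃ w < n, rep v j = w * t + j) :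
    (repForest n t rep h).height ≤ t :=
  Finset.sup_le fun i _ => (repForest n t rep h).depth_le (repParent_reaches_root h t i (by omega))

include hE hT in
/-- The solution found by the dynamic program is a treedepth decomposition. -/
theorem IsTrace.exists_decomposition (hR : IsRep n t par col (cur (n - 1)) rep) (psi : ℕ → ℕ)
    (hpsi : ∀ v < n, ∀ j < t, digit (t + 2) (cur (n - 1) v) j = col v → psi v = rep v j) :
    ∃ (F : RootedForest (Fin (n * t))) (ψ : Fin n → Fin (n * t)), F.height ≤ t ∧
      (∀ i, (F.parent i).elim 0 (fun p => (p : ℕ) + 1) =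
        if (i : ℕ) % t + 1 < t then rep (i / t) (i % t + 1) + 1 else 0) ∧
      (∀ v, (ψ v : ℕ) = psi v) ∧ Function.Injective ψ ∧
      ∀ u v : Fin n, A u v → F.IsAncestor (ψ u) (ψ v) ∨ F.IsAncestor (ψ v) (ψ u) := by
  have hrep : ∀ v < n, ∀ j < t, ∃ w < n, rep v j = w * t + j := fun v hv j hj => by
    obtain ⟨w, hw, h, -⟩ := hT.rep_spec hE hR hv hj
    exact ⟨w, by omega, h⟩
  have hslot : ∀ v < n, ∃ j < t, digit (t + 2) (cur (n - 1) v) j = col v := fun v hv =>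
    hT.exists_digit hE hv (hE.col_lt v hv) (by have := hE.two_le_col v hv; omega) (.inl rfl)
  -- The node `rep v j` is `w * t + j`, and its parent is defined through the bag `w`; by `rep_spec`
  -- this is also the next node on the path of `v`.
  have hpar : ∀ v (hv : v < n) j (hj : j + 1 < t), (repForest n t rep hrep).parent
      ⟨rep v j, rep_lt_card hrep hv (by omega)⟩ = some ⟨rep v (j + 1), rep_lt_card hrep hv hj⟩ := by
    intro v hv j hj
    obtain ⟨w, hw, h1, -, h3⟩ := hT.rep_spec hE hR hv (show j < t by omega)
    have hmod : rep v j % t = j := by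
      rw [h1, mul_comm, Nat.mul_add_mod, Nat.mod_eq_of_lt (by omega)]
    have hdiv : rep v j / t = w := by
      rw [h1, mul_comm, Nat.mul_add_div (by omega), Nat.div_eq_of_lt (by omega), add_zero]
    simp only [repForest, repParent, hmod, hdiv, dif_pos hj, h3 (j + 1) (by omega) hj]
  have hanc : ∀ v (hv : v < n) d j (hj : j + d + 1 < t), (repForest n t rep hrep).IsAncestor
      ⟨rep v (j + d + 1), rep_lt_card hrep hv hj⟩ ⟨rep v j, rep_lt_card hrep hv (by omega)⟩ := by
    intro v hv d
    induction d with
    | zero => exact fun j hj => .single (hpar v hv j hj)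
    | succ d ih =>
      intro j hj
      have := ih (j + 1) (by omega)
      simp only [show j + 1 + d + 1 = j + (d + 1) + 1 by omega] at this
      exact .tail this (hpar v hv j (by omega))
  -- The colour of `u` keeps its place, and the place its node, in all bags on the way from `v` up
  -- to that of `u`. So the ends of an edge `uv` both lie on the path of `v`.
  have hup : ∀ v < n, ∀ u < v, A u v → ∀ j < t, digit (t + 2) (cur (n - 1) v) j = col u →
      digit (t + 2) (cur (n - 1) u) j = col u ∧ rep v j = rep u j := by
    intro v
    induction v using Nat.strong_induction_on with
    | _ v ih =>
      intro hv u hu hA j hj hd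
      have hpv := hE.par_lt v (by omega) hv
      obtain ⟨hseen, hd'⟩ := hT.digit_par hE hv hu hA hj hd
      have hr := (hR v hv j hj).1 hseen
      rcases hE.par_spec u v hv hu hA with rfl | ⟨h1, h2⟩
      · exact ⟨hd', hr⟩
      · obtain ⟨h3, h4⟩ := ih (par v) hpv (by omega) u h1 h2 j hj hd'
        exact ⟨h3, hr.trans h4⟩
  have hlt : ∀ v < n, psi v < n * t := fun v hv => by
    obtain ⟨j, hj, hd⟩ := hslot v hv
    rw [hpsi v hv j hj hd]
    exact rep_lt_card hrep hv hj
  have hedge : ∀ u v (hv : v < n) (hu : u < v), A u v →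
      (repForest n t rep hrep).IsAncestor ⟨psi u, hlt u (by omega)⟩ ⟨psi v, hlt v hv⟩ ∨
      (repForest n t rep hrep).IsAncestor ⟨psi v, hlt v hv⟩ ⟨psi u, hlt u (by omega)⟩ := by
    intro u v hv hu hA
    have hun : u < n := by omega
    obtain ⟨j, hj, hd⟩ := hslot v hv
    obtain ⟨i, hi, hdi⟩ := hT.exists_digit hE hv (hE.col_lt u hun)
      (by have := hE.two_le_col u hun; omega) (.inr ⟨u, hu, hA, rfl⟩)
    obtain ⟨h1, h2⟩ := hup v hv u hu hA i hi hdi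
    have e1 : psi u = rep v i := (hpsi u hun i hi h1).trans h2.symm
    have e2 : psi v = rep v j := hpsi v hv j hj hd
    have hne : i ≠ j := by
      rintro rfl
      exact hE.col_ne u v hu hv hA (hdi.symm.trans hd)
    simp only [e1, e2]
    rcases lt_or_gt_of_ne hne with h | h
    · obtain ⟨d, rfl⟩ : ∃ d, j = i + d + 1 := ⟨j - i - 1, by omega⟩
      exact .inr (hanc v hv d i hj)
    · obtain ⟨d, rfl⟩ : ∃ d, i = j + d + 1 := ⟨i - j - 1, by omega⟩
      exact .inl (hanc v hv d j hi)
  refine ⟨repForest n t rep hrep, fun v => ⟨psi v, hlt v v.isLt⟩, repForest_height_le hrep, ?_,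
    fun _ => rfl, ?_, ?_⟩
  · intro i
    simp only [repForest, repParent]
    split_ifs <;> rfl
  · intro x y hxy
    obtain ⟨i, hi, hdi⟩ := hslot x x.isLt
    obtain ⟨j, hj, hdj⟩ := hslot y y.isLt
    have he : rep x i = rep y j := by
      rw [← hpsi x x.isLt i hi hdi, ← hpsi y y.isLt j hj hdj]
      exact congrArg Fin.val hxy
    obtain ⟨w, hw, h1, h2, -⟩ := hT.rep_spec hE hR x.isLt hi
    obtain ⟨w', hw', h1', h2', -⟩ := hT.rep_spec hE hR y.isLt hj
    -- Equal nodes have the same height, the remainder modulo `t`, and the same bag of origin, the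
    -- quotient, to which both vertices climb.
    rw [h1, h1'] at he
    have hij : i = j := by
      have := congrArg (· % t) he
      simpa [mul_comm _ t, Nat.mul_add_mod, Nat.mod_eq_of_lt hi, Nat.mod_eq_of_lt hj] using this
    subst hij
    obtain rfl : w = w' := Nat.eq_of_mul_eq_mul_right (show 0 < t by omega) (by omega)
    exact Fin.ext (hT.eq_of_climbs hE hi x.isLt y.isLt hdi hdj h2 h2')
  · intro u v hA
    rcases lt_trichotomy (u : ℕ) v with h | h | h
    · exact hedge u v v.isLt h hA
    · rw [h] at hA
      exact absurd hA (hE.irrefl _)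
    · exact (hedge v u u.isLt h (hE.symm _ _ hA)).symm

end Soundness

/-! ### Completeness: a decomposition yields reachable states -/

section Completeness

/-- `y` belongs to the subtree of `k`. -/
inductive IsBelow (par : ℕ → ℕ) (y : ℕ) : ℕ → Prop
  | refl : IsBelow par y y
  | step (w : ℕ) : IsBelow par y w → 0 < w → IsBelow par y (par w)

variable (hE : IsElimination n t A par col cs)

include hE in
theorem IsBelow.le {y k : ℕ} (hy : y < n) (h : IsBelow par y k) : k ≤ y := by
  induction h with
  | refl => exact le_rfl
  | step w _ hw ih =>
    have := hE.par_lt w hw (by omega)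
    omega

theorem IsBelow.total {y k k' : ℕ} (h : IsBelow par y k) (h' : IsBelow par y k') :
    IsBelow par k k' ∨ IsBelow par k' k := by
  induction h with
  | refl => exact .inl h'
  | step w hw hw0 ih =>
    rcases ih with ih | ih
    · cases ih with
      | refl => exact .inr (.step _ .refl hw0)
      | step w' h1 h2 =>
        clear h'
        have : ∀ v, IsBelow par w v → v = w ∨ IsBelow par (par w) v := by
          intro v hv
          induction hv with
          | refl => exact .inl rfl
          | step w'' _ h4 ih =>
            rcases ih with rfl | ih
            · exact .inr .refl
            · exact .inr (.step _ ih h4)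
        rcases this _ (.step w' h1 h2) with h | h
        · rw [h]
          exact .inr (.step _ .refl hw0)
        · exact .inl h
    · exact .inr (.step _ ih hw0)

include hE in
-- Both lie on the way up from `y`, so one is above the other. If they differed, the upper one would
-- be at most the parent of the lower one, which is also its own parent and thus smaller than it.
theorem IsBelow.eq_of_par_eq {y k k' : ℕ} (hy : y < n) (h : IsBelow par y k)
    (h' : IsBelow par y k') (hk : 0 < k) (hk' : 0 < k') (hp : par k = par k') : k = k' := by
  have hkn : k < n := (h.le hE hy).trans_lt hy
  have hkn' : k' < n := (h'.le hE hy).trans_lt hy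
  have key : ∀ {a c : ℕ}, 0 < a → 0 < c → a < n → c < n → par a = par c → IsBelow par a c →
      a = c := by
    intro a c ha hc han hcn hac hb
    have hd : c = a ∨ c ≤ par a := by
      clear hc hcn hac
      induction hb with
      | refl => exact .inl rfl
      | step w hw hw0 ih =>
        have hwn : w < n := (hw.le hE han).trans_lt han
        have := hE.par_lt w hw0 hwn
        rcases ih with rfl | ih
        · exact .inr le_rfl
        · exact .inr (by omega)
    have := hE.par_lt c hc hcn
    omega
  rcases h.total h' with h | h
  · exact key hk hk' hkn hkn' hp h
  · exact (key hk' hk hkn' hkn hp.symm h).symm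

include hE in
/-- If there is a treedepth decomposition of height at most `t`, then the dynamic program finds a
state for the root. -/
theorem exists_reach {N : Type*} {F : RootedForest N} {ψ : ℕ → N}
    (hinj : ∀ u v, u < n → v < n → ψ u = ψ v → u = v)
    (hadj : ∀ u v, u < n → v < n → A u v → F.Comparable (ψ u) (ψ v))
    (hdepth : ∀ v < n, F.depth (ψ v) ≤ t) (i : ℕ) (hi : i < n) :
    ∀ v < n, ∃ x < (t + 2) ^ t, Reach n t par col cs i v x ∧
      (∀ u, (u = v ∨ u < v ∧ A u v) → digit (t + 2) x (t - F.depth (ψ u)) = col u) ∧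
      (∀ j < t, 2 ≤ digit (t + 2) x j → ∃ u, (u = v ∨ u < v ∧ A u v) ∧
        t - F.depth (ψ u) = j) ∧
      (∀ j < t, digit (t + 2) x j = 1 → ∃ k y, n - i ≤ k ∧ k ≤ y ∧ y < n ∧ par k = v ∧
        IsBelow par y k ∧ t - F.depth (ψ y) = j ∧
        ∃ u, (u = v ∨ u < v ∧ A u v) ∧ F.IsAncestor (ψ y) (ψ u)) := by
  -- A bag is a clique. Hence its images form a chain, and depths as well as colours distinguish its
  -- vertices.
  have hbag : ∀ v < n, ∀ u u', (u = v ∨ u < v ∧ A u v) → (u' = v ∨ u' < v ∧ A u' v) →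
      u = u' ∨ A u u' := by
    rintro v hv u u' (rfl | ⟨h1, h2⟩) (rfl | ⟨h3, h4⟩)
    · exact .inl rfl
    · exact .inr (hE.symm _ _ h4)
    · exact .inr h2
    · by_cases h : u = u'
      · exact .inl h
      · exact .inr (hE.clique u u' v hv h1 h3 h h2 h4)
  have hcomp : ∀ v < n, ∀ u u', (u = v ∨ u < v ∧ A u v) → (u' = v ∨ u' < v ∧ A u' v) →
      F.Comparable (ψ u) (ψ u') := by
    intro v hv u u' hu hu'
    rcases hbag v hv u u' hu hu' with rfl | h
    · exact .inl rfl
    · exact hadj u u' (by omega) (by omega) h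
  have hd : ∀ v < n, 1 ≤ F.depth (ψ v) ∧ F.depth (ψ v) ≤ t := fun v hv =>
    ⟨F.depth_pos _, hdepth v hv⟩
  have hinj' : ∀ v < n, ∀ u u', (u = v ∨ u < v ∧ A u v) → (u' = v ∨ u' < v ∧ A u' v) →
      t - F.depth (ψ u) = t - F.depth (ψ u') → u = u' := by
    intro v hv u u' hu hu' he
    have h1 := hd u (by omega)
    have h2 := hd u' (by omega)
    exact hinj u u' (by omega) (by omega) ((hcomp v hv u u' hu hu').eq_of_depth_eq (by omega))
  have hcolinj : ∀ v < n, ∀ u u', (u = v ∨ u < v ∧ A u v) → (u' = v ∨ u' < v ∧ A u' v) →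
      col u = col u' → u = u' := by
    intro v hv u u' hu hu' he
    rcases hbag v hv u u' hu hu' with rfl | h
    · rfl
    · rcases lt_trichotomy u u' with hlt | rfl | hlt
      · exact absurd he (hE.col_ne u u' hlt (by omega) h)
      · rfl
      · exact absurd he.symm (hE.col_ne u' u hlt (by omega) (hE.symm _ _ h))
  induction i with
  | zero =>
    intro v hv
    classical
    -- Each bag vertex puts its colour at its height, and the other places are free. There is only
    -- one vertex to choose, by `hinj'`.
    obtain ⟨x, hx, hdig⟩ := exists_digit_eq (b := t + 2) t (fun j =>
      if h : ∃ u, (u = v ∨ u < v ∧ A u v) ∧ t - F.depth (ψ u) = j then col h.choose else 0)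
      (fun j hj => by
        split_ifs with h
        · exact hE.col_lt _ (by have := h.choose_spec.1; omega)
        · omega)
    have hdig' : ∀ u, (u = v ∨ u < v ∧ A u v) →
        digit (t + 2) x (t - F.depth (ψ u)) = col u := by
      intro u hu
      have := hd u (by omega)
      rw [hdig _ (by omega)]
      have h : ∃ u', (u' = v ∨ u' < v ∧ A u' v) ∧
          t - F.depth (ψ u') = t - F.depth (ψ u) := ⟨u, hu, rfl⟩
      simp only [dif_pos h]
      rw [hinj' v hv _ u h.choose_spec.1 hu h.choose_spec.2]
    have hdig2 : ∀ j < t, digit (t + 2) x j ≠ 0 → ∃ u, (u = v ∨ u < v ∧ A u v) ∧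
        t - F.depth (ψ u) = j := by
      intro j hj h
      by_contra hcon
      rw [hdig j hj] at h
      simp [hcon] at h
    refine ⟨x, hx, ?_, hdig', fun j hj h => hdig2 j hj (by omega), fun j hj h => ?_⟩
    · intro d hd1 hdt
      by_cases hc : d = col v ∨ ∃ u < v, A u v ∧ col u = d
      · obtain ⟨u, hu, rfl⟩ : ∃ u, (u = v ∨ u < v ∧ A u v) ∧ col u = d := by
          rcases hc with rfl | ⟨u, h1, h2, h3⟩
          · exact ⟨v, .inl rfl, rfl⟩
          · exact ⟨u, .inr ⟨h1, h2⟩, h3⟩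
        rw [hE.cs_eq_one v hv _ hdt hc, Finset.card_eq_one]
        refine ⟨t - F.depth (ψ u), Finset.ext fun j => ?_⟩
        simp only [Finset.mem_filter, Finset.mem_range, Finset.mem_singleton]
        constructor
        · rintro ⟨hj, h⟩
          obtain ⟨u', hu', rfl⟩ := hdig2 j hj (by omega)
          rw [hdig' u' hu'] at h
          rw [hcolinj v hv u' u hu' hu h]
        · rintro rfl
          have := hd u (by omega)
          exact ⟨by omega, hdig' u hu⟩
      · rw [hE.cs_eq_zero v hv _ hdt hc, Finset.card_eq_zero, Finset.filter_eq_empty_iff]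
        intro j hj h
        obtain ⟨u, hu, rfl⟩ := hdig2 j (Finset.mem_range.1 hj) (by omega)
        rw [hdig' u hu] at h
        apply hc
        rcases hu with rfl | hu
        · exact .inl h.symm
        · exact .inr ⟨u, hu.1, hu.2, h⟩
    · obtain ⟨u, hu, rfl⟩ := hdig2 j hj (by omega)
      rw [hdig' u hu] at h
      have := hE.two_le_col u (by omega)
      omega
  | succ i ih =>
    intro v hv
    obtain ⟨x, hx, hxr, hx1, hx2, hx3⟩ := ih (by omega) v hv
    by_cases hp : v = par (n - 1 - i)
    swap
    · refine ⟨x, hx, by simpa only [Reach, if_neg hp] using hxr, hx1, hx2, fun j hj h => ?_⟩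
      obtain ⟨k, y, h1, h2⟩ := hx3 j hj h
      exact ⟨k, y, by omega, h2⟩
    generalize hk : n - 1 - i = k at hp
    have hk0 : 0 < k := by omega
    have hkn : k < n := by omega
    obtain ⟨y, hy, hyr, hy1, hy2, hy3⟩ := ih (by omega) k hkn
    have hvk : v < k := hp ▸ hE.par_lt k hk0 hkn
    have hsub : ∀ u, u < k → A u k → (u = v ∨ u < v ∧ A u v) := by
      intro u hu hA
      rw [hp]
      exact hE.par_spec u k hkn hu hA
    have hc2 := hE.two_le_col k hkn
    classical
    -- `Merge` prescribes all digits of `z`. What has to be shown is that its demands on `x` are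
    -- met: `hcolour` for the common vertices, `hused` for the places that become `1`.
    obtain ⟨z, hz, hdig⟩ := exists_digit_eq (b := t + 2) t (fun j =>
      if 2 ≤ digit (t + 2) y j ∧ digit (t + 2) y j ≠ col k then digit (t + 2) y j
      else if digit (t + 2) y j ≠ 0 ∧ Seen (t + 2) (col k) y j then 1 else digit (t + 2) x j)
      (fun j hj => by
        have h1 := digit_lt (show 0 < t + 2 by omega) y j
        have h2 := digit_lt (show 0 < t + 2 by omega) x j
        split_ifs <;> omega)
    have hcolour : ∀ j < t, 2 ≤ digit (t + 2) y j → digit (t + 2) y j ≠ col k →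
        ∃ u, u < k ∧ A u k ∧ t - F.depth (ψ u) = j ∧ digit (t + 2) y j = col u ∧
          digit (t + 2) x j = col u := by
      intro j hj h1 h2
      obtain ⟨u, hu, rfl⟩ := hy2 j hj h1
      have h3 := hy1 u hu
      rcases hu with rfl | hu
      · exact absurd h3 h2
      · exact ⟨u, hu.1, hu.2, rfl, h3, hx1 u (hsub u hu.1 hu.2)⟩
    have hused : ∀ j < t, ¬ (2 ≤ digit (t + 2) y j ∧ digit (t + 2) y j ≠ col k) →
        digit (t + 2) y j ≠ 0 → Seen (t + 2) (col k) y j → digit (t + 2) x j = 0 ∧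
        ∃ k' y, n - (i + 1) ≤ k' ∧ k' ≤ y ∧ y < n ∧ par k' = v ∧
        IsBelow par y k' ∧ t - F.depth (ψ y) = j ∧
        ∃ u, (u = v ∨ u < v ∧ A u v) ∧ F.IsAncestor (ψ y) (ψ u) := by
      intro j hj h1 h2 h3
      obtain ⟨i₀, hi₀, h4, h5⟩ := h3
      obtain ⟨u, huk, huA, hui, huy, -⟩ := hcolour i₀ (by omega) h4 h5
      have hne : i₀ ≠ j := by
        rintro rfl
        exact h1 ⟨h4, h5⟩
      -- The place is taken by a vertex `w` of the subtree of `k`: by `k` itself, or by an already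
      -- forgotten vertex.
      have hw : ∃ w, k ≤ w ∧ w < n ∧ IsBelow par w k ∧ t - F.depth (ψ w) = j ∧
          ∃ u', (u' = k ∨ u' < k ∧ A u' k) ∧ F.Comparable (ψ w) (ψ u) := by
        by_cases hc : digit (t + 2) y j = col k
        · obtain ⟨u', hu', hj'⟩ := hy2 j hj (by omega)
          have h6 := hy1 u' hu'
          rw [hj', hc] at h6
          obtain rfl := hcolinj k hkn u' k hu' (.inl rfl) h6.symm
          exact ⟨u', le_rfl, hkn, .refl, hj', u', .inl rfl,
            hcomp u' hkn u' u (.inl rfl) (.inr ⟨huk, huA⟩)⟩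
        · obtain ⟨k', w, h6, h7, h8, h9, h10, h11, u', hu', h12⟩ := hy3 j hj (by omega)
          have h13 : IsBelow par w k := h9 ▸ .step k' h10 (by omega)
          exact ⟨w, h13.le hE h8, h8, h13, h11, u', hu',
            h12.comparable (hcomp k hkn u' u hu' (.inr ⟨huk, huA⟩))⟩
      obtain ⟨w, hkw, hwn, hwb, hwj, -, -, hwu⟩ := hw
      have hdw := hd w hwn
      have hdu := hd u (by omega)
      have hanc : F.IsAncestor (ψ w) (ψ u) := hwu.isAncestor_of_depth_lt (by omega)
      refine ⟨?_, k, w, by omega, hkw, hwn, hp.symm, hwb, hwj, u, hsub u huk huA, hanc⟩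
      -- The image of `u` is lower, at the height `i₀ < j`, and has only one ancestor at the height
      -- `j`.
      have hany : ∀ w', w' < n → t - F.depth (ψ w') = j → F.Comparable (ψ w') (ψ u) → w' = w := by
        intro w' hw' hj' hc'
        have hdw' := hd w' hw'
        have hanc' : F.IsAncestor (ψ w') (ψ u) := hc'.isAncestor_of_depth_lt (by omega)
        exact hinj _ _ hw' hwn
          (RootedForest.Comparable.eq_of_depth_eq (hanc'.total hanc) (by omega))
      by_contra hx0
      by_cases hx1' : digit (t + 2) x j = 1
      -- A `1` in `x` would come from a sibling `k' > k` that also has `w` in its subtree; a colour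
      -- would come from a bag vertex `u' ≤ v`, whereas `v < k ≤ w`.
      · obtain ⟨k', w', h6, h7, h8, h9, h10, h11, u', hu', h12⟩ := hx3 j hj hx1'
        obtain rfl := hany w' h8 h11 (h12.comparable (hcomp v hv u' u hu' (hsub u huk huA)))
        have := hwb.eq_of_par_eq hE hwn h10 hk0 (by omega) (hp.symm.trans h9.symm)
        omega
      · obtain ⟨u', hu', h6⟩ := hx2 j hj (by omega)
        have := hany u' (by omega) h6 (hcomp v hv u' u hu' (hsub u huk huA))
        omega
    refine ⟨z, hz, ?_, ?_, ?_, ?_⟩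
    · simp only [Reach, hk, if_pos hp]
      refine ⟨x, hx, y, hy, hxr, hyr, fun j hj => ⟨fun h => ?_, fun h1 h2 h3 => ?_, fun h1 h2 => ?_⟩⟩
      · obtain ⟨u, -, -, -, h1, h2⟩ := hcolour j hj h.1 h.2
        rw [hdig j hj, if_pos h]
        exact ⟨h2.trans h1.symm, rfl⟩
      · rw [hdig j hj, if_neg h1, if_pos ⟨h2, h3⟩]
        exact ⟨(hused j hj h1 h2 h3).1, rfl⟩
      · rw [hdig j hj, if_neg h1, if_neg h2]
    · intro u hu
      have hdu := hd u (by omega)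
      have hxu := hx1 u hu
      have hu2 := hE.two_le_col u (by omega)
      rw [hdig _ (by omega)]
      split_ifs with h1 h2
      · obtain ⟨u', -, -, -, h3, h4⟩ := hcolour _ (by omega) h1.1 h1.2
        rw [h3, ← h4, hxu]
      · have := (hused _ (by omega) h1 h2.1 h2.2).1
        omega
      · exact hxu
    · intro j hj h
      rw [hdig j hj] at h
      split_ifs at h with h1 h2
      · obtain ⟨u, h3, h4, h5, -⟩ := hcolour j hj h1.1 h1.2
        exact ⟨u, hsub u h3 h4, h5⟩
      · omega
      · exact hx2 j hj h
    · intro j hj h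
      rw [hdig j hj] at h
      split_ifs at h with h1 h2
      · omega
      · exact (hused j hj h1 h2.1 h2.2).2
      · obtain ⟨k', y', h6, h7⟩ := hx3 j hj h
        exact ⟨k', y', by omega, h7⟩

end Completeness

end DynamicProgram

/-! ## The dynamic program on the machine -/

namespace ArrayMachine

open WordRAM (Op)

infixl:65 " +ᵃ " => AExpr.op WordRAM.Op.add
infixl:65 " -ᵃ " => AExpr.op WordRAM.Op.sub
infixl:70 " *ᵃ " => AExpr.op WordRAM.Op.mul
infixl:70 " /ᵃ " => AExpr.op WordRAM.Op.div
infixl:70 " %ᵃ " => AExpr.op WordRAM.Op.mod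
infix:50 " <ᵃ " => AExpr.op WordRAM.Op.lt
infix:50 " =ᵃ " => AExpr.op WordRAM.Op.eq
infixr:40 " ;; " => AProg.seq

attribute [simp] AProg.WP_skip AProg.WP_assign AProg.WP_store AProg.WP_seq AProg.WP_ite
  AExpr.eval AExpr.Safe WordRAM.Op.eval

/-- The bounds for values and arrays are large enough for `n` vertices and height `t`. -/
structure Env.Large (E : Env) (n t : ℕ) : Prop where
  M_zero : E.M 0 = 2 + n * t + n
  M_succ : ∀ k, E.M (k + 1) = E.M 1
  M_q : n * (t + 2) ^ t ≤ E.M 1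
  M_b : n * (t + 2) ≤ E.M 1
  M_W : t * (t + n + 3 * (t * n) + 2) ≤ E.M 1
  B_q : ((t + 2) ^ t) ^ 3 + 1 ≤ E.B
  B_n : 4 * (n + 1) * (t + 2) ≤ E.B

theorem index_lt {n b v x : ℕ} (hv : v < n) (hx : x < b) : v * b + x < n * b :=
  calc v * b + x < v * b + b := by omega
    _ = (v + 1) * b := by ring
    _ ≤ n * b := Nat.mul_le_mul_right b hv

theorem index_inj {b v v' x x' : ℕ} (hx : x < b) (hx' : x' < b) (h : v * b + x = v' * b + x') :
    v = v' ∧ x = x' := by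
  have h1 : (v * b + x) / b = v := by
    rw [mul_comm, Nat.mul_add_div (by omega), Nat.div_eq_of_lt hx, add_zero]
  have h2 : (v' * b + x') / b = v' := by
    rw [mul_comm, Nat.mul_add_div (by omega), Nat.div_eq_of_lt hx', add_zero]
  have h3 : v = v' := by rw [← h1, ← h2, h]
  subst h3
  exact ⟨rfl, by omega⟩

/-- The registers `0`, `1`, `2`, `3` hold `t`, `n`, `t + 2` and the number `(t + 2) ^ t` of
states. -/
structure Parameters (n t : ℕ) (s : AState) : Prop where
  t_eq : s.reg 0 = t
  n_eq : s.reg 1 = n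
  b_eq : s.reg 2 = t + 2
  q_eq : s.reg 3 = (t + 2) ^ t

theorem Parameters.of_frame {n t : ℕ} {s s' : AState} {p : AProg} {xs : List ℕ}
    (h : Parameters n t s) (hf : p.Frame xs s s')
    (h' : ∀ z < 4, z ∉ xs ∧ p.writesReg z = false) : Parameters n t s' where
  t_eq := (hf.reg 0 (h' 0 (by omega)).1 (h' 0 (by omega)).2).trans h.t_eq
  n_eq := (hf.reg 1 (h' 1 (by omega)).1 (h' 1 (by omega)).2).trans h.n_eq
  b_eq := (hf.reg 2 (h' 2 (by omega)).1 (h' 2 (by omega)).2).trans h.b_eq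
  q_eq := (hf.reg 3 (h' 3 (by omega)).1 (h' 3 (by omega)).2).trans h.q_eq

theorem Parameters.setReg {n t : ℕ} {s : AState} (h : Parameters n t s) {x v : ℕ} (hx : 4 ≤ x) :
    Parameters n t (s.setReg x v) := by
  constructor <;> rw [AState.reg_setReg, if_neg (by omega)]
  exacts [h.t_eq, h.n_eq, h.b_eq, h.q_eq]

theorem digit_succ (b x j : ℕ) : x / b ^ j / b = x / b ^ (j + 1) := by
  rw [Nat.div_div_eq_div_mul, pow_succ]

theorem div_pow_mod (b x j : ℕ) : x / b ^ j % b = digit b x j := rfl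

variable {E : Env} {n t : ℕ}

theorem Env.Large.le_B (hE : E.Large n t) : (t + 2) ^ t + 1 ≤ E.B ∧ 4 * n + 4 ≤ E.B ∧
    4 * t + 8 ≤ E.B ∧ n * t ≤ E.B ∧ ((t + 2) ^ t) ^ 2 + 1 ≤ E.B := by
  have h1 : 0 < (t + 2) ^ t := by positivity
  have h2 : (t + 2) ^ t ≤ ((t + 2) ^ t) ^ 3 := Nat.le_self_pow (by norm_num) _
  have h3 : ((t + 2) ^ t) ^ 2 ≤ ((t + 2) ^ t) ^ 3 := Nat.pow_le_pow_right h1 (by norm_num)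
  have h4 := hE.B_q
  have h5 := hE.B_n
  refine ⟨by omega, by nlinarith, by nlinarith, by nlinarith, by omega⟩

/-- Counts the digits `d + 1` of the number in register `9`, where `d` is in register `11`. -/
def countDigit : AProg :=
  .assign 13 (.lit 0) ;; .assign 14 (.reg 9) ;;
  .loop 15 0 (
    .ite (.reg 14 %ᵃ .reg 2 =ᵃ .reg 11 +ᵃ .lit 1) (.assign 13 (.reg 13 +ᵃ .lit 1)) .skip ;;
    .assign 14 (.reg 14 /ᵃ .reg 2))

theorem countDigit_spec (hE : E.Large n t) {s : AState} (hp : Parameters n t s)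
    (hx : s.reg 9 < (t + 2) ^ t) :
    AProg.WP E countDigit s fun c s' => c ≤ 6 * (t + 1) ∧ s'.reg 13 =
      ((Finset.range t).filter fun j => digit (t + 2) (s.reg 9) j = s.reg 11 + 1).card := by
  obtain ⟨h1, h2, h3, h4, h5⟩ := hE.le_B
  simp only [countDigit, AProg.WP_seq, AProg.WP_assign]
  simp
  refine ⟨by omega, ?_⟩
  refine AProg.WP_loop 3 (fun i s' => s'.reg 14 = s.reg 9 / (t + 2) ^ i ∧ s'.reg 13 =
      ((Finset.range i).filter fun j => digit (t + 2) (s.reg 9) j = s.reg 11 + 1).card)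
    rfl rfl (by norm_num) (by simp) ?_ ?_
  · rintro i s' hi h6 h7 hf ⟨h8, h9⟩
    simp [hp.t_eq] at hi
    have h10 : s'.reg 11 = s.reg 11 := by simpa using hf.reg 11 (by simp) rfl
    have h11 : s'.reg 2 = t + 2 := by simpa [hp.b_eq] using hf.reg 2 (by simp) rfl
    have h12 : s.reg 9 / (t + 2) ^ i ≤ s.reg 9 := Nat.div_le_self _ _
    have h13 : s.reg 9 / (t + 2) ^ i / (t + 2) ≤ s.reg 9 := (Nat.div_le_self _ _).trans h12
    have hcard : ((Finset.range i).filter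
        fun j => digit (t + 2) (s.reg 9) j = s.reg 11 + 1).card ≤ i := by
      simpa using Finset.card_filter_le (Finset.range i) _
    simp only [Finset.range_add_one, Finset.filter_insert]
    simp [h8, h9, h10, h11, digit_succ, div_pow_mod]
    rw [digit_succ] at h13
    by_cases hd : digit (t + 2) (s.reg 9) i = s.reg 11 + 1
    · simp [hd]
      omega
    · simp [hd]
      omega
  · rintro c s' hc h6 hf ⟨h7, h8⟩
    simp [hp.t_eq] at hc h8
    exact ⟨by omega, h8⟩

/-- The arrays `6`, `7` and `8` hold parents, colours and the colours of bags. -/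
structure Bags (n t : ℕ) (par col : ℕ → ℕ) (cs : ℕ → ℕ → ℕ) (s : AState) : Prop where
  par_eq : ∀ v < n, s.arr 6 v = par v
  col_eq : ∀ v < n, s.arr 7 v = col v
  cs_eq : ∀ v < n, ∀ d < t + 2, s.arr 8 (v * (t + 2) + d) = cs v d

theorem Bags.of_frame {par col : ℕ → ℕ} {cs : ℕ → ℕ → ℕ} {s s' : AState} {p : AProg}
    {xs : List ℕ} (h : Bags n t par col cs s) (hf : p.Frame xs s s') (h6 : p.writesArr 6 = false)
    (h7 : p.writesArr 7 = false) (h8 : p.writesArr 8 = false) : Bags n t par col cs s' where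
  par_eq v hv := by rw [hf.arr 6 h6, h.par_eq v hv]
  col_eq v hv := by rw [hf.arr 7 h7, h.col_eq v hv]
  cs_eq v hv d hd := by rw [hf.arr 8 h8, h.cs_eq v hv d hd]

/-- Register `10` becomes one if the number in register `9` is an initial state for the vertex in
register `8`, and zero otherwise. -/
def checkInit : AProg :=
  .assign 10 (.lit 1) ;;
  .loop 11 12 (countDigit ;;
    .ite (.reg 13 =ᵃ .arr 8 (.reg 8 *ᵃ .reg 2 +ᵃ (.reg 11 +ᵃ .lit 1))) .skip (.assign 10 (.lit 0)))

theorem checkInit_spec (hE : E.Large n t) {s : AState} (hp : Parameters n t s)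
    {par col : ℕ → ℕ} {cs : ℕ → ℕ → ℕ} (hb : Bags n t par col cs s) (h12 : s.reg 12 = t + 1)
    {v : ℕ} (hv : s.reg 8 = v) (hvn : v < n) (hx : s.reg 9 < (t + 2) ^ t) :
    AProg.WP E checkInit s fun c s' => c ≤ 20 * (t + 1) ^ 2 ∧ s'.reg 10 ≤ 1 ∧
      (s'.reg 10 ≠ 0 ↔ IsInitState t (cs v) (s.reg 9)) := by
  obtain ⟨h1, h2, h3, h4, h5⟩ := hE.le_B
  simp only [checkInit, AProg.WP_seq, AProg.WP_assign]
  refine ⟨⟨by simp, by simp; omega⟩, ?_⟩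
  obtain ⟨P, hP⟩ : ∃ P : ℕ → Prop, ∀ i, P i ↔ ∀ d < i, ((Finset.range t).filter
      fun j => digit (t + 2) (s.reg 9) j = d + 1).card = cs v (d + 1) := ⟨_, fun _ => Iff.rfl⟩
  have hP0 : P 0 := by simp [hP]
  have hPs : ∀ i, P (i + 1) ↔ P i ∧ ((Finset.range t).filter
      fun j => digit (t + 2) (s.reg 9) j = i + 1).card = cs v (i + 1) := fun i => by
    rw [hP, hP, Nat.forall_lt_succ_right]
  refine AProg.WP_loop (6 * (t + 1) + 3) (fun i s' => s'.reg 10 ≤ 1 ∧ (s'.reg 10 ≠ 0 ↔ P i))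
    rfl rfl (by norm_num) (by simp [hP0]) ?_ ?_
  · rintro i s' hi h6 h7 hf ⟨h8, h9⟩
    simp [h12] at hi
    have hs9 : s'.reg 9 = s.reg 9 := by simpa using hf.reg 9 (by simp) rfl
    have hs8 : s'.reg 8 = v := by simpa [hv] using hf.reg 8 (by simp) rfl
    have hp' : Parameters n t s' := (hp.setReg (by norm_num)).of_frame hf
      (by intro z hz; interval_cases z <;> exact ⟨by simp, rfl⟩)
    have hcs : s'.arr 8 (v * (t + 2) + (i + 1)) = cs v (i + 1) := by
      rw [hf.arr 8 rfl]
      exact hb.cs_eq v hvn _ (by omega)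
    have hidx := index_lt hvn (show i + 1 < t + 2 by omega)
    have hM : v * (t + 2) + (i + 1) < E.M 8 := by
      rw [hE.M_succ 7]
      exact hidx.trans_le hE.M_b
    rw [AProg.WP_seq]
    refine (countDigit_spec hE hp' (by rw [hs9]; exact hx)).frame fun c s'' hf' h => ?_
    obtain ⟨hc, hcount⟩ := h
    have hPs' := hPs i
    have e2 : s''.reg 2 = t + 2 := by rw [hf'.reg 2 (by simp) rfl, hp'.b_eq]
    have e8 : s''.reg 8 = v := by rw [hf'.reg 8 (by simp) rfl, hs8]
    have e10 : s''.reg 10 = s'.reg 10 := hf'.reg 10 (by simp) rfl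
    have e11 : s''.reg 11 = i := by rw [hf'.reg 11 (by simp) rfl, h6]
    rw [hs9, h6] at hcount
    have earr : s''.arr 8 = s'.arr 8 := hf'.arr 8 rfl
    rw [← hcount] at hPs'
    simp [e2, e8, e10, e11, earr, hcs, hM, hPs']
    exact ⟨fun h => ⟨by omega, h8, h9.trans (by simp [h])⟩, fun h => ⟨by omega, fun _ => h⟩⟩
  · rintro c s' hc h6 hf ⟨h7, h8⟩
    simp only [AState.reg_setReg, h12] at hc h8
    norm_num at hc h8
    rw [← ne_eq, hP] at h8
    refine ⟨by nlinarith, h7, h8.trans ?_⟩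
    constructor
    · intro h d hd1 hd2
      have := h (d - 1) (by omega)
      rwa [Nat.sub_add_cancel hd1] at this
    · intro h d hd
      exact h (d + 1) (by omega) (by omega)

def initTable : AProg :=
  .assign 12 (.reg 0 +ᵃ .lit 1) ;;
  .loop 8 1 (.loop 9 3 (checkInit ;; .store 9 (.reg 8 *ᵃ .reg 3 +ᵃ .reg 9) (.reg 10)))

theorem initTable_spec (hE : E.Large n t) {s : AState} (hp : Parameters n t s)
    {par col : ℕ → ℕ} {cs : ℕ → ℕ → ℕ} (hb : Bags n t par col cs s) :
    AProg.WP E initTable s fun c s' =>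
      c ≤ n * ((t + 2) ^ t * (20 * (t + 1) ^ 2 + 3) + 4) + 3 ∧
      ∀ v < n, ∀ x < (t + 2) ^ t,
        (s'.arr 9 (v * (t + 2) ^ t + x) ≠ 0 ↔ IsInitState t (cs v) x) := by
  obtain ⟨h1, h2, h3, h4, h5⟩ := hE.le_B
  simp only [initTable, AProg.WP_seq, AProg.WP_assign]
  refine ⟨⟨by simp, by simp [hp.t_eq]; omega⟩, ?_⟩
  refine AProg.WP_loop ((t + 2) ^ t * (20 * (t + 1) ^ 2 + 3) + 2) (fun i s' => ∀ v < i,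
    ∀ x < (t + 2) ^ t, (s'.arr 9 (v * (t + 2) ^ t + x) ≠ 0 ↔ IsInitState t (cs v) x))
    rfl rfl (by norm_num) (by simp) ?_ ?_
  · intro v s₁ hi hv h7 hf h8
    simp [hp.n_eq] at hi
    have hp₁ : Parameters n t s₁ := (hp.setReg (by norm_num)).of_frame hf
      (by intro z hz; interval_cases z <;> exact ⟨by simp, rfl⟩)
    have h12 : s₁.reg 12 = t + 1 := by simpa [hp.t_eq] using hf.reg 12 (by simp) rfl
    have hb₁ : Bags n t par col cs s₁ :=
      Bags.of_frame (s := s.setReg 12 _) ⟨hb.1, hb.2, hb.3⟩ hf rfl rfl rfl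
    refine AProg.WP_loop (20 * (t + 1) ^ 2 + 1) (fun i s' => ∀ v' ≤ v, ∀ x < (t + 2) ^ t,
      (v' < v ∨ x < i) → (s'.arr 9 (v' * (t + 2) ^ t + x) ≠ 0 ↔ IsInitState t (cs v') x))
      rfl rfl (by norm_num) ?_ ?_ ?_
    · intro v' hv' x hx h
      exact h8 v' (by omega) x hx
    · intro x s₂ hx hx₂ h9 hf₂ h10
      rw [hp₁.q_eq] at hx
      have hp₂ : Parameters n t s₂ := hp₁.of_frame hf₂
        (by intro z hz; interval_cases z <;> exact ⟨by simp, rfl⟩)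
      have hb₂ : Bags n t par col cs s₂ := hb₁.of_frame hf₂ rfl rfl rfl
      have hv₂ : s₂.reg 8 = v := by rw [hf₂.reg 8 (by simp) rfl, hv]
      have h12₂ : s₂.reg 12 = t + 1 := by rw [hf₂.reg 12 (by simp) rfl, h12]
      rw [AProg.WP_seq]
      refine (checkInit_spec hE hp₂ hb₂ h12₂ hv₂ hi (by rwa [hx₂])).frame fun c s₃ hf₃ h => ?_
      obtain ⟨hc, hle, hiff⟩ := h
      have e3 : s₃.reg 3 = (t + 2) ^ t := by rw [hf₃.reg 3 (by simp) rfl, hp₂.q_eq]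
      have e8 : s₃.reg 8 = v := by rw [hf₃.reg 8 (by simp) rfl, hv₂]
      have e9 : s₃.reg 9 = x := by rw [hf₃.reg 9 (by simp) rfl, hx₂]
      have earr : s₃.arr 9 = s₂.arr 9 := hf₃.arr 9 rfl
      have hM : v * (t + 2) ^ t + x < E.M 9 := by
        rw [hE.M_succ 8]
        exact (index_lt hi hx).trans_le hE.M_q
      rw [hx₂] at hiff
      simp only [AProg.WP_store, AExpr.Safe, AExpr.eval, Op.eval, e3, e8, e9]
      refine ⟨⟨by simp, by simp, hM, by omega⟩, by omega, ?_⟩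
      intro v' hv' x' hx' hor
      simp only [AState.arr_setReg, AState.arr_setArr, if_true, Function.update_apply]
      by_cases heq : v' * (t + 2) ^ t + x' = v * (t + 2) ^ t + x
      · obtain ⟨rfl, rfl⟩ := index_inj hx' hx heq
        rw [if_pos rfl, hiff]
      · rw [if_neg heq, earr]
        refine h10 v' hv' x' hx' ?_
        rcases hor with h | h
        · exact .inl h
        · rcases hv'.eq_or_lt with rfl | h'
          · refine .inr ?_
            have : x' ≠ x := fun h => heq (by rw [h])
            omega
          · exact .inl h'
    · intro c s₂ hc h9 hf₂ h10
      rw [hp₁.q_eq] at hc h10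
      refine ⟨by nlinarith, fun v' hv' x hx => ?_⟩
      simp only [AState.arr_setReg]
      exact h10 v' (by omega) x hx (.inr hx)
  · intro c s' hc h6 hf h7
    simp [hp.n_eq] at hc h7
    refine ⟨by linarith, fun v hv x hx => ?_⟩
    simpa using h7 v hv x hx

end ArrayMachine

/-! ### Testing a single merge on the machine -/

namespace ArrayMachine

open WordRAM (Op)

variable {E : Env} {n t : ℕ}

/-- The condition of `Merge` for one digit. -/
def MergeAt (t c x y z j : ℕ) : Prop :=
  (2 ≤ digit (t + 2) y j ∧ digit (t + 2) y j ≠ c →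
    digit (t + 2) x j = digit (t + 2) y j ∧ digit (t + 2) z j = digit (t + 2) y j) ∧
  (¬ (2 ≤ digit (t + 2) y j ∧ digit (t + 2) y j ≠ c) → digit (t + 2) y j ≠ 0 →
    Seen (t + 2) c y j → digit (t + 2) x j = 0 ∧ digit (t + 2) z j = 1) ∧
  (¬ (2 ≤ digit (t + 2) y j ∧ digit (t + 2) y j ≠ c) →
    ¬ (digit (t + 2) y j ≠ 0 ∧ Seen (t + 2) c y j) → digit (t + 2) z j = digit (t + 2) x j)

/-- Register `10` becomes one or zero according to whether the states in registers `19`, `20` and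
`21` satisfy `Merge` with the colour in register `17`. -/
def checkMerge : AProg :=
  .assign 10 (.lit 1) ;; .assign 22 (.lit 0) ;;
  .loop 15 0 (
    .assign 23 (.reg 20 %ᵃ .reg 2) ;; .assign 24 (.reg 19 %ᵃ .reg 2) ;;
    .assign 25 (.reg 21 %ᵃ .reg 2) ;;
    .assign 19 (.reg 19 /ᵃ .reg 2) ;; .assign 20 (.reg 20 /ᵃ .reg 2) ;;
    .assign 21 (.reg 21 /ᵃ .reg 2) ;;
    .ite ((.lit 1 <ᵃ .reg 23) *ᵃ ((.reg 23 =ᵃ .reg 17) =ᵃ .lit 0))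
      (.assign 22 (.lit 1) ;;
        .assign 10 (.reg 10 *ᵃ ((.reg 24 =ᵃ .reg 23) *ᵃ (.reg 25 =ᵃ .reg 23))))
      (.ite (.reg 23 *ᵃ .reg 22)
        (.assign 10 (.reg 10 *ᵃ ((.reg 24 =ᵃ .lit 0) *ᵃ (.reg 25 =ᵃ .lit 1))))
        (.assign 10 (.reg 10 *ᵃ (.reg 25 =ᵃ .reg 24)))))

/-- The verification condition of one round of `checkMerge`, in the form that simplification gives
it. Here `ok` and `seen` stand for the registers `10` and `22`, and multiplication by comparison
results acts as a conjunction. -/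
theorem checkMerge_step {B ok seen dx dy dz c : ℕ} {P P' Z Z' m : Prop} (hB : 1 ≤ B)
    (h8 : ok ≤ 1) (h9 : ok ≠ 0 ↔ P) (h10 : seen ≤ 1) (h11 : seen ≠ 0 ↔ Z) (hP : P' ↔ P ∧ m)
    (hZ : Z' ↔ Z ∨ (2 ≤ dy ∧ dy ≠ c)) (hcol : 2 ≤ dy → dy ≠ c → (m ↔ dx = dy ∧ dz = dy))
    (hused : ¬ (2 ≤ dy ∧ dy ≠ c) → dy ≠ 0 → Z → (m ↔ dx = 0 ∧ dz = 1))
    (hfree : ¬ (2 ≤ dy ∧ dy ≠ c) → (dy = 0 ∨ ¬ Z) → (m ↔ dz = dx)) :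
    (¬ dy = c → 1 < dy → 1 ≤ B ∧ (if dz = dy then if dx = dy then ok else 0 else 0) ≤ B ∧
      (if dz = dy then if dx = dy then ok else 0 else 0) ≤ 1 ∧
      (dz = dy ∧ dx = dy ∧ ¬ ok = 0 ↔ P') ∧ Z') ∧
    ((¬ dy = c → dy ≤ 1) →
      (¬ dy = 0 → ¬ seen = 0 → (if dz = 1 then if dx = 0 then ok else 0 else 0) ≤ B ∧
        (if dz = 1 then if dx = 0 then ok else 0 else 0) ≤ 1 ∧
        (dz = 1 ∧ dx = 0 ∧ ¬ ok = 0 ↔ P') ∧ seen ≤ 1 ∧ (¬ seen = 0 ↔ Z')) ∧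
      (dy = 0 ∨ seen = 0 → (if dz = dx then ok else 0) ≤ B ∧ (if dz = dx then ok else 0) ≤ 1 ∧
        (dz = dx ∧ ¬ ok = 0 ↔ P') ∧ seen ≤ 1 ∧ (¬ seen = 0 ↔ Z'))) := by
  have hif : ∀ (q r : Prop) [Decidable q] [Decidable r],
      (if q then if r then ok else 0 else 0) ≤ 1 := by
    intro q r _ _
    split_ifs <;> omega
  have hif' : ∀ (q : Prop) [Decidable q], (if q then ok else 0) ≤ 1 := by
    intro q _
    split_ifs <;> omega
  refine ⟨fun ha hb => ?_, fun ha => ⟨fun hb hs => ?_, fun hb => ?_⟩⟩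
  · rw [hP, hZ, hcol hb ha, ← h9]
    exact ⟨hB, (hif _ _).trans hB, hif _ _, ⟨fun h => ⟨h.2.2, h.2.1, h.1⟩, fun h => ⟨h.2.2, h.2.1, h.1⟩⟩, .inr ⟨hb, ha⟩⟩
  · rw [hP, hZ, hused (by omega) hb (h11.1 hs), ← h9, ← h11]
    exact ⟨(hif _ _).trans hB, hif _ _, ⟨fun h => ⟨h.2.2, h.2.1, h.1⟩, fun h => ⟨h.2.2, h.2.1, h.1⟩⟩, h10, by simp [hs]⟩
  · have hb' : dy = 0 ∨ ¬ Z := hb.imp_right fun h h' => h11.2 h' h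
    rw [hP, hZ, hfree (by omega) hb', ← h9, ← h11]
    refine ⟨(hif' _).trans hB, hif' _, and_comm, h10, fun h => .inl h, ?_⟩
    rintro (h | h)
    · exact h
    · omega

theorem checkMerge_spec (hE : E.Large n t) {s : AState} (hp : Parameters n t s) {c x y z : ℕ}
    (hc : s.reg 17 = c) (hx : s.reg 19 = x) (hy : s.reg 20 = y) (hz : s.reg 21 = z)
    (hxq : x < (t + 2) ^ t) (hyq : y < (t + 2) ^ t) (hzq : z < (t + 2) ^ t) :
    AProg.WP E checkMerge s fun k s' => k ≤ 14 * (t + 1) ∧ s'.reg 10 ≤ 1 ∧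
      (s'.reg 10 ≠ 0 ↔ Merge t c x y z) := by
  obtain ⟨h1, h2, h3, h4, h5⟩ := hE.le_B
  simp only [checkMerge, AProg.WP_seq, AProg.WP_assign]
  refine ⟨⟨by simp, by simp; omega⟩, ⟨by simp, by simp⟩, ?_⟩
  obtain ⟨P, hP⟩ : ∃ P : ℕ → Prop, ∀ i, P i ↔ ∀ j < i, MergeAt t c x y z j := ⟨_, fun _ => Iff.rfl⟩
  have hPs : ∀ i, P (i + 1) ↔ P i ∧ MergeAt t c x y z i := fun i => by
    rw [hP, hP, Nat.forall_lt_succ_right]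
  obtain ⟨Z, hZ⟩ : ∃ Z : ℕ → Prop, ∀ i, Z i ↔ ∃ j < i, 2 ≤ digit (t + 2) y j ∧
      digit (t + 2) y j ≠ c := ⟨_, fun _ => Iff.rfl⟩
  have hZs : ∀ i, Z (i + 1) ↔ Z i ∨ (2 ≤ digit (t + 2) y i ∧ digit (t + 2) y i ≠ c) := fun i => by
    rw [hZ, hZ, Nat.exists_lt_succ_right]
  have hP0 : P 0 := by simp [hP]
  have hZ0 : ¬ Z 0 := by simp [hZ]
  refine AProg.WP_loop 10 (fun i s' => s'.reg 10 ≤ 1 ∧ (s'.reg 10 ≠ 0 ↔ P i) ∧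
    s'.reg 22 ≤ 1 ∧ (s'.reg 22 ≠ 0 ↔ Z i) ∧ s'.reg 19 = x / (t + 2) ^ i ∧
    s'.reg 20 = y / (t + 2) ^ i ∧ s'.reg 21 = z / (t + 2) ^ i)
    rfl rfl (by norm_num) (by simp [hP0, hZ0, hx, hy, hz]) ?_ ?_
  · rintro i s' hi h6 h7 hf ⟨h8, h9, h10, h11, h12, h13, h14⟩
    have e2 : s'.reg 2 = t + 2 := by simpa [hp.b_eq] using hf.reg 2 (by simp) rfl
    have e17 : s'.reg 17 = c := by simpa [hc] using hf.reg 17 (by simp) rfl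
    have hdx := digit_lt (show 0 < t + 2 by omega) x i
    have hdy := digit_lt (show 0 < t + 2 by omega) y i
    have hdz := digit_lt (show 0 < t + 2 by omega) z i
    have hqx : x / (t + 2) ^ (i + 1) ≤ x := Nat.div_le_self _ _
    have hqy : y / (t + 2) ^ (i + 1) ≤ y := Nat.div_le_self _ _
    have hqz : z / (t + 2) ^ (i + 1) ≤ z := Nat.div_le_self _ _
    have hPi := hPs i
    have hZi := hZs i
    -- `Seen` includes the digit `i` itself, the register only those before it. This makes no
    -- difference in the cases of `Merge` that depend on `Seen`.
    have hSeen : ¬ (2 ≤ digit (t + 2) y i ∧ digit (t + 2) y i ≠ c) →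
        (Seen (t + 2) c y i ↔ Z i) := by
      intro hn
      rw [hZ, Seen]
      constructor
      · rintro ⟨j, hj, h⟩
        rcases hj.eq_or_lt with rfl | hj
        · exact absurd h hn
        · exact ⟨j, hj, h⟩
      · rintro ⟨j, hj, h⟩
        exact ⟨j, hj.le, h⟩
    have hcol : 2 ≤ digit (t + 2) y i → digit (t + 2) y i ≠ c → (MergeAt t c x y z i ↔
        digit (t + 2) x i = digit (t + 2) y i ∧ digit (t + 2) z i = digit (t + 2) y i) := by
      intro ha hb
      simp [MergeAt, ha, hb]
    have hused : ¬ (2 ≤ digit (t + 2) y i ∧ digit (t + 2) y i ≠ c) → digit (t + 2) y i ≠ 0 → Z i →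
        (MergeAt t c x y z i ↔ digit (t + 2) x i = 0 ∧ digit (t + 2) z i = 1) := by
      intro ha hb hc
      unfold MergeAt
      rw [hSeen ha]
      simp [ha, hb, hc]
    have hfree : ¬ (2 ≤ digit (t + 2) y i ∧ digit (t + 2) y i ≠ c) →
        (digit (t + 2) y i = 0 ∨ ¬ Z i) →
        (MergeAt t c x y z i ↔ digit (t + 2) z i = digit (t + 2) x i) := by
      intro ha hb
      unfold MergeAt
      rw [hSeen ha]
      rcases hb with hb | hb <;> simp [ha, hb]
    simp only [AProg.WP_seq, AProg.WP_assign, AProg.WP_ite]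
    simp [e2, e17, h12, h13, h14, digit_succ, div_pow_mod]
    refine ⟨by omega, by omega, by omega, by omega, by omega, by omega, ?_⟩
    exact checkMerge_step (by omega) h8 h9 h10 h11 hPi hZi hcol hused hfree
  · rintro k s' hk h6 hf ⟨h7, h8, -⟩
    simp [hp.t_eq] at hk
    simp only [AState.reg_setReg, hp.t_eq] at h8
    norm_num at h8
    rw [← ne_eq, hP] at h8
    exact ⟨by omega, h7, h8⟩

end ArrayMachine

/-! ### Merging the table of a child into that of its parent -/

namespace ArrayMachine

open WordRAM (Op)

variable {E : Env} {n t : ℕ}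

/-- For the number in register `18`, coding states `x`, `y`, `z`, stores the code of `x` and `y` as
an origin of the state `z` of the parent in register `16` of the vertex in register `8`. -/
def tryMerge : AProg :=
  .assign 19 (.reg 18 %ᵃ .reg 3) ;; .assign 20 (.reg 18 /ᵃ .reg 3 %ᵃ .reg 3) ;;
  .assign 21 (.reg 18 /ᵃ .reg 3 /ᵃ .reg 3) ;; .assign 27 (.reg 21) ;;
  .ite (.arr 9 (.reg 16 *ᵃ .reg 3 +ᵃ .reg 19))
    (.ite (.arr 9 (.reg 8 *ᵃ .reg 3 +ᵃ .reg 20))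
      (checkMerge ;;
        .ite (.reg 10)
          (.store 10 (.reg 8 *ᵃ .reg 3 +ᵃ .reg 27) (.reg 18 %ᵃ (.reg 3 *ᵃ .reg 3) +ᵃ .lit 1))
          .skip)
      .skip)
    .skip

theorem mod_mul_div (e q : ℕ) : e % (q * q) / q = e / q % q ∧ e % (q * q) % q = e % q := by
  refine ⟨Nat.mod_mul_right_div_self e q q, Nat.mod_mul_right_mod e q q⟩

/-- With `q = (t + 2) ^ t`, the base `q` digits of `e < q ^ 3` are `x`, `y`, `z`. The origin kept
for `z` is `y * q + x + 1`, where the successor reserves zero for no origin. Register `27` saves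
`z`, because `checkMerge` uses up its arguments. -/
theorem tryMerge_spec (hE : E.Large n t) {s : AState} (hp : Parameters n t s) {v p c e : ℕ}
    (hv : s.reg 8 = v) (hps : s.reg 16 = p) (hc : s.reg 17 = c) (he : s.reg 18 = e)
    (hvn : v < n) (hpn : p < n) (heq : e < ((t + 2) ^ t) ^ 3) :
    AProg.WP E tryMerge s fun k s' => k ≤ 14 * (t + 1) + 9 ∧
      (∀ i, i ≠ v * (t + 2) ^ t + e / (t + 2) ^ t / (t + 2) ^ t → s'.arr 10 i = s.arr 10 i) ∧
      let B := s'.arr 10 (v * (t + 2) ^ t + e / (t + 2) ^ t / (t + 2) ^ t)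
      ((s.arr 9 (p * (t + 2) ^ t + e % (t + 2) ^ t) ≠ 0 ∧
        s.arr 9 (v * (t + 2) ^ t + e / (t + 2) ^ t % (t + 2) ^ t) ≠ 0 ∧
        Merge t c (e % (t + 2) ^ t) (e / (t + 2) ^ t % (t + 2) ^ t) (e / (t + 2) ^ t / (t + 2) ^ t) ∧
        B = e % ((t + 2) ^ t * (t + 2) ^ t) + 1) ∨
      (¬ (s.arr 9 (p * (t + 2) ^ t + e % (t + 2) ^ t) ≠ 0 ∧
        s.arr 9 (v * (t + 2) ^ t + e / (t + 2) ^ t % (t + 2) ^ t) ≠ 0 ∧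
        Merge t c (e % (t + 2) ^ t) (e / (t + 2) ^ t % (t + 2) ^ t) (e / (t + 2) ^ t / (t + 2) ^ t)) ∧
        B = s.arr 10 (v * (t + 2) ^ t + e / (t + 2) ^ t / (t + 2) ^ t))) := by
  obtain ⟨h1, h2, h3, h4, h5⟩ := hE.le_B
  have hB := hE.B_q
  have hq0 : 0 < (t + 2) ^ t := by positivity
  have hMq := hE.M_q
  have e2 := hp.b_eq
  have e3 := hp.q_eq
  generalize hq : (t + 2) ^ t = q at *
  have hx : e % q < q := Nat.mod_lt _ hq0
  have hy : e / q % q < q := Nat.mod_lt _ hq0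
  have hz : e / q / q < q := by
    rw [Nat.div_div_eq_div_mul]
    exact Nat.div_lt_of_lt_mul (by rw [← pow_two]; rwa [show q ^ 2 * q = q ^ 3 by ring])
  have hix := index_lt hpn hx
  have hiy := index_lt hvn hy
  have hiz := index_lt hvn hz
  have hMx : p * q + e % q < E.M 9 := by rw [hE.M_succ 8]; omega
  have hMy : v * q + e / q % q < E.M 9 := by rw [hE.M_succ 8]; omega
  have hMz : v * q + e / q / q < E.M 10 := by rw [hE.M_succ 9]; omega
  have hem : e % (q * q) < q * q := Nat.mod_lt _ (by positivity)
  rw [pow_two] at h5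
  simp only [tryMerge, AProg.WP_seq, AProg.WP_assign, AProg.WP_ite]
  simp [e3, he, hv, hps, hMx, hMy]
  refine ⟨by omega, by omega, by omega, fun h9x => ⟨fun h9y => ?_,
    fun h9y _ h9y' => absurd h9y h9y'⟩, fun h9x h9x' => absurd h9x h9x'⟩
  · refine (checkMerge_spec hE (c := c) (x := e % q) (y := e / q % q) (z := e / q / q)
      ((((hp.setReg (by norm_num)).setReg (by norm_num)).setReg (by norm_num)).setReg
        (by norm_num)) (by simp [hc]) (by simp)
      (by simp) (by simp) (by rwa [hq]) (by rwa [hq]) (by rwa [hq])).frame fun k s' hf h => ?_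
    obtain ⟨hk, -, hiff⟩ := h
    have f3 : s'.reg 3 = q := by simpa [e3] using hf.reg 3 (by simp) rfl
    have f8 : s'.reg 8 = v := by simpa [hv] using hf.reg 8 (by simp) rfl
    have f18 : s'.reg 18 = e := by simpa [he] using hf.reg 18 (by simp) rfl
    have f27 : s'.reg 27 = e / q / q := by simpa using hf.reg 27 (by simp) rfl
    have f10 : s'.arr 10 = s.arr 10 := by simpa using hf.arr 10 rfl
    simp [f3, f8, f18, f27, hMz]
    refine ⟨fun h => ⟨by omega, by omega, fun i hi => ?_, ?_⟩, fun h => ⟨by omega, ?_, ?_⟩⟩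
    · rw [Function.update_of_ne hi, f10]
    · exact .inl ⟨h9x, h9y, hiff.1 h⟩
    · intro i _
      rw [f10]
    · exact .inr ⟨fun _ _ h' => hiff.2 h' h, by rw [f10]⟩

/-- Merges the table of the vertex in register `8` into the table of its parent. -/
def mergeTable : AProg :=
  .assign 16 (.arr 6 (.reg 8)) ;; .assign 17 (.arr 7 (.reg 8)) ;;
  .assign 26 (.reg 3 *ᵃ .reg 3 *ᵃ .reg 3) ;;
  .loop 18 26 tryMerge ;;
  .loop 18 3 (.store 9 (.reg 16 *ᵃ .reg 3 +ᵃ .reg 18) (.lit 0 <ᵃ .arr 10 (.reg 8 *ᵃ .reg 3 +ᵃ .reg 18)))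

/-- The entry `w` for the state `z` of the table of origins: zero if there is no origin, and else
the successor of the code of one. -/
def IsOrigin (t c : ℕ) (T T' : ℕ → Prop) (z w : ℕ) : Prop :=
  (w = 0 ∧ ¬ ∃ x < (t + 2) ^ t, ∃ y < (t + 2) ^ t, T x ∧ T' y ∧ Merge t c x y z) ∨
  ∃ x < (t + 2) ^ t, ∃ y < (t + 2) ^ t, T x ∧ T' y ∧ Merge t c x y z ∧
    w = y * (t + 2) ^ t + x + 1

/-- The first loop reads the tables in array `9` and writes only origins into array `10`, so every
triple is tested against the tables before the merge. Only the second loop replaces the row of the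
parent. -/
theorem mergeTable_spec (hE : E.Large n t) {s : AState} (hp : Parameters n t s) {v p c : ℕ}
    (hv : s.reg 8 = v) (hps : s.arr 6 v = p) (hc : s.arr 7 v = c) (hcB : c < t + 2)
    (hvn : v < n) (hpv : p < v)
    (h0 : ∀ z < (t + 2) ^ t, s.arr 10 (v * (t + 2) ^ t + z) = 0) :
    AProg.WP E mergeTable s fun k s' =>
      k ≤ ((t + 2) ^ t) ^ 3 * (14 * (t + 1) + 11) + 2 + (t + 2) ^ t * 3 + 5 ∧
      (∀ v' < n, v' ≠ v → ∀ z < (t + 2) ^ t,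
        s'.arr 10 (v' * (t + 2) ^ t + z) = s.arr 10 (v' * (t + 2) ^ t + z)) ∧
      (∀ v' < n, v' ≠ p → ∀ z < (t + 2) ^ t,
        s'.arr 9 (v' * (t + 2) ^ t + z) = s.arr 9 (v' * (t + 2) ^ t + z)) ∧
      (∀ z < (t + 2) ^ t, (s'.arr 9 (p * (t + 2) ^ t + z) ≠ 0 ↔
        s'.arr 10 (v * (t + 2) ^ t + z) ≠ 0)) ∧
      ∀ z < (t + 2) ^ t, IsOrigin t c (fun x => s.arr 9 (p * (t + 2) ^ t + x) ≠ 0)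
        (fun y => s.arr 9 (v * (t + 2) ^ t + y) ≠ 0) z (s'.arr 10 (v * (t + 2) ^ t + z)) := by
  obtain ⟨h1, h2, h3, h4, h5⟩ := hE.le_B
  have hB := hE.B_q
  have hq0 : 0 < (t + 2) ^ t := by positivity
  have hMq := hE.M_q
  have hMb := hE.M_b
  have e2 := hp.b_eq
  have e3 := hp.q_eq
  have hvM : v < E.M 6 := by rw [hE.M_succ 5]; nlinarith
  have hvM' : v < E.M 7 := by rw [hE.M_succ 6]; nlinarith
  simp only [mergeTable, AProg.WP_seq, AProg.WP_assign]
  simp [hv, hvM, hvM', hps, hc, e3]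
  refine ⟨by omega, by omega, ?_, ?_⟩
  · rw [show (t + 2) ^ t * (t + 2) ^ t * (t + 2) ^ t = ((t + 2) ^ t) ^ 3 by ring]
    omega
  rw [show (t + 2) ^ t * (t + 2) ^ t * (t + 2) ^ t = ((t + 2) ^ t) ^ 3 by ring]
  have hp₁ : Parameters n t (((s.setReg 16 p).setReg 17 c).setReg 26 (((t + 2) ^ t) ^ 3)) :=
    ((hp.setReg (by norm_num)).setReg (by norm_num)).setReg (by norm_num)
  generalize hs₁ : (((s.setReg 16 p).setReg 17 c).setReg 26 (((t + 2) ^ t) ^ 3)) = s₁ at *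
  have g8 : s₁.reg 8 = v := by simp [← hs₁, hv]
  have g16 : s₁.reg 16 = p := by simp [← hs₁]
  have g17 : s₁.reg 17 = c := by simp [← hs₁]
  have g26 : s₁.reg 26 = ((t + 2) ^ t) ^ 3 := by simp [← hs₁]
  have garr : s₁.arr = s.arr := by simp [← hs₁]
  clear hs₁
  set q := (t + 2) ^ t with hq
  let Good : ℕ → Prop := fun e => s.arr 9 (p * q + e % q) ≠ 0 ∧ s.arr 9 (v * q + e / q % q) ≠ 0 ∧
    Merge t c (e % q) (e / q % q) (e / q / q)
  refine AProg.WP_loop (14 * (t + 1) + 9) (fun i s' =>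
    (∀ v' < n, v' ≠ v → ∀ z < q, s'.arr 10 (v' * q + z) = s.arr 10 (v' * q + z)) ∧
    ∀ z < q, (s'.arr 10 (v * q + z) = 0 ∧ ¬ ∃ e < i, Good e ∧ e / q / q = z) ∨
      ∃ e < i, Good e ∧ e / q / q = z ∧ s'.arr 10 (v * q + z) = e % (q * q) + 1)
    rfl rfl (by norm_num) ?_ ?_ ?_
  · simp [garr]
    exact h0
  · rintro i s' hi h6 h7 hf ⟨h8, h9⟩
    rw [g26] at hi
    have hp' : Parameters n t s' := hp₁.of_frame hf (by decide)
    have hz : i / q / q < q := by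
      rw [Nat.div_div_eq_div_mul]
      exact Nat.div_lt_of_lt_mul (by rw [← pow_two]; rwa [show q ^ 2 * q = q ^ 3 by ring])
    refine (tryMerge_spec hE hp' (v := v) (p := p) (c := c) (e := i)
      (by rw [hf.reg 8 (by simp) rfl, g8]) (by rw [hf.reg 16 (by simp) rfl, g16])
      (by rw [hf.reg 17 (by simp) rfl, g17]) h6 hvn (by omega) hi).mono fun k s'' h => ?_
    obtain ⟨hk, h10, h11⟩ := h
    have earr : s'.arr 9 = s.arr 9 := by rw [hf.arr 9 rfl, garr]
    rw [earr] at h11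
    refine ⟨hk, fun v' hv' hne z hzq => ?_, fun z hzq => ?_⟩
    · rw [AState.arr_setReg, h10 _ (fun h => hne (index_inj hzq hz h).1), h8 v' hv' hne z hzq]
    · rw [AState.arr_setReg]
      by_cases hzi : z = i / q / q
      · subst hzi
        rcases h11 with ⟨a1, a2, a3, a4⟩ | ⟨a1, a2⟩
        · exact .inr ⟨i, by omega, ⟨a1, a2, a3⟩, rfl, a4⟩
        · rw [← hq] at a2
          rw [a2]
          refine (h9 _ hzq).imp (fun h => ⟨h.1, ?_⟩) ?_
          · rintro ⟨e, he, hg, hez⟩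
            rcases Nat.lt_succ_iff_lt_or_eq.1 he with h' | rfl
            · exact h.2 ⟨e, h', hg, hez⟩
            · exact a1 hg
          · rintro ⟨e, he, h⟩
            exact ⟨e, by omega, h⟩
      · rw [h10 _ (fun h => hzi (index_inj hzq hz h).2)]
        refine (h9 _ hzq).imp (fun h => ⟨h.1, ?_⟩) ?_
        · rintro ⟨e, he, hg, hez⟩
          rcases Nat.lt_succ_iff_lt_or_eq.1 he with h' | rfl
          · exact h.2 ⟨e, h', hg, hez⟩
          · exact hzi hez.symm
        · rintro ⟨e, he, h⟩
          exact ⟨e, by omega, h⟩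
  · rintro k₁ s₂ hk₁ h6 hf ⟨h8, h9⟩
    rw [g26] at hk₁ h9
    have e3₂ : s₂.reg 3 = q := by rw [hf.reg 3 (by simp) rfl, hp₁.q_eq]
    have e8₂ : s₂.reg 8 = v := by rw [hf.reg 8 (by simp) rfl, g8]
    have e16₂ : s₂.reg 16 = p := by rw [hf.reg 16 (by simp) rfl, g16]
    have earr₂ : s₂.arr 9 = s.arr 9 := by rw [hf.arr 9 rfl, garr]
    refine AProg.WP_loop 1 (fun i s' =>
      (∀ v' < n, v' ≠ p → ∀ z < q, s'.arr 9 (v' * q + z) = s.arr 9 (v' * q + z)) ∧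
      ∀ z < i, (s'.arr 9 (p * q + z) ≠ 0 ↔ s₂.arr 10 (v * q + z) ≠ 0))
      rfl rfl (by norm_num) ?_ ?_ ?_
    · simp [earr₂]
    · rintro i s' hi h6' h7 hf' ⟨h10, h11⟩
      rw [e3₂] at hi
      have b3 : s'.reg 3 = q := by rw [hf'.reg 3 (by simp) rfl, e3₂]
      have b8 : s'.reg 8 = v := by rw [hf'.reg 8 (by simp) rfl, e8₂]
      have b16 : s'.reg 16 = p := by rw [hf'.reg 16 (by simp) rfl, e16₂]
      have barr : s'.arr 10 = s₂.arr 10 := hf'.arr 10 rfl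
      have hM1 : p * q + i < E.M 9 := by
        rw [hE.M_succ 8]
        exact (index_lt (show p < n by omega) hi).trans_le hMq
      have hM2 : v * q + i < E.M 10 := by
        rw [hE.M_succ 9]
        exact (index_lt hvn hi).trans_le hMq
      simp only [AProg.WP_store]
      simp only [AExpr.Safe, AExpr.eval, Op.eval, b3, b8, b16, h6', barr]
      refine ⟨⟨by simp, by simp [hM2], hM1, by split_ifs <;> omega⟩, le_rfl, ?_, ?_⟩
      · intro v' hv' hne z hz
        simp only [AState.arr_setReg, AState.arr_setArr, if_true]
        rw [Function.update_of_ne (fun h => hne (index_inj hz hi h).1)]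
        exact h10 v' hv' hne z hz
      · intro z hz
        simp only [AState.arr_setReg, AState.arr_setArr, if_true, Function.update_apply]
        by_cases hzi : z = i
        · subst hzi
          simp [Nat.pos_iff_ne_zero]
        · rw [if_neg (by omega)]
          exact h11 z (by omega)
    · rintro k₂ s₃ hk₂ h6' hf' ⟨h10, h11⟩
      rw [e3₂] at hk₂ h11
      have barr : s₃.arr 10 = s₂.arr 10 := hf'.arr 10 rfl
      rw [barr]
      have hk : q ^ 3 * (14 * (t + 1) + 9 + 2) = q ^ 3 * (14 * (t + 1) + 11) := rfl
      refine ⟨by omega, h8, h10, by simpa using h11, fun z hz => ?_⟩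
      refine (h9 z hz).imp (fun h => ⟨h.1, ?_⟩) ?_
      · rintro ⟨x, hx, y, hy, hTx, hTy, hM⟩
        -- The loop has met every triple, since `(x, y, z)` has the code `z * q ^ 2 + y * q + x`.
        have hlt : z * q * q + (y * q + x) < q ^ 3 := by
          have a1 := index_lt hy hx
          have a2 := index_lt hz a1
          calc z * q * q + (y * q + x) = z * (q * q) + (y * q + x) := by ring
            _ < q * (q * q) := a2
            _ = q ^ 3 := by ring
        have d1 : z * q * q + (y * q + x) = (z * q + y) * q + x := by ring
        have d2 : (z * q * q + (y * q + x)) / q = z * q + y := by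
          rw [d1, mul_comm, Nat.mul_add_div hq0, Nat.div_eq_of_lt hx, add_zero]
        have d3 : (z * q + y) / q = z := by
          rw [mul_comm, Nat.mul_add_div hq0, Nat.div_eq_of_lt hy, add_zero]
        have d4 : (z * q * q + (y * q + x)) % q = x := by
          rw [d1, mul_comm, Nat.mul_add_mod, Nat.mod_eq_of_lt hx]
        have d5 : (z * q + y) % q = y := by
          rw [mul_comm, Nat.mul_add_mod, Nat.mod_eq_of_lt hy]
        exact h.2 ⟨z * q * q + (y * q + x), hlt, ⟨by rwa [d4], by rwa [d2, d5],
          by rwa [d2, d4, d5, d3]⟩, by rw [d2, d3]⟩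
      · rintro ⟨e, he, ⟨a1, a2, a3⟩, rfl, a4⟩
        refine ⟨e % q, Nat.mod_lt _ hq0, e / q % q, Nat.mod_lt _ hq0, a1, a2, a3, ?_⟩
        obtain ⟨b1, b2⟩ := mod_mul_div e q
        rw [a4, ← b1, ← b2, ← hq, Nat.div_add_mod']

end ArrayMachine

/-! ### All merges, the root state and the way back -/

namespace ArrayMachine

open WordRAM (Op)

variable {E : Env} {n t : ℕ}

theorem IsOrigin.congr {c : ℕ} {T₁ T₁' T₂ T₂' : ℕ → Prop} {z w : ℕ} (h : IsOrigin t c T₁ T₁' z w)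
    (hT : ∀ x < (t + 2) ^ t, (T₁ x ↔ T₂ x)) (hT' : ∀ x < (t + 2) ^ t, (T₁' x ↔ T₂' x)) :
    IsOrigin t c T₂ T₂' z w := by
  refine h.imp (fun h => ⟨h.1, ?_⟩) ?_
  · rintro ⟨x, hx, y, hy, h1, h2, h3⟩
    exact h.2 ⟨x, hx, y, hy, (hT x hx).2 h1, (hT' y hy).2 h2, h3⟩
  · rintro ⟨x, hx, y, hy, h1, h2, h3⟩
    exact ⟨x, hx, y, hy, (hT x hx).1 h1, (hT' y hy).1 h2, h3⟩

theorem IsOrigin.ne_zero_iff {c : ℕ} {T T' : ℕ → Prop} {z w : ℕ} (h : IsOrigin t c T T' z w) :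
    w ≠ 0 ↔ ∃ x < (t + 2) ^ t, ∃ y < (t + 2) ^ t, T x ∧ T' y ∧ Merge t c x y z := by
  rcases h with ⟨h1, h2⟩ | ⟨x, hx, y, hy, h1, h2, h3, rfl⟩
  · simp only [h1, ne_eq, not_true, false_iff]
    exact h2
  · exact ⟨fun _ => ⟨x, hx, y, hy, h1, h2, h3⟩, fun _ => by omega⟩

/-- Merges the tables of all vertices into those of their parents. -/
def mergeAll : AProg :=
  .assign 29 (.reg 1 -ᵃ .lit 1) ;;
  .loop 28 29 (.assign 8 (.reg 29 -ᵃ .reg 28) ;; mergeTable)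

/-- Children have larger numbers than parents, so merging in decreasing order completes the table of
`k` before `k` is merged. Its origins refer to the tables after `n - 1 - k` merges, those of the
larger vertices. -/
theorem mergeAll_spec (hE : E.Large n t) {s : AState} (hp : Parameters n t s) (hn : 0 < n)
    {par col : ℕ → ℕ} {cs : ℕ → ℕ → ℕ} (hb : Bags n t par col cs s)
    (hpar : ∀ v, 0 < v → v < n → par v < v) (hcol : ∀ v < n, col v < t + 2)
    (h9 : ∀ v < n, ∀ x < (t + 2) ^ t,
      (s.arr 9 (v * (t + 2) ^ t + x) ≠ 0 ↔ IsInitState t (cs v) x))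
    (h10 : ∀ i, s.arr 10 i = 0) :
    AProg.WP E mergeAll s fun k s' =>
      k ≤ n * (((t + 2) ^ t) ^ 3 * (14 * (t + 1) + 11) + (t + 2) ^ t * 3 + 10) + 3 ∧
      (∀ v < n, ∀ x < (t + 2) ^ t,
        (s'.arr 9 (v * (t + 2) ^ t + x) ≠ 0 ↔ Reach n t par col cs (n - 1) v x)) ∧
      ∀ k, 0 < k → k < n → ∀ z < (t + 2) ^ t, IsOrigin t (col k)
        (Reach n t par col cs (n - 1 - k) (par k)) (Reach n t par col cs (n - 1 - k) k) z
        (s'.arr 10 (k * (t + 2) ^ t + z)) := by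
  obtain ⟨h1, h2, h3, h4, h5⟩ := hE.le_B
  have hq0 : 0 < (t + 2) ^ t := by positivity
  simp only [mergeAll, AProg.WP_seq, AProg.WP_assign]
  refine ⟨⟨by simp, by simp [hp.n_eq]; omega⟩, ?_⟩
  refine AProg.WP_loop (((t + 2) ^ t) ^ 3 * (14 * (t + 1) + 11) + (t + 2) ^ t * 3 + 8) (fun i s' =>
    (∀ v < n, ∀ x < (t + 2) ^ t,
      (s'.arr 9 (v * (t + 2) ^ t + x) ≠ 0 ↔ Reach n t par col cs i v x)) ∧
    (∀ k, n - i ≤ k → k < n → ∀ z < (t + 2) ^ t, IsOrigin t (col k)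
      (Reach n t par col cs (n - 1 - k) (par k)) (Reach n t par col cs (n - 1 - k) k) z
      (s'.arr 10 (k * (t + 2) ^ t + z))) ∧
    ∀ k < n - i, ∀ z < (t + 2) ^ t, s'.arr 10 (k * (t + 2) ^ t + z) = 0)
    rfl rfl (by norm_num) ?_ ?_ ?_
  · refine ⟨fun v hv x hx => ?_, fun k hk hk' => by omega, fun k _ z _ => h10 _⟩
    simpa [Reach] using h9 v hv x hx
  · rintro i s' hi h6 h7 hf ⟨h11, h12, h13⟩
    simp [hp.n_eq] at hi h7
    have hp' : Parameters n t s' := (hp.setReg (by norm_num)).of_frame hf (by decide)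
    have hb' : Bags n t par col cs s' :=
      Bags.of_frame (s := s.setReg 29 _) ⟨hb.1, hb.2, hb.3⟩ hf rfl rfl rfl
    rw [AProg.WP_seq, AProg.WP_assign]
    simp only [AExpr.eval, AExpr.Safe, Op.eval, h6, h7]
    refine ⟨⟨by simp, by omega⟩, ?_⟩
    obtain ⟨v, hv⟩ : ∃ v, v = n - 1 - i := ⟨_, rfl⟩
    rw [← hv]
    have hvn : v < n := by omega
    have hv0 : 0 < v := by omega
    have hpv := hpar v hv0 hvn
    refine (mergeTable_spec hE (s := s'.setReg 8 v) (hp'.setReg (by norm_num)) (v := v)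
      (p := par v) (c := col v) (by simp) (by simpa using hb'.par_eq v hvn)
      (by simpa using hb'.col_eq v hvn) (hcol v hvn) hvn hpv
      (fun z hz => by simpa using h13 v (by omega) z hz)).mono fun k s'' h => ?_
    simp only [AState.arr_setReg] at h ⊢
    obtain ⟨hk, a1, a2, a3, a4⟩ := h
    have hni : n - 1 - v = i := by omega
    have hor : ∀ z < (t + 2) ^ t, IsOrigin t (col v) (Reach n t par col cs i (par v))
        (Reach n t par col cs i v) z (s''.arr 10 (v * (t + 2) ^ t + z)) := fun z hz =>
      (a4 z hz).congr (fun x hx => h11 _ (by omega) x hx) (fun y hy => h11 v hvn y hy)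
    refine ⟨by omega, fun v' hv' x hx => ?_, fun k hk1 hk2 z hz => ?_, fun k hk1 z hz => ?_⟩
    · simp only [Reach]
      rw [← hv]
      by_cases hvp : v' = par v
      · rw [if_pos hvp, hvp, a3 x hx, (hor x hx).ne_zero_iff]
      · rw [if_neg hvp, a2 v' hv' hvp x hx]
        exact h11 v' hv' x hx
    · by_cases hkv : k = v
      · subst hkv
        rw [hni]
        exact hor z hz
      · rw [a1 k hk2 hkv z hz]
        exact h12 k (by omega) hk2 z hz
    · rw [a1 k (by omega) (by omega) z hz]
      exact h13 k (by omega) z hz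
  · rintro k s' hk h6 hf ⟨h11, h12, -⟩
    simp [hp.n_eq] at hk h11 h12
    refine ⟨?_, h11, fun k hk0 hkn => h12 k (by omega) hkn⟩
    have : (n - 1) * (((t + 2) ^ t) ^ 3 * (14 * (t + 1) + 11) + (t + 2) ^ t * 3 + 8 + 2) ≤
      n * (((t + 2) ^ t) ^ 3 * (14 * (t + 1) + 11) + (t + 2) ^ t * 3 + 10) :=
      Nat.mul_le_mul (by omega) le_rfl
    omega

/-- Register `30` becomes the successor of a state in the table of the root, or zero if there is
none. -/
def findRoot : AProg :=
  .assign 30 (.lit 0) ;;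
  .loop 18 3 (.ite (.arr 9 (.reg 18)) (.assign 30 (.reg 18 +ᵃ .lit 1)) .skip)

theorem findRoot_spec (hE : E.Large n t) {s : AState} (hp : Parameters n t s) (hn : 0 < n) :
    AProg.WP E findRoot s fun k s' => k ≤ (t + 2) ^ t * 4 + 3 ∧
      ((s'.reg 30 = 0 ∧ ∀ x < (t + 2) ^ t, s.arr 9 x = 0) ∨
        ∃ x < (t + 2) ^ t, s'.reg 30 = x + 1 ∧ s.arr 9 x ≠ 0) := by
  obtain ⟨h1, h2, h3, h4, h5⟩ := hE.le_B
  have hMq := hE.M_q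
  simp only [findRoot, AProg.WP_seq, AProg.WP_assign]
  refine ⟨⟨by simp, by simp⟩, ?_⟩
  refine AProg.WP_loop 2 (fun i s' => (s'.reg 30 = 0 ∧ ∀ x < i, s.arr 9 x = 0) ∨
    ∃ x < i, s'.reg 30 = x + 1 ∧ s.arr 9 x ≠ 0) rfl rfl (by norm_num) (by simp) ?_ ?_
  · intro i s' hi h6 h7 hf h8
    simp [hp.q_eq] at hi
    have earr : s'.arr 9 = s.arr 9 := by simpa using hf.arr 9 rfl
    have hM : i < E.M 9 := by
      rw [hE.M_succ 8]
      exact hi.trans_le ((Nat.le_mul_of_pos_left _ hn).trans hMq)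
    have hM' : i + 1 ≤ E.B := by omega
    simp only [AProg.WP_ite, AProg.WP_assign, AProg.WP_skip]
    simp only [AExpr.eval, AExpr.Safe, Op.eval, h6, earr, AState.reg_setReg]
    norm_num
    refine ⟨hM, fun h => ⟨hM', i, le_rfl, rfl, h⟩, fun h => h8.imp ?_ ?_⟩
    · rintro ⟨a1, a2⟩
      refine ⟨a1, fun x hx => ?_⟩
      rcases Nat.lt_succ_iff_lt_or_eq.1 (Nat.lt_succ_iff.2 hx) with h' | rfl
      exacts [a2 x h', h]
    · rintro ⟨x, hx, h⟩
      exact ⟨x, by omega, h⟩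
  · intro k s' hk h6 hf h7
    simp [hp.q_eq] at hk h7
    refine ⟨by omega, ?_⟩
    simpa using h7

/-- Undoes the merges, starting with the state of the root in register `30`. -/
def traceBack : AProg :=
  .store 11 (.lit 0) (.reg 30 -ᵃ .lit 1) ;; .assign 29 (.reg 1 -ᵃ .lit 1) ;;
  .loop 28 29 (
    .assign 8 (.reg 28 +ᵃ .lit 1) ;; .assign 16 (.arr 6 (.reg 8)) ;;
    .assign 18 (.arr 10 (.reg 8 *ᵃ .reg 3 +ᵃ .arr 11 (.reg 16)) -ᵃ .lit 1) ;;
    .store 11 (.reg 8) (.reg 18 /ᵃ .reg 3) ;; .store 11 (.reg 16) (.reg 18 %ᵃ .reg 3))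

/-- Array `11` only keeps the current row `cur r`; the earlier rows exist in the invariant alone. A
round extends them by replacing the state of the parent by its origin and adding that of the child.
-/
theorem traceBack_spec (hE : E.Large n t) {s : AState} (hp : Parameters n t s) (hn : 0 < n)
    {par col : ℕ → ℕ} {cs : ℕ → ℕ → ℕ} (hb : Bags n t par col cs s)
    (hpar : ∀ v, 0 < v → v < n → par v < v)
    (h10 : ∀ k, 0 < k → k < n → ∀ z < (t + 2) ^ t, IsOrigin t (col k)
        (Reach n t par col cs (n - 1 - k) (par k)) (Reach n t par col cs (n - 1 - k) k) z
        (s.arr 10 (k * (t + 2) ^ t + z)))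
    {x : ℕ} (hx : x < (t + 2) ^ t) (h30 : s.reg 30 = x + 1)
    (hr : Reach n t par col cs (n - 1) 0 x) :
    AProg.WP E traceBack s fun k s' => k ≤ n * 7 + 4 ∧ ∃ cur, IsTrace n t par col cs cur ∧
      ∀ v < n, s'.arr 11 v = cur (n - 1) v ∧ cur (n - 1) v < (t + 2) ^ t := by
  obtain ⟨h1, h2, h3, h4, h5⟩ := hE.le_B
  have hq0 : 0 < (t + 2) ^ t := by positivity
  have hMq := hE.M_q
  have hM : ∀ k, ∀ v < n, v < E.M (k + 1) := fun k v hv => by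
    rw [hE.M_succ k]
    exact hv.trans_le ((Nat.le_mul_of_pos_right _ hq0).trans hMq)
  simp only [traceBack, AProg.WP_seq, AProg.WP_assign, AProg.WP_store]
  refine ⟨⟨by simp, by simp, by simpa using hM 10 0 hn, by simp [h30]; omega⟩,
    ⟨by simp, by simp [hp.n_eq]; omega⟩, ?_⟩
  refine AProg.WP_loop 5 (fun r s' => ∃ cur : ℕ → ℕ → ℕ,
    (∀ k < r, Merge t (col (k + 1)) (cur (k + 1) (par (k + 1))) (cur (k + 1) (k + 1))
      (cur k (par (k + 1)))) ∧
    (∀ k < r, ∀ v ≤ k, v ≠ par (k + 1) → cur (k + 1) v = cur k v) ∧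
    ∀ v ≤ r, s'.arr 11 v = cur r v ∧ cur r v < (t + 2) ^ t ∧
      Reach n t par col cs (n - 1 - r) v (cur r v))
    rfl rfl (by norm_num) ?_ ?_ ?_
  · refine ⟨fun _ _ => x, by simp, by simp, fun v hv => ?_⟩
    obtain rfl : v = 0 := by omega
    simp [h30, hx, hr]
  · rintro r s' hi h6 h7 hf ⟨cur, h11, h12, h13⟩
    simp [hp.n_eq] at hi h7
    have hv0 : 0 < r + 1 := by omega
    have hvn : r + 1 < n := by omega
    have hpv := hpar (r + 1) hv0 hvn
    have e3 : s'.reg 3 = (t + 2) ^ t := by simpa [hp.q_eq] using hf.reg 3 (by simp) rfl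
    have e6 : s'.arr 6 (r + 1) = par (r + 1) := by
      rw [hf.arr 6 rfl]
      simpa using hb.par_eq _ hvn
    have e10 : s'.arr 10 = s.arr 10 := by simpa using hf.arr 10 rfl
    obtain ⟨c1, c2, c3⟩ := h13 (par (r + 1)) (by omega)
    have hor := h10 (r + 1) hv0 hvn _ c2
    -- As `n - 1 - r` is the successor of `n - 1 - (r + 1)`, `Reach` unfolds to the merge of `r +
    -- 1`. So the entry of the table of origins is not zero.
    have hreach : ∃ x < (t + 2) ^ t, ∃ y < (t + 2) ^ t,
        Reach n t par col cs (n - 1 - (r + 1)) (par (r + 1)) x ∧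
        Reach n t par col cs (n - 1 - (r + 1)) (r + 1) y ∧
        Merge t (col (r + 1)) x y (cur r (par (r + 1))) := by
      rw [show n - 1 - r = n - 1 - (r + 1) + 1 by omega] at c3
      simp only [Reach, show n - 1 - (n - 1 - (r + 1)) = r + 1 by omega, if_true] at c3
      exact c3
    rcases hor with ⟨-, hor⟩ | ⟨x', hx', y', hy', a1, a2, a3, a4⟩
    · exact absurd hreach hor
    have hM6 := hM 5 _ hvn
    have hM11 := hM 10 _ hvn
    have hMp := hM 10 _ (hpv.trans hvn)
    have hM10 : (r + 1) * (t + 2) ^ t + cur r (par (r + 1)) < E.M 10 := by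
      rw [hE.M_succ 9]
      exact (index_lt hvn c2).trans_le hMq
    have hdiv : (y' * (t + 2) ^ t + x') / (t + 2) ^ t = y' := by
      rw [mul_comm, Nat.mul_add_div hq0, Nat.div_eq_of_lt hx', add_zero]
    have hmod : (y' * (t + 2) ^ t + x') % (t + 2) ^ t = x' := by
      rw [mul_comm, Nat.mul_add_mod, Nat.mod_eq_of_lt hx']
    have hlt : y' * (t + 2) ^ t + x' ≤ E.B := by
      have := index_lt hy' hx'
      rw [pow_two] at h5
      omega
    have hupd : ∀ i, Function.update (Function.update (s'.arr 11) (r + 1) y') (par (r + 1)) x' i =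
        if i = par (r + 1) then x' else if i = r + 1 then y' else s'.arr 11 i := by
      intro i
      simp only [Function.update_apply]
    simp only [AProg.WP_seq, AProg.WP_assign, AProg.WP_store]
    simp [h6, e6, e3, e10, c1, a4, hM6, hM11, hMp, hM10, hdiv, hmod]
    refine ⟨by omega, by omega, hlt, by omega, by omega,
      fun k v => if k ≤ r then cur k v else if v = par (r + 1) then x' else
        if v = r + 1 then y' else cur r v, ?_, ?_, ?_⟩
    · intro k hk
      by_cases hkr : k < r
      · simp only [show k + 1 ≤ r by omega, show k ≤ r by omega, if_true]
        exact h11 k hkr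
      · obtain rfl : k = r := by omega
        simp only [if_neg (show ¬ k + 1 ≤ k by omega), le_refl, if_true,
          if_neg (show ¬ k + 1 = par (k + 1) by omega)]
        exact a3
    · intro k hk v hv hne
      by_cases hkr : k < r
      · simp only [show k + 1 ≤ r by omega, show k ≤ r by omega, if_true]
        exact h12 k hkr v hv hne
      · obtain rfl : k = r := by omega
        simp only [if_neg (show ¬ k + 1 ≤ k by omega), le_refl, if_true, if_neg hne,
          if_neg (show ¬ v = k + 1 by omega)]
    · intro v hv
      simp only [if_neg (show ¬ r + 1 ≤ r by omega), hupd]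
      by_cases hvp : v = par (r + 1)
      · simp only [if_pos hvp]
        refine ⟨trivial, hx', ?_⟩
        rw [hvp]
        exact a1
      · simp only [if_neg hvp]
        by_cases hvr : v = r + 1
        · simp only [if_pos hvr]
          refine ⟨trivial, hy', ?_⟩
          rw [hvr]
          exact a2
        · simp only [if_neg hvr]
          obtain ⟨b1, b2, b3⟩ := h13 v (by omega)
          refine ⟨b1, b2, ?_⟩
          rw [show n - 1 - r = n - 1 - (r + 1) + 1 by omega] at b3
          simp only [Reach, show n - 1 - (n - 1 - (r + 1)) = r + 1 by omega, if_neg hvp] at b3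
          exact b3
  · rintro k s' hk h6 hf ⟨cur, h11, h12, h13⟩
    simp [hp.n_eq] at hk h11 h12 h13
    refine ⟨by omega, cur, ⟨fun k hk => h11 k (by omega), fun k hk => h12 k (by omega),
      fun v hv => (h13 v (by omega)).2.2⟩, fun v hv => ?_⟩
    obtain ⟨b1, b2, -⟩ := h13 v (by omega)
    exact ⟨b1, b2⟩

end ArrayMachine

/-! ### Writing the decomposition -/

namespace ArrayMachine

open WordRAM (Op)

variable {E : Env} {n t : ℕ}

/-- Computes the nodes on the path through the bag of the vertex in register `8`, and the image of
that vertex. -/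
def repRow : AProg :=
  .assign 16 (.arr 6 (.reg 8)) ;; .assign 17 (.arr 7 (.reg 8)) ;;
  .assign 19 (.arr 11 (.reg 8)) ;; .assign 22 (.lit 0) ;;
  .loop 15 0 (
    .assign 23 (.reg 19 %ᵃ .reg 2) ;; .assign 19 (.reg 19 /ᵃ .reg 2) ;;
    .assign 22 (.reg 22 +ᵃ (.lit 1 <ᵃ .reg 23) *ᵃ ((.reg 23 =ᵃ .reg 17) =ᵃ .lit 0)) ;;
    .ite (.reg 22)
      (.store 12 (.reg 8 *ᵃ .reg 0 +ᵃ .reg 15) (.arr 12 (.reg 16 *ᵃ .reg 0 +ᵃ .reg 15)))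
      (.store 12 (.reg 8 *ᵃ .reg 0 +ᵃ .reg 15) (.reg 8 *ᵃ .reg 0 +ᵃ .reg 15)) ;;
    .ite (.reg 23 =ᵃ .reg 17)
      (.store 0 (.lit 2 +ᵃ .reg 1 *ᵃ .reg 0 +ᵃ .arr 4 (.reg 8))
        (.arr 12 (.reg 8 *ᵃ .reg 0 +ᵃ .reg 15)))
      .skip)

/-- The row of the parent is read only at heights that are inherited. Then `v` is not the root, by
`hseen0`, so `p < v` and that row is finished. By `huniq` the image of `v` is written at most once.
-/
theorem repRow_spec (hE : E.Large n t) {s : AState} (hp : Parameters n t s)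
    {v p c x r : ℕ} (hv : s.reg 8 = v) (hvn : v < n) (hpar : s.arr 6 v = p)
    (hpn : p < n) (hpv : 0 < v → p < v) (hcol : s.arr 7 v = c) (hc2 : c < t + 2) (hx : s.arr 11 v = x)
    (hxq : x < (t + 2) ^ t) (hseen0 : v = 0 → ∀ j < t, ¬ Seen (t + 2) c x j)
    (huniq : ∀ i < t, ∀ j < t, digit (t + 2) x i = c → digit (t + 2) x j = c → i = j)
    (hr : s.arr 4 v = r) (hrn : r < n)
    (h12 : ∀ v' < v, ∀ j < t, s.arr 12 (v' * t + j) < n * t) :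
    AProg.WP E repRow s fun k s' => k ≤ t * 10 + 6 ∧
      (∀ v' < v, ∀ j < t, s'.arr 12 (v' * t + j) = s.arr 12 (v' * t + j)) ∧
      (∀ j < t, (Seen (t + 2) c x j → s'.arr 12 (v * t + j) = s.arr 12 (p * t + j)) ∧
        (¬ Seen (t + 2) c x j → s'.arr 12 (v * t + j) = v * t + j)) ∧
      (∀ i, i ≠ 2 + n * t + r → s'.arr 0 i = s.arr 0 i) ∧
      ∀ j < t, digit (t + 2) x j = c → s'.arr 0 (2 + n * t + r) = s'.arr 12 (v * t + j) := by
  obtain ⟨h1, h2, h3, h4, h5⟩ := hE.le_B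
  have hMb := hE.M_b
  have hM0 := hE.M_zero
  have hntM : n * t ≤ E.M 1 := by nlinarith
  have hM : ∀ k, ∀ v < n, v < E.M (k + 1) := fun k v hv => by
    rw [hE.M_succ k]
    nlinarith
  have hM6 : v < E.M 6 := hM 5 v hvn
  have hM7 : v < E.M 7 := hM 6 v hvn
  have hM11 : v < E.M 11 := hM 10 v hvn
  have hM4 : v < E.M 4 := hM 3 v hvn
  simp only [repRow, AProg.WP_seq, AProg.WP_assign]
  simp only [AExpr.eval, AExpr.Safe, AState.reg_setReg, AState.arr_setReg]
  norm_num
  simp only [hv, hpar, hcol, hx, hM6, hM7, hM11]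
  simp only [true_and]
  refine ⟨by omega, by omega, by omega, ?_⟩
  have hp₁ : Parameters n t ((((s.setReg 16 p).setReg 17 c).setReg 19 x).setReg 22 0) :=
    (((hp.setReg (by norm_num)).setReg (by norm_num)).setReg (by norm_num)).setReg (by norm_num)
  generalize hs₁ : ((((s.setReg 16 p).setReg 17 c).setReg 19 x).setReg 22 0) = s₁ at *
  have g8 : s₁.reg 8 = v := by simp [← hs₁, hv]
  have g16 : s₁.reg 16 = p := by simp [← hs₁]
  have g17 : s₁.reg 17 = c := by simp [← hs₁]
  have g19 : s₁.reg 19 = x := by simp [← hs₁]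
  have g22 : s₁.reg 22 = 0 := by simp [← hs₁]
  have garr : s₁.arr = s.arr := by simp [← hs₁]
  clear hs₁
  obtain ⟨Z, hZ⟩ : ∃ Z : ℕ → Prop, ∀ i, Z i ↔ ∃ j < i, 2 ≤ digit (t + 2) x j ∧
      digit (t + 2) x j ≠ c := ⟨_, fun _ => Iff.rfl⟩
  have hZs : ∀ i, Z (i + 1) ↔ Z i ∨ (2 ≤ digit (t + 2) x i ∧ digit (t + 2) x i ≠ c) := fun i => by
    rw [hZ, hZ, Nat.exists_lt_succ_right]
  have hZ0 : ¬ Z 0 := by simp [hZ]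
  have hZseen : ∀ i, Z (i + 1) ↔ Seen (t + 2) c x i := fun i => by
    simp only [hZ, Seen, Nat.lt_succ_iff]
  refine AProg.WP_loop 8 (fun i s' => s'.reg 22 ≤ i ∧ (s'.reg 22 ≠ 0 ↔ Z i) ∧ s'.reg 19 = x / (t + 2) ^ i ∧
      (∀ v' < v, ∀ j < t, s'.arr 12 (v' * t + j) = s.arr 12 (v' * t + j)) ∧
      (∀ j < i, (Seen (t + 2) c x j → s'.arr 12 (v * t + j) = s.arr 12 (p * t + j)) ∧
        (¬ Seen (t + 2) c x j → s'.arr 12 (v * t + j) = v * t + j)) ∧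
      (∀ i, i ≠ 2 + n * t + r → s'.arr 0 i = s.arr 0 i) ∧
      ∀ j < i, digit (t + 2) x j = c → s'.arr 0 (2 + n * t + r) = s'.arr 12 (v * t + j))
    rfl rfl (by norm_num) ?_ ?_ ?_
  · simp [hZ0, g19, g22, garr]
  · rintro i s' hi h6 h7 hf ⟨h22, h8, h9, h10, h11, h13, h14⟩
    rw [hp₁.t_eq] at hi
    have e0 : s'.reg 0 = t := by rw [h7, hp₁.t_eq]
    have e1 : s'.reg 1 = n := by rw [hf.reg 1 (by simp) rfl, hp₁.n_eq]
    have e2 : s'.reg 2 = t + 2 := by rw [hf.reg 2 (by simp) rfl, hp₁.b_eq]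
    have e8 : s'.reg 8 = v := by rw [hf.reg 8 (by simp) rfl, g8]
    have e16 : s'.reg 16 = p := by rw [hf.reg 16 (by simp) rfl, g16]
    have e17 : s'.reg 17 = c := by rw [hf.reg 17 (by simp) rfl, g17]
    have e4 : s'.arr 4 v = r := by rw [hf.arr 4 rfl, garr, hr]
    have hdx := digit_lt (show 0 < t + 2 by omega) x i
    have hqx : x / (t + 2) ^ (i + 1) ≤ x := Nat.div_le_self _ _
    have hidx := index_lt hvn hi
    have hidp := index_lt hpn hi
    have hMv : v * t + i < E.M 12 := by rw [hE.M_succ 11]; omega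
    have hMp : p * t + i < E.M 12 := by rw [hE.M_succ 11]; omega
    have hMo : 2 + n * t + r < E.M 0 := by omega
    have hZi := hZs i
    have hZi' := hZseen i
    have hne : ∀ v' < v, ∀ j < t, v' * t + j ≠ v * t + i := fun v' hv' j hj h =>
      hv'.ne (index_inj hj hi h).1
    have hne' : ∀ j < i, v * t + j ≠ v * t + i := fun j hj h => by omega
    have hstep : ∀ (w : ℕ), (Z (i + 1) → w = s.arr 12 (p * t + i)) →
        (¬ Z (i + 1) → w = v * t + i) →
        (∀ v' < v, ∀ j < t, Function.update (s'.arr 12) (v * t + i) w (v' * t + j) =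
          s.arr 12 (v' * t + j)) ∧
        (∀ j < i + 1, (Seen (t + 2) c x j → Function.update (s'.arr 12) (v * t + i) w (v * t + j) =
            s.arr 12 (p * t + j)) ∧
          (¬ Seen (t + 2) c x j → Function.update (s'.arr 12) (v * t + i) w (v * t + j) =
            v * t + j)) := by
      intro w hw1 hw2
      refine ⟨fun v' hv' j hj => ?_, fun j hj => ?_⟩
      · rw [Function.update_of_ne (hne v' hv' j hj)]
        exact h10 v' hv' j hj
      · rcases Nat.lt_succ_iff_lt_or_eq.1 hj with hj | rfl
        · rw [Function.update_of_ne (hne' j hj)]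
          exact h11 j hj
        · rw [Function.update_self, ← hZi']
          exact ⟨hw1, hw2⟩
    have hstep' : ∀ (w : ℕ), ∀ j < i + 1, digit (t + 2) x j = c →
        (if digit (t + 2) x i = c then w else s'.arr 0 (2 + n * t + r)) =
          Function.update (s'.arr 12) (v * t + i) w (v * t + j) := by
      intro w j hj hd
      rcases Nat.lt_succ_iff_lt_or_eq.1 hj with hj | rfl
      · rw [Function.update_of_ne (hne' j hj), if_neg]
        · exact h14 j hj hd
        · intro h
          have := huniq i hi j (by omega) h hd
          omega
      · rw [if_pos hd, Function.update_self]
    have hout : ∀ (w : ℕ), ∀ i, i ≠ 2 + n * t + r →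
        Function.update (s'.arr 0) (2 + n * t + r) w i = s.arr 0 i := fun w i hi => by
      rw [Function.update_of_ne hi]
      exact h13 i hi
    -- The new value of register `22`, which counts remaining colours up to the height `i`; only
    -- whether it vanishes matters.
    obtain ⟨f, hf0⟩ : ∃ f, f = s'.reg 22 + (if digit (t + 2) x i = c then 0 else
        if 1 < digit (t + 2) x i then 1 else 0) := ⟨_, rfl⟩
    have hfi : f ≤ i + 1 := by
      rw [hf0]
      split_ifs <;> omega
    have hfZ : f ≠ 0 ↔ Z (i + 1) := by
      rw [hZi, ← h8, hf0]
      split_ifs <;> first | contradiction | omega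
    have hpt : s'.arr 12 (p * t + i) = s.arr 12 (p * t + i) ∨ ¬ Z (i + 1) := by
      by_cases hz : Z (i + 1)
      · refine .inl (h10 p (hpv ?_) i hi)
        by_contra h0
        exact hseen0 (by omega) i hi (hZi'.1 hz)
      · exact .inr hz
    have hptB : ¬ Z (i + 1) ∨ s'.arr 12 (p * t + i) ≤ E.B := by
      rcases hpt with h | h
      · by_cases hz : Z (i + 1)
        · have hv0 : 0 < v := by
            by_contra h0
            exact hseen0 (by omega) i hi (hZi'.1 hz)
          have := h12 p (hpv hv0) i hi
          exact .inr (by omega)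
        · exact .inl hz
      · exact .inl h
    rw [AProg.WP_seq, AProg.WP_assign, AProg.WP_seq, AProg.WP_assign, AProg.WP_seq, AProg.WP_assign]
    refine ⟨⟨by simp, by simp [e2, h9, div_pow_mod]; omega⟩,
      ⟨by simp, by simp [e2, h9, digit_succ]; omega⟩,
      ⟨by simp, by simp [e2, e17, h9, div_pow_mod, ← hf0]; omega⟩, ?_⟩
    have hev : AExpr.eval E ((s'.setReg 23 (digit (t + 2) x i)).setReg 19 (x / (t + 2) ^ (i + 1)))
        (.reg 22 +ᵃ (.lit 1 <ᵃ .reg 23) *ᵃ ((.reg 23 =ᵃ .reg 17) =ᵃ .lit 0)) = f := by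
      simp [e17, ← hf0]
    have hev₁ : AExpr.eval E s' (.reg 19 %ᵃ .reg 2) = digit (t + 2) x i := by
      simp [e2, h9, div_pow_mod]
    have hev₂ : AExpr.eval E (s'.setReg 23 (digit (t + 2) x i)) (.reg 19 /ᵃ .reg 2) =
        x / (t + 2) ^ (i + 1) := by
      simp [e2, h9, digit_succ]
    rw [hev₁, hev₂, hev]
    generalize hs₂ : (((s'.setReg 23 (digit (t + 2) x i)).setReg 19 (x / (t + 2) ^ (i + 1))).setReg
      22 f) = s₂
    have d0 : s₂.reg 0 = t := by simp [← hs₂, e0]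
    have d1 : s₂.reg 1 = n := by simp [← hs₂, e1]
    have d8 : s₂.reg 8 = v := by simp [← hs₂, e8]
    have d15 : s₂.reg 15 = i := by simp [← hs₂, h6]
    have d16 : s₂.reg 16 = p := by simp [← hs₂, e16]
    have d17 : s₂.reg 17 = c := by simp [← hs₂, e17]
    have d19 : s₂.reg 19 = x / (t + 2) ^ (i + 1) := by simp [← hs₂]
    have d22 : s₂.reg 22 = f := by simp [← hs₂]
    have d23 : s₂.reg 23 = digit (t + 2) x i := by simp [← hs₂]
    have darr : s₂.arr = s'.arr := by simp [← hs₂]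
    clear hs₂
    by_cases hz : Z (i + 1)
    · have hf1 := hfZ.2 hz
      have hpt' := hpt.resolve_right (not_not.2 hz)
      have hptB' := hptB.resolve_left (not_not.2 hz)
      have hst := hstep _ (fun _ => hpt') (fun h => absurd hz h)
      have hst' := hstep' (s'.arr 12 (p * t + i))
      have hst'' := hout (s'.arr 12 (p * t + i))
      by_cases hd : digit (t + 2) x i = c
      · simp only [hd, if_true] at hst'
        simp [d0, d1, d8, d15, d16, d17, d19, d22, d23, darr, e4, hMv, hMp, hMo, hM4, hf1, hd, hz]
        exact ⟨hptB', by omega, hst.1, fun j hj => hst.2 j (by omega), hst'',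
          fun j hj => hst' j (by omega)⟩
      · simp only [hd, if_false] at hst'
        simp [d0, d1, d8, d15, d16, d17, d19, d22, d23, darr, e4, hMv, hMp, hMo, hM4, hf1, hd, hz]
        exact ⟨hptB', by omega, hst.1, fun j hj => hst.2 j (by omega), h13,
          fun j hj => hst' j (by omega)⟩
    · have hf1 : f = 0 := by
        by_contra h
        exact hz (hfZ.1 h)
      have hst := hstep (v * t + i) (fun h => absurd h hz) (fun h => rfl)
      have hst' := hstep' (v * t + i)
      have hst'' := hout (v * t + i)
      by_cases hd : digit (t + 2) x i = c
      · simp only [hd, if_true] at hst'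
        simp [d0, d1, d8, d15, d16, d17, d19, d22, d23, darr, e4, hMv, hMp, hMo, hM4, hf1, hd, hz]
        exact ⟨by omega, hst.1, fun j hj => hst.2 j (by omega), hst'',
          fun j hj => hst' j (by omega)⟩
      · simp only [hd, if_false] at hst'
        simp [d0, d1, d8, d15, d16, d17, d19, d22, d23, darr, e4, hMv, hMp, hMo, hM4, hf1, hd, hz]
        exact ⟨by omega, hst.1, fun j hj => hst.2 j (by omega), h13,
          fun j hj => hst' j (by omega)⟩
  · rintro k s' hk h6 hf ⟨-, -, -, h9, h10, h11, h12⟩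
    rw [hp₁.t_eq] at hk h10 h12
    exact ⟨by omega, h9, h10, h11, h12⟩

/-- Writes the parents of the nodes that belong to the vertex in register `8`. -/
def outRow : AProg :=
  .assign 24 (.reg 0 -ᵃ .lit 1) ;;
  .loop 15 24 (.store 0 (.lit 2 +ᵃ (.reg 8 *ᵃ .reg 0 +ᵃ .reg 15))
    (.arr 12 (.reg 8 *ᵃ .reg 0 +ᵃ (.reg 15 +ᵃ .lit 1)) +ᵃ .lit 1))

/-- The nodes of height `t - 1` are roots and are left out: their cells keep the initial zero. -/
theorem outRow_spec (hE : E.Large n t) {s : AState} (hp : Parameters n t s) {v : ℕ}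
    (hv : s.reg 8 = v) (hvn : v < n) (h12 : ∀ j < t, s.arr 12 (v * t + j) < n * t) :
    AProg.WP E outRow s fun k s' => k ≤ t * 3 + 3 ∧
      (∀ j, j + 1 < t → s'.arr 0 (2 + (v * t + j)) = s.arr 12 (v * t + (j + 1)) + 1) ∧
      ∀ i, (∀ j, j + 1 < t → i ≠ 2 + (v * t + j)) → s'.arr 0 i = s.arr 0 i := by
  obtain ⟨h1, h2, h3, h4, h5⟩ := hE.le_B
  have hMb := hE.M_b
  have hM0 := hE.M_zero
  have hntM : n * t ≤ E.M 1 := by nlinarith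
  simp only [outRow, AProg.WP_seq, AProg.WP_assign]
  refine ⟨⟨by simp, by simp [hp.t_eq]; omega⟩, ?_⟩
  refine AProg.WP_loop 1 (fun i s' =>
    (∀ j < i, s'.arr 0 (2 + (v * t + j)) = s.arr 12 (v * t + (j + 1)) + 1) ∧
      ∀ i', (∀ j < i, i' ≠ 2 + (v * t + j)) → s'.arr 0 i' = s.arr 0 i')
    rfl rfl (by norm_num) ?_ ?_ ?_
  · simp
  · rintro i s' hi h6 h7 hf ⟨h8, h9⟩
    simp [hp.t_eq] at hi
    have e0 : s'.reg 0 = t := by simpa [hp.t_eq] using hf.reg 0 (by simp) rfl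
    have e8 : s'.reg 8 = v := by simpa [hv] using hf.reg 8 (by simp) rfl
    have e12 : s'.arr 12 = s.arr 12 := by simpa using hf.arr 12 rfl
    have hidx := index_lt hvn (show i < t by omega)
    have hidx' := index_lt hvn (show i + 1 < t by omega)
    have hM : v * t + (i + 1) < E.M 12 := by rw [hE.M_succ 11]; omega
    have hM' : 2 + (v * t + i) < E.M 0 := by omega
    have hlt := h12 (i + 1) (by omega)
    rw [AProg.WP_store]
    simp only [AExpr.eval, AExpr.Safe, Op.eval, e0, e8, h6, e12]
    refine ⟨⟨by simp, by simp [hM], hM', by omega⟩, le_rfl, ?_⟩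
    simp only [AState.arr_setReg, AState.arr_setArr, if_true]
    refine ⟨fun j hj => ?_, fun i' hi' => ?_⟩
    · by_cases hji : j = i
      · rw [hji, Function.update_self]
      · rw [Function.update_of_ne (by omega)]
        exact h8 j (by omega)
    · rw [Function.update_of_ne (hi' i (by omega))]
      exact h9 i' fun j hj => hi' j (by omega)
  · rintro k s' hk h6 hf ⟨h7, h8⟩
    simp [hp.t_eq] at hk h7 h8
    exact ⟨by omega, fun j hj => h7 j (by omega), fun i hi => h8 i fun j hj => hi j (by omega)⟩

/-- Writes the treedepth decomposition. -/
def output : AProg :=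
  .loop 8 1 (repRow ;; outRow) ;; .store 0 (.lit 0) (.lit 1) ;;
  .store 0 (.lit 1) (.reg 1 *ᵃ .reg 0)

/-- The dynamic program works with positions in the search order. The map `r` takes a position to
its vertex, and the image is stored under the latter. -/
theorem output_spec (hE : E.Large n t) {s : AState} (hp : Parameters n t s)
    {par col a r : ℕ → ℕ} (h6 : ∀ v < n, s.arr 6 v = par v) (h7 : ∀ v < n, s.arr 7 v = col v)
    (h11 : ∀ v < n, s.arr 11 v = a v) (h4 : ∀ v < n, s.arr 4 v = r v) (h0 : ∀ i, s.arr 0 i = 0)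
    (hparn : ∀ v < n, par v < n) (hpar : ∀ v, 0 < v → v < n → par v < v)
    (hcol : ∀ v < n, col v < t + 2) (ha : ∀ v < n, a v < (t + 2) ^ t)
    (hseen0 : ∀ j < t, ¬ Seen (t + 2) (col 0) (a 0) j)
    (huniq : ∀ v < n, ∀ i < t, ∀ j < t, digit (t + 2) (a v) i = col v →
      digit (t + 2) (a v) j = col v → i = j)
    (hr : ∀ v < n, r v < n) (hrinj : ∀ u v, u < n → v < n → r u = r v → u = v) :
    AProg.WP E output s fun k s' => k ≤ n * (t * 13 + 12) + 6 ∧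
      s'.arr 0 0 = 1 ∧ s'.arr 0 1 = n * t ∧ ∃ rep, IsRep n t par col a rep ∧
      (∀ v < n, ∀ j < t, s'.arr 0 (2 + (v * t + j)) =
        if j + 1 < t then rep v (j + 1) + 1 else 0) ∧
      ∀ v < n, ∀ j < t, digit (t + 2) (a v) j = col v →
        s'.arr 0 (2 + n * t + r v) = rep v j := by
  obtain ⟨h1, h2, h3, h5, -⟩ := hE.le_B
  have hM0 := hE.M_zero
  rw [output, AProg.WP_seq]
  refine AProg.WP_loop (t * 13 + 10) (fun v s' =>
    (∀ v' < v, ∀ j < t, s'.arr 12 (v' * t + j) < n * t) ∧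
    (∀ v' < v, ∀ j < t,
      (Seen (t + 2) (col v') (a v') j → s'.arr 12 (v' * t + j) = s'.arr 12 (par v' * t + j)) ∧
      (¬ Seen (t + 2) (col v') (a v') j → s'.arr 12 (v' * t + j) = v' * t + j)) ∧
    (∀ v' < n, ∀ j < t, s'.arr 0 (2 + (v' * t + j)) =
        if v' < v ∧ j + 1 < t then s'.arr 12 (v' * t + (j + 1)) + 1 else 0) ∧
    ∀ v' < v, ∀ j < t, digit (t + 2) (a v') j = col v' →
        s'.arr 0 (2 + n * t + r v') = s'.arr 12 (v' * t + j))
    rfl rfl (by norm_num) ?_ ?_ ?_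
  · simp [h0]
  · rintro v s₁ hv e8 e1 hf ⟨i1, i2, i3, i4⟩
    rw [hp.n_eq] at hv
    have hp₁ : Parameters n t s₁ := hp.of_frame hf (by decide)
    rw [AProg.WP_seq]
    have hs0 : v = 0 → ∀ j < t, ¬ Seen (t + 2) (col v) (a v) j := by
      rintro rfl
      exact hseen0
    refine (repRow_spec hE hp₁ e8 hv (by rw [hf.arr 6 rfl, h6 v hv]) (hparn v hv)
      (fun h => hpar v h hv) (by rw [hf.arr 7 rfl, h7 v hv]) (hcol v hv)
      (by rw [hf.arr 11 rfl, h11 v hv]) (ha v hv) hs0 (huniq v hv)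
      (by rw [hf.arr 4 rfl, h4 v hv]) (hr v hv) i1).frame fun k s₂ hf₂ h => ?_
    obtain ⟨hk, j1, j2, j3, j4⟩ := h
    have hp₂ : Parameters n t s₂ := hp₁.of_frame hf₂ (by decide)
    have hpv : ∀ j < t, Seen (t + 2) (col v) (a v) j → par v < v := fun j hj h =>
      hpar v (Nat.pos_of_ne_zero fun h0 => hs0 h0 j hj h) hv
    have j2' : ∀ j < t,
        (Seen (t + 2) (col v) (a v) j → s₂.arr 12 (v * t + j) = s₂.arr 12 (par v * t + j)) ∧
        (¬ Seen (t + 2) (col v) (a v) j → s₂.arr 12 (v * t + j) = v * t + j) := fun j hj =>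
      ⟨fun h => by rw [(j2 j hj).1 h, j1 _ (hpv j hj h) j hj], (j2 j hj).2⟩
    have jb : ∀ v' ≤ v, ∀ j < t, s₂.arr 12 (v' * t + j) < n * t := by
      intro v' hv' j hj
      rcases hv'.lt_or_eq with h | rfl
      · rw [j1 v' h j hj]
        exact i1 v' h j hj
      · by_cases hs : Seen (t + 2) (col v') (a v') j
        · rw [(j2 j hj).1 hs]
          exact i1 _ (hpv j hj hs) j hj
        · rw [(j2 j hj).2 hs]
          exact index_lt hv hj
    refine (outRow_spec hE hp₂ (by rw [hf₂.reg 8 (by simp) rfl, e8]) hv (jb v le_rfl)).frame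
      fun k' s₃ hf₃ h => ?_
    obtain ⟨hk', l1, l2⟩ := h
    have e12 : s₃.arr 12 = s₂.arr 12 := hf₃.arr 12 rfl
    simp only [AState.arr_setReg, e12]
    refine ⟨by omega, fun v' hv' => jb v' (by omega), fun v' hv' j hj => ?_, fun v' hv' j hj => ?_,
      fun v' hv' j hj hd => ?_⟩
    · rcases (Nat.lt_succ_iff.1 hv').lt_or_eq with h | rfl
      · rw [j1 v' h j hj]
        refine ⟨fun hs => ?_, (i2 v' h j hj).2⟩
        have hv0 : 0 < v' := Nat.pos_of_ne_zero fun h0 => by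
          subst h0
          exact hseen0 j hj hs
        rw [j1 (par v') ((hpar v' hv0 (by omega)).trans h) j hj]
        exact (i2 v' h j hj).1 hs
      · exact j2' j hj
    · by_cases hvv : v' = v ∧ j + 1 < t
      · obtain ⟨rfl, hj'⟩ := hvv
        rw [l1 j hj', if_pos ⟨by omega, hj'⟩]
      · have hlt := index_lt hv' hj
        rw [l2, j3 _ (by omega), i3 v' hv' j hj]
        · by_cases h : v' < v ∧ j + 1 < t
          · rw [if_pos h, if_pos ⟨by omega, h.2⟩, j1 v' h.1 _ h.2]
          · rw [if_neg h, if_neg]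
            intro h'
            omega
        · intro j' hj' he
          have := index_inj hj (show j' < t by omega) (Nat.add_left_cancel he)
          omega
    · have hne : ∀ j', j' + 1 < t → 2 + n * t + r v' ≠ 2 + (v * t + j') := fun j' hj' => by
        have := index_lt hv (show j' < t by omega)
        omega
      rw [l2 _ hne]
      rcases (Nat.lt_succ_iff.1 hv').lt_or_eq with h | rfl
      · rw [j3, i4 v' h j hj hd, j1 v' h j hj]
        intro he
        have := hrinj v' v (by omega) hv (by omega)
        omega
      · exact j4 j hj hd
  · rintro k s' hk - hf ⟨i1, i2, i3, i4⟩
    rw [hp.n_eq] at hk i1 i2 i3 i4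
    have e0 : s'.reg 0 = t := by rw [hf.reg 0 (by simp) rfl, hp.t_eq]
    have e1 : s'.reg 1 = n := by rw [hf.reg 1 (by simp) rfl, hp.n_eq]
    have hne : ∀ w i, i ≠ 0 → i ≠ 1 → Function.update (Function.update (s'.arr 0) 0 1) 1 w i =
        s'.arr 0 i := fun w i hi hi' => by
      rw [Function.update_of_ne hi', Function.update_of_ne hi]
    simp only [AProg.WP_seq, AProg.WP_store]
    simp [e0, e1]
    rw [show t * 13 + 10 + 2 = t * 13 + 12 by omega] at hk
    refine ⟨by omega, ⟨by omega, by omega⟩, by omega, fun v j => s'.arr 12 (v * t + j), i2,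
      fun v hv j hj => ?_, fun v hv j hj hd => ?_⟩
    · rw [hne _ _ (by omega) (by omega), i3 v hv j hj]
      simp [hv]
    · rw [hne _ _ (by omega) (by omega), i4 v hv j hj hd]

end ArrayMachine

/-! ## Maximum cardinality search -/

section Search

open Finset

open Classical in
/-- The number of neighbours of `x` among the first `m` vertices of a sequence. -/
noncomputable def visitedCount (R : ℕ → ℕ → Prop) (vert : ℕ → ℕ) (m x : ℕ) : ℕ :=
  ((range m).filter fun i => R x (vert i)).card

variable {R : ℕ → ℕ → Prop} {vert vert' : ℕ → ℕ} {n t m W j N : ℕ}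

theorem visitedCount_congr {x : ℕ} (h : ∀ i < m, vert i = vert' i) :
    visitedCount R vert m x = visitedCount R vert' m x := by
  classical
  exact congrArg card (filter_congr fun i hi => by rw [h i (mem_range.1 hi)])

@[simp]
theorem visitedCount_zero (x : ℕ) : visitedCount R vert 0 x = 0 := by
  simp [visitedCount]

open Classical in
theorem visitedCount_succ (x : ℕ) :
    visitedCount R vert (m + 1) x = visitedCount R vert m x + if R x (vert m) then 1 else 0 := by
  unfold visitedCount
  rw [range_add_one, filter_insert]
  split_ifs with h
  · rw [card_insert_of_notMem (by simp)]
  · rfl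

/-- The first `m` entries of `vert`, with the inverse `pos - 1`, are a search order in which every
vertex has the maximum number of visited neighbours, and less than `t` of them. -/
structure IsSearchOrder (n t : ℕ) (R : ℕ → ℕ → Prop) (m : ℕ) (vert pos : ℕ → ℕ) : Prop where
  vert_lt : ∀ i < m, vert i < n
  pos_vert : ∀ i < m, pos (vert i) = i + 1
  vert_pos : ∀ u < n, pos u ≠ 0 → pos u ≤ m ∧ vert (pos u - 1) = u
  count_le : ∀ i < m, ∀ c < n, (pos c = 0 ∨ i + 1 < pos c) →
    visitedCount R vert i c ≤ visitedCount R vert i (vert i)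
  count_lt : ∀ i < m, visitedCount R vert i (vert i) < t

theorem IsSearchOrder.vert_inj {pos : ℕ → ℕ} (h : IsSearchOrder n t R m vert pos) {i i' : ℕ}
    (hi : i < m) (hi' : i' < m) (he : vert i = vert i') : i = i' := by
  have := h.pos_vert i hi
  rw [he, h.pos_vert i' hi'] at this
  omega

theorem IsSearchOrder.card_le {pos : ℕ → ℕ} (h : IsSearchOrder n t R m vert pos) : m ≤ n := by
  have := card_le_card_of_injOn (s := range m) (t := range n) vert
    (fun i hi => by simpa using h.vert_lt i (by simpa using hi))
    (fun i hi i' hi' he => h.vert_inj (by simpa using hi) (by simpa using hi') he)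
  simpa using this

theorem IsSearchOrder.eq_of_forall {pos : ℕ → ℕ} (h : IsSearchOrder n t R m vert pos)
    (hall : ∀ u < n, pos u ≠ 0) : m = n := by
  refine le_antisymm h.card_le ?_
  have := card_le_card_of_injOn (s := range n) (t := range m) (fun u => pos u - 1)
    (fun u hu => by
      have := h.vert_pos u (by simpa using hu) (hall u (by simpa using hu))
      have := hall u (by simpa using hu)
      simp only [coe_range, Set.mem_Iio]
      omega)
    (fun u hu u' hu' he => by
      have h1 := (h.vert_pos u (by simpa using hu) (hall u (by simpa using hu))).2
      have h2 := (h.vert_pos u' (by simpa using hu') (hall u' (by simpa using hu'))).2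
      simp only at he
      rw [← h1, ← h2, he])
  simpa using this

theorem IsSearchOrder.sum_le {pos : ℕ → ℕ} (h : IsSearchOrder n t R m vert pos) (f : ℕ → ℕ) :
    ∑ i ∈ range m, f (vert i) ≤ ∑ u ∈ range n, f u := by
  rw [← sum_image (f := f) (s := range m) (g := vert) fun i hi i' hi' he =>
    h.vert_inj (by simpa using hi) (by simpa using hi') he]
  refine sum_le_sum_of_subset fun u hu => ?_
  obtain ⟨i, hi, rfl⟩ := mem_image.1 hu
  simpa using h.vert_lt i (by simpa using hi)

theorem IsSearchOrder.step {pos : ℕ → ℕ} (h : IsSearchOrder n t R m vert pos) {u : ℕ} (hu : u < n)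
    (hpos : pos u = 0)
    (hmax : ∀ c < n, pos c = 0 → visitedCount R vert m c ≤ visitedCount R vert m u)
    (hlt : visitedCount R vert m u < t) :
    IsSearchOrder n t R (m + 1) (Function.update vert m u) (Function.update pos u (m + 1)) := by
  have hv : ∀ i < m, Function.update vert m u i = vert i := fun i hi =>
    Function.update_of_ne (by omega) _ _
  have hne : ∀ i < m, vert i ≠ u := fun i hi he => by
    have := h.pos_vert i hi
    rw [he, hpos] at this
    omega
  have hcount : ∀ i ≤ m, ∀ x, visitedCount R (Function.update vert m u) i x =
      visitedCount R vert i x := fun i hi x => visitedCount_congr fun i' hi' => hv i' (by omega)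
  refine ⟨fun i hi => ?_, fun i hi => ?_, fun c hc hc0 => ?_, fun i hi c hc hc' => ?_,
    fun i hi => ?_⟩
  · rcases Nat.lt_succ_iff_lt_or_eq.1 hi with hi | rfl
    · rw [hv i hi]
      exact h.vert_lt i hi
    · rwa [Function.update_self]
  · rcases Nat.lt_succ_iff_lt_or_eq.1 hi with hi | rfl
    · rw [hv i hi, Function.update_of_ne (hne i hi)]
      exact h.pos_vert i hi
    · rw [Function.update_self, Function.update_self]
  · by_cases hcu : c = u
    · subst hcu
      simp
    · rw [Function.update_of_ne hcu] at hc0 ⊢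
      obtain ⟨h1, h2⟩ := h.vert_pos c hc hc0
      rw [hv _ (by omega)]
      exact ⟨by omega, h2⟩
  · rw [hcount i (by omega), hcount i (by omega)]
    rcases Nat.lt_succ_iff_lt_or_eq.1 hi with hi | rfl
    · rw [hv i hi]
      refine h.count_le i hi c hc ?_
      by_cases hcu : c = u
      · exact .inl (hcu ▸ hpos)
      · rwa [Function.update_of_ne hcu] at hc'
    · rw [Function.update_self]
      refine hmax c hc ?_
      by_cases hcu : c = u
      · exact hcu ▸ hpos
      · rw [Function.update_of_ne hcu] at hc'
        by_contra hc0
        have := (h.vert_pos c hc hc0).1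
        omega
  · rw [hcount i (by omega)]
    rcases Nat.lt_succ_iff_lt_or_eq.1 hi with hi | rfl
    · rw [hv i hi]
      exact h.count_lt i hi
    · rwa [Function.update_self]

/-- The stacks `bk` with sizes `sz` hold every unvisited vertex `u` at its label `l u`; all entries
are vertices with at least this label, or visited. -/
structure IsBucketQueue (n t W : ℕ) (l : ℕ → ℕ) (j N : ℕ) (sz bk pos : ℕ → ℕ) : Prop where
  label_lt : ∀ u < n, pos u = 0 → l u < t
  mem : ∀ u < n, pos u = 0 → ∃ k < sz (l u), bk (l u * W + k) = u
  entry_lt : ∀ a < t, ∀ k < sz a, bk (a * W + k) < n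
  entry_le : ∀ a < t, ∀ k < sz a, pos (bk (a * W + k)) = 0 → a ≤ l (bk (a * W + k))
  top : ∀ a < t, j < a → sz a = 0
  sum_le : ∑ a ∈ range t, sz a ≤ N

variable {l l' sz bk pos pos' : ℕ → ℕ}

theorem IsBucketQueue.size_le (h : IsBucketQueue n t W l j N sz bk pos) {a : ℕ} (ha : a < t) :
    sz a ≤ N :=
  (single_le_sum (f := sz) (fun _ _ => Nat.zero_le _) (mem_range.2 ha)).trans h.sum_le

theorem IsBucketQueue.congr (h : IsBucketQueue n t W l j N sz bk pos)
    (hl : ∀ u < n, pos u = 0 → l u = l' u) : IsBucketQueue n t W l' j N sz bk pos where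
  label_lt u hu h0 := hl u hu h0 ▸ h.label_lt u hu h0
  mem u hu h0 := hl u hu h0 ▸ h.mem u hu h0
  entry_lt := h.entry_lt
  entry_le a ha k hk h0 := hl _ (h.entry_lt a ha k hk) h0 ▸ h.entry_le a ha k hk h0
  top := h.top
  sum_le := h.sum_le

theorem IsBucketQueue.label_le (h : IsBucketQueue n t W l j N sz bk pos) {u : ℕ} (hu : u < n)
    (h0 : pos u = 0) : l u ≤ j := by
  by_contra hlt
  obtain ⟨k, hk, -⟩ := h.mem u hu h0
  rw [h.top _ (h.label_lt u hu h0) (by omega)] at hk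
  omega

theorem IsBucketQueue.down (h : IsBucketQueue n t W l j N sz bk pos) (hj : sz j = 0) :
    IsBucketQueue n t W l (j - 1) N sz bk pos :=
  { h with
    top := fun a ha haj => by
      rcases eq_or_ne a j with rfl | hne
      · exact hj
      · exact h.top a ha (by omega) }

/-- An entry can be dropped if its vertex counts as visited under `pos'`. This covers both an
outdated entry and the vertex that is being visited now. -/
theorem IsBucketQueue.pop (h : IsBucketQueue n t W l j N sz bk pos) (hj : j < t) {k : ℕ}
    (hk : sz j = k + 1) (hpos : ∀ c, pos' c = 0 → pos c = 0) (hu : pos' (bk (j * W + k)) ≠ 0) :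
    IsBucketQueue n t W l j (N - 1) (Function.update sz j k) bk pos' := by
  have hle : ∀ a, Function.update sz j k a ≤ sz a := fun a => by
    rw [Function.update_apply]
    split_ifs with h
    · rw [h]
      omega
    · exact le_rfl
  refine ⟨fun u hu h0 => h.label_lt u hu (hpos u h0), fun u hun h0 => ?_,
    fun a ha k' hk' => h.entry_lt a ha k' (hk'.trans_le (hle a)),
    fun a ha k' hk' h0 => h.entry_le a ha k' (hk'.trans_le (hle a)) (hpos _ h0),
    fun a ha haj => Nat.le_zero.1 ((hle a).trans (h.top a ha haj).le), ?_⟩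
  · obtain ⟨k', hk', he⟩ := h.mem u hun (hpos u h0)
    refine ⟨k', ?_, he⟩
    rw [Function.update_apply]
    split_ifs with hlj
    · rw [hlj] at hk' he
      have : k' ≠ k := fun hkk => by
        subst hkk
        exact hu (he ▸ h0)
      omega
    · exact hk'
  · have h1 := h.sum_le
    rw [sum_update_of_mem (mem_range.2 hj)]
    rw [← sum_erase_add _ _ (mem_range.2 hj), hk, erase_eq] at h1
    omega

/-- The old entry of `x` is not removed: its bucket number is now below the label, which `entry_le`
permits. As at most `N < W` entries exist, the buckets do not overlap. -/
theorem IsBucketQueue.push (h : IsBucketQueue n t W l j N sz bk pos) (hN : N < W) {x : ℕ}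
    (hx : x < n) (h0 : pos x = 0) (hlt : l x + 1 < t) :
    IsBucketQueue n t W (Function.update l x (l x + 1)) (t - 1) (N + 1)
      (Function.update sz (l x + 1) (sz (l x + 1) + 1))
      (Function.update bk ((l x + 1) * W + sz (l x + 1)) x) pos := by
  have hsz := h.size_le hlt
  have hbk : ∀ a < t, ∀ k < sz a,
      Function.update bk ((l x + 1) * W + sz (l x + 1)) x (a * W + k) = bk (a * W + k) := by
    intro a ha k hk
    have := h.size_le ha
    refine Function.update_of_ne (fun he => ?_) _ _
    obtain ⟨rfl, rfl⟩ := ArrayMachine.index_inj (by omega) (by omega) he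
    omega
  have hle : ∀ a, sz a ≤ Function.update sz (l x + 1) (sz (l x + 1) + 1) a := fun a => by
    rw [Function.update_apply]
    split_ifs with h
    · rw [h]
      omega
    · exact le_rfl
  have hcases : ∀ a < t, ∀ k < Function.update sz (l x + 1) (sz (l x + 1) + 1) a,
      k < sz a ∨ (a = l x + 1 ∧ k = sz (l x + 1)) := by
    intro a ha k hk
    rw [Function.update_apply] at hk
    split_ifs at hk with h
    · subst h
      omega
    · exact .inl hk
  refine ⟨fun u hu hu0 => ?_, fun u hu hu0 => ?_, fun a ha k hk => ?_, fun a ha k hk hk0 => ?_,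
    fun a ha haj => by omega, ?_⟩
  · rw [Function.update_apply]
    split_ifs
    · exact hlt
    · exact h.label_lt u hu hu0
  · by_cases hux : u = x
    · subst hux
      rw [Function.update_self, Function.update_self]
      exact ⟨sz (l u + 1), by omega, Function.update_self _ _ _⟩
    · rw [Function.update_of_ne hux]
      obtain ⟨k, hk, he⟩ := h.mem u hu hu0
      refine ⟨k, hk.trans_le (hle _), ?_⟩
      rw [hbk _ (h.label_lt u hu hu0) k hk, he]
  · rcases hcases a ha k hk with hk | ⟨rfl, rfl⟩
    · rw [hbk a ha k hk]
      exact h.entry_lt a ha k hk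
    · rwa [Function.update_self]
  · rcases hcases a ha k hk with hk | ⟨rfl, rfl⟩
    · rw [hbk a ha k hk] at hk0 ⊢
      have := h.entry_le a ha k hk hk0
      rw [Function.update_apply]
      split_ifs with he
      · rw [he] at this
        omega
      · exact this
    · rw [Function.update_self, Function.update_self]
  · have h1 := h.sum_le
    rw [sum_update_of_mem (mem_range.2 hlt)]
    rw [← sum_erase_add _ _ (mem_range.2 hlt), erase_eq] at h1
    omega

end Search

/-! ### Search orders produced by maximum cardinality search -/

section SearchOrder

open Finset

variable {n t m : ℕ} {G : SimpleGraph (Fin n)} {R : ℕ → ℕ → Prop} {vert pos : ℕ → ℕ}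

/-- Visited vertices are ranked by position and all unvisited ones by `n + 1`, so that the statement
is available for an incomplete search as well. -/
theorem IsSearchOrder.adj_of_adj (h : IsSearchOrder n t R m vert pos) (hG : IsChordal G)
    (hR : ∀ u v, R u v ↔ ∃ (hu : u < n) (hv : v < n), G.Adj ⟨u, hu⟩ ⟨v, hv⟩) {a b c : ℕ}
    (ha : pos a ≠ 0) (hb : pos b ≠ 0) (hac : pos c = 0 ∨ pos a < pos c)
    (hbc : pos c = 0 ∨ pos b < pos c) (hne : a ≠ b) (h1 : R a c) (h2 : R b c) : R a b := by
  have hmn := h.card_le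
  obtain ⟨han, hcn, h1⟩ := (hR a c).1 h1
  obtain ⟨hbn, _, h2⟩ := (hR b c).1 h2
  have hle : ∀ u < n, pos u ≤ n := fun u hu => by
    by_cases h0 : pos u = 0
    · omega
    · exact (h.vert_pos u hu h0).1.trans hmn
  obtain ⟨r, hr⟩ : ∃ r : Fin n → ℕ, ∀ u, r u = if pos u = 0 then n + 1 else pos u := ⟨_, fun _ => rfl⟩
  have hr0 : ∀ u : Fin n, pos u ≠ 0 → r u = pos u := fun u hu => by rw [hr, if_neg hu]
  have hrn : ∀ u : Fin n, r u ≤ n + 1 := fun u => by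
    rw [hr]
    split_ifs
    · exact le_rfl
    · exact (hle u u.2).trans (by omega)
  have hr1 : ∀ u v : Fin n, r u < r v → pos u ≠ 0 := fun u v huv h0 => by
    have := hrn v
    rw [hr u, if_pos h0] at huv
    omega
  have hlt : ∀ u v : Fin n, pos u ≠ 0 → (r u < r v ↔ (pos v = 0 ∨ pos u < pos v)) := by
    intro u v hu
    have := hle u u.2
    rw [hr0 u hu, hr v]
    split_ifs with h0
    · simp only [h0, true_or, iff_true]
      omega
    · simp only [h0, false_or]
  refine (hR a b).2 ⟨han, hbn, hG.adj_of_search_order r ?_ ?_ (c := ⟨c, hcn⟩) ?_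
    ((hlt _ _ ha).2 hac) ((hlt _ _ hb).2 hbc) h1 h2⟩
  · intro u v w huv huw
    have hu := hr1 u w huw
    have hv := hr1 v w (huv ▸ huw)
    rw [hr0 u hu, hr0 v hv] at huv
    ext
    rw [← (h.vert_pos u u.2 hu).2, ← (h.vert_pos v v.2 hv).2, huv]
  · intro u v w huv hvw h1 h2
    have hu := hr1 u v huv
    have hv := hr1 v w hvw
    rw [hlt u v hu] at huv
    rw [hlt v w hv] at hvw
    obtain ⟨hum, hue⟩ := h.vert_pos u u.2 hu
    obtain ⟨hvm, hve⟩ := h.vert_pos v v.2 hv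
    by_contra hcon
    push Not at hcon
    -- If all earlier neighbours of `v` were neighbours of `w`, then `w` would have had more visited
    -- neighbours than `v` when `v` was chosen, because `u` is a neighbour of `w` only.
    have hle := h.count_le (pos v - 1) (by omega) w w.2 (by omega)
    rw [hve] at hle
    refine absurd hle (not_le.2 (card_lt_card (ssubset_iff_of_subset ?_ |>.2 ?_)))
    · intro i hi
      simp only [mem_filter, mem_range] at hi ⊢
      refine ⟨hi.1, ?_⟩
      obtain ⟨_, hin, hadj⟩ := (hR _ _).1 hi.2
      have hpi := h.pos_vert i (by omega)
      refine (hR _ _).2 ⟨w.2, hin, (hcon ⟨vert i, hin⟩ ?_ hadj.symm).symm⟩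
      rw [hlt _ _ (by simp only [hpi]; omega)]
      simp only [hpi]
      omega
    · refine ⟨pos u - 1, ?_, ?_⟩
      · simp only [mem_filter, mem_range]
        exact ⟨by omega, by rw [hue]; exact (hR _ _).2 ⟨w.2, u.2, h1.symm⟩⟩
      · simp only [mem_filter, mem_range, not_and, hue]
        intro _ hadj
        obtain ⟨_, _, hadj⟩ := (hR _ _).1 hadj
        exact h2 hadj.symm
  · simpa using hne

/-- Together with its visited neighbours, `x` forms a clique of more than `t` vertices. -/
theorem IsSearchOrder.not_treedepth_le (h : IsSearchOrder n t R m vert pos) (hG : IsChordal G)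
    (hR : ∀ u v, R u v ↔ ∃ (hu : u < n) (hv : v < n), G.Adj ⟨u, hu⟩ ⟨v, hv⟩) {x : ℕ} (hx : x < n)
    (h0 : pos x = 0) (ht : t ≤ visitedCount R vert m x) : ¬ treedepth G ≤ t := by
  classical
  intro htd
  have hcl := card_le_of_isClique htd (univ.filter fun u : Fin n => (u : ℕ) = x ∨
    (pos u ≠ 0 ∧ R x u)) fun u hu v hv huv => by
      simp only [mem_filter, mem_univ, true_and] at hu hv
      have hsymm : ∀ u v, R u v → R v u := fun u v huv => by
        obtain ⟨hu, hv, huv⟩ := (hR u v).1 huv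
        exact (hR v u).2 ⟨hv, hu, huv.symm⟩
      have : R u v := by
        rcases hu with hu | ⟨hu1, hu2⟩ <;> rcases hv with hv | ⟨hv1, hv2⟩
        · exact absurd (Fin.ext (hu.trans hv.symm)) huv
        · rw [hu]
          exact hv2
        · rw [hv]
          exact hsymm _ _ hu2
        · exact h.adj_of_adj hG hR hu1 hv1 (.inl h0) (.inl h0) (fun h => huv (Fin.ext h))
            (hsymm _ _ hu2) (hsymm _ _ hv2)
      exact ((hR u v).1 this).2.2
  have hsub : insert x (((range m).filter fun i => R x (vert i)).image vert) ⊆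
      (univ.filter fun u : Fin n => (u : ℕ) = x ∨ (pos u ≠ 0 ∧ R x u)).image Fin.val := by
    intro u hu
    rw [mem_insert, mem_image] at hu
    rcases hu with rfl | ⟨i, hi, rfl⟩
    · exact mem_image.2 ⟨⟨u, hx⟩, by simp, rfl⟩
    · simp only [mem_filter, mem_range] at hi
      refine mem_image.2 ⟨⟨vert i, h.vert_lt i hi.1⟩, ?_, rfl⟩
      simp only [mem_filter, mem_univ, true_and]
      exact .inr ⟨by rw [h.pos_vert i hi.1]; omega, hi.2⟩
  have hcard := (card_le_card hsub).trans card_image_le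
  rw [card_insert_of_notMem, card_image_of_injOn] at hcard
  · have : visitedCount R vert m x = ((range m).filter fun i => R x (vert i)).card := by
      unfold visitedCount
      congr
    omega
  · intro i hi i' hi' he
    simp only [coe_filter, mem_range, Set.mem_ofPred_eq] at hi hi'
    exact h.vert_inj hi.1 hi'.1 he
  · intro hx
    obtain ⟨i, hi, he⟩ := mem_image.1 hx
    simp only [mem_filter, mem_range] at hi
    have := h.pos_vert i hi.1
    rw [he, h0] at this
    omega

end SearchOrder

/-! ### Adjacency lists as read by the machine -/

/-- The word sequence `inp` holds adjacency lists of the graph `R` on `0, …, n - 1`: the list of `u`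
has the offset `off u` and the entries `nb u k`. -/
structure IsAdjacencyInput (inp : List ℕ) (n : ℕ) (off : ℕ → ℕ) (nb : ℕ → ℕ → ℕ)
    (R : ℕ → ℕ → Prop) : Prop where
  off_le : ∀ u < n, off u ≤ off (u + 1)
  inp_off : ∀ u ≤ n, inp.getD (u + 2) 0 = off u
  inp_nb : ∀ u < n, ∀ k < off (u + 1) - off u, inp.getD (n + 3 + off u + k) 0 = nb u k
  rel_iff : ∀ u < n, ∀ x, R u x ↔ ∃ k < off (u + 1) - off u, nb u k = x
  nb_inj : ∀ u < n, ∀ k < off (u + 1) - off u, ∀ k' < off (u + 1) - off u,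
    nb u k = nb u k' → k = k'
  rel_lt : ∀ u x, R u x → x < n
  symm : ∀ u x, R u x → R x u
  irrefl : ∀ u, ¬ R u u

namespace IsAdjacencyInput

variable {inp : List ℕ} {n : ℕ} {off : ℕ → ℕ} {nb : ℕ → ℕ → ℕ} {R : ℕ → ℕ → Prop}

theorem off_mono (h : IsAdjacencyInput inp n off nb R) {u v : ℕ} (huv : u ≤ v) (hv : v ≤ n) :
    off u ≤ off v := by
  induction v, huv using Nat.le_induction with
  | base => exact le_rfl
  | succ v _ ih => exact (ih (by omega)).trans (h.off_le v (by omega))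

theorem sum_degree (h : IsAdjacencyInput inp n off nb R) :
    ∑ u ∈ Finset.range n, (off (u + 1) - off u) ≤ off n := by
  have : ∀ m ≤ n, ∑ u ∈ Finset.range m, (off (u + 1) - off u) ≤ off m := by
    intro m
    induction m with
    | zero => simp
    | succ m ih =>
      intro hm
      have := ih (by omega)
      have := h.off_le m (by omega)
      rw [Finset.sum_range_succ]
      omega
  exact this n le_rfl

theorem nb_lt (h : IsAdjacencyInput inp n off nb R) {u k : ℕ} (hu : u < n)
    (hk : k < off (u + 1) - off u) : nb u k < n :=
  h.rel_lt u _ ((h.rel_iff u hu _).2 ⟨k, hk, rfl⟩)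

end IsAdjacencyInput

/-! ### The search on the machine -/

namespace ArrayMachine

open WordRAM (Op)

variable {E : Env} {n t : ℕ} {off : ℕ → ℕ} {nb : ℕ → ℕ → ℕ} {R : ℕ → ℕ → Prop}

theorem Env.Large.lt_M (hE : E.Large n t) (k : ℕ) {v : ℕ} (hv : v < n) : v < E.M (k + 1) := by
  rw [hE.M_succ k]
  have := hE.M_b
  nlinarith

/-- The arrays `1`, `2`, `3`, `5` hold the sizes of the buckets, the buckets, the positions and the
labels. -/
structure QueueState (n t W : ℕ) (l : ℕ → ℕ) (j N : ℕ) (s : AState) : Prop where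
  queue : IsBucketQueue n t W l j N (s.arr 1) (s.arr 2) (s.arr 3)
  label : ∀ u < n, s.arr 3 u = 0 → s.arr 5 u = l u

theorem QueueState.congr {W j N N' : ℕ} {l l' : ℕ → ℕ} {s s' : AState}
    (h : QueueState n t W l j N s) (hN : N ≤ N') (hl : ∀ u < n, s.arr 3 u = 0 → l u = l' u) (h1 : s'.arr 1 = s.arr 1) (h2 : s'.arr 2 = s.arr 2)
    (h3 : s'.arr 3 = s.arr 3) (h5 : s'.arr 5 = s.arr 5) : QueueState n t W l' j N' s' where
  queue := by
    rw [h1, h2, h3]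
    exact { h.queue.congr hl with sum_le := h.queue.sum_le.trans hN }
  label u hu h0 := by
    rw [h3] at h0
    rw [h5, h.label u hu h0, hl u hu h0]

/-- Puts the vertex in register `17` onto the bucket of its label. -/
def push : AProg :=
  .assign 19 (.arr 5 (.reg 17)) ;;
  .store 2 (.reg 19 *ᵃ .reg 4 +ᵃ .arr 1 (.reg 19)) (.reg 17) ;;
  .store 1 (.reg 19) (.arr 1 (.reg 19) +ᵃ .lit 1)

theorem push_spec {s : AState} {x W a : ℕ} (hx : s.reg 17 = x) (hW : s.reg 4 = W)
    (ha : s.arr 5 x = a) (hx5 : x < E.M 5) (haB : a ≤ E.B) (hxB : x ≤ E.B) (ha1 : a < E.M 1)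
    (hb : a * W + s.arr 1 a < E.M 2) (hsz : s.arr 1 a + 1 ≤ E.B) :
    AProg.WP E push s fun c s' => c ≤ 3 ∧ s'.arr 1 = Function.update (s.arr 1) a (s.arr 1 a + 1) ∧
      s'.arr 2 = Function.update (s.arr 2) (a * W + s.arr 1 a) x := by
  simp only [push, AProg.WP_seq, AProg.WP_assign, AProg.WP_store]
  simp [hx, hW, ha, hx5, haB, hxB, ha1, hb, hsz]

/-- Processes the neighbour with the number in register `21` of the vertex in register `16`. -/
def visitNeighbour : AProg :=
  .assign 17 (.input (.reg 1 +ᵃ .lit 3 +ᵃ .input (.reg 16 +ᵃ .lit 2) +ᵃ .reg 21)) ;;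
  .ite (.reg 7 +ᵃ .arr 3 (.reg 17)) .skip (
    .store 5 (.reg 17) (.arr 5 (.reg 17) +ᵃ .lit 1) ;;
    .ite (.arr 5 (.reg 17) <ᵃ .reg 0) push (.assign 7 (.lit 1)))

theorem visitNeighbour_spec (hE : E.Large n t) (hA : IsAdjacencyInput E.inp n off nb R) {s : AState}
    (hp : Parameters n t s) {u k W N : ℕ} {l : ℕ → ℕ} (hu : s.reg 16 = u) (hun : u < n)
    (hk : s.reg 21 = k) (hkd : k < off (u + 1) - off u) (hW : s.reg 4 = W) (hN : N < W)
    (hWB : W ≤ E.B) (hWM : t * W ≤ E.M 1)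
    (hq : s.reg 7 = 0 → QueueState n t W l (t - 1) N s) :
    AProg.WP E visitNeighbour s fun c s' => c ≤ 7 ∧
      ((s'.reg 7 ≠ 0 ∧ (s.reg 7 ≠ 0 ∨ (s.arr 3 (nb u k) = 0 ∧ t ≤ l (nb u k) + 1))) ∨
        (s'.reg 7 = 0 ∧ s.reg 7 = 0 ∧
          QueueState n t W (Function.update l (nb u k) (l (nb u k) + 1)) (t - 1) (N + 1) s')) := by
  obtain ⟨h1, h2, h3, h4, h5⟩ := hE.le_B
  have hx := hA.nb_lt hun hkd
  have hin := hA.inp_nb u hun k hkd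
  have hio := hA.inp_off u hun.le
  obtain ⟨x, hxe⟩ : ∃ x, x = nb u k := ⟨_, rfl⟩
  rw [← hxe] at hx hin ⊢
  have hM3 : x < E.M 3 := hE.lt_M 2 hx
  have hM5 : x < E.M 5 := hE.lt_M 4 hx
  have hev : AExpr.eval E s (.input (.reg 1 +ᵃ .lit 3 +ᵃ .input (.reg 16 +ᵃ .lit 2) +ᵃ .reg 21)) =
      x := by
    simp only [AExpr.eval, Op.eval, hp.n_eq, hu, hk, hio, hin]
  rw [visitNeighbour, AProg.WP_seq, AProg.WP_assign, hev]
  refine ⟨⟨by simp, by omega⟩, ?_⟩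
  rw [AProg.WP_ite]
  simp only [AExpr.eval, AExpr.Safe, Op.eval, AState.reg_setReg, AState.arr_setReg]
  norm_num
  refine ⟨hM3, fun h => ?_, fun h7 h0 => ?_⟩
  · by_cases h7 : s.reg 7 = 0
    -- A visited neighbour is skipped; its label in the invariant may grow nevertheless, as labels
    -- of visited vertices are not constrained.
    · refine .inr ⟨h7, (hq h7).congr (Nat.le_succ N) (fun v hv hv0 => ?_) rfl rfl rfl rfl⟩
      rw [Function.update_of_ne]
      rintro rfl
      exact h h7 hv0
    · exact .inl ⟨h7, .inl h7⟩
  · have hq := hq h7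
    have hlab := hq.label x hx h0
    have hlt := hq.queue.label_lt x hx h0
    simp only [hlab, hp.t_eq]
    refine ⟨⟨hM5, by omega⟩, hM5, fun hlt => ?_, fun hle => ?_⟩
    · have hsz := hq.queue.size_le hlt
      have hidx := index_lt hlt (show s.arr 1 (l x + 1) < W by omega)
      refine (push_spec (x := x) (W := W) (a := l x + 1) (by simp) (by simp [hW]) (by simp)
        hM5 (by omega) (by omega) (by nlinarith)
        (by rw [hE.M_succ 1]; simpa using hidx.trans_le hWM) (by simp; omega)).frame
        fun c s' hf h => ?_
      obtain ⟨hc, e1, e2⟩ := h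
      have e7 : s'.reg 7 = 0 := by
        rw [hf.reg 7 (by simp) rfl]
        simp [h7]
      have e3 : s'.arr 3 = s.arr 3 := by
        rw [hf.arr 3 rfl]
        simp
      have e5 : s'.arr 5 = Function.update (s.arr 5) x (l x + 1) := by
        rw [hf.arr 5 rfl]
        simp
      simp at e1 e2
      refine ⟨by omega, .inr ⟨e7, h7, ?_, fun v hv hv0 => ?_⟩⟩
      · rw [e1, e2, e3]
        exact hq.queue.push hN hx h0 hlt
      · rw [e3] at hv0
        rw [e5, Function.update_apply, Function.update_apply]
        split_ifs
        · rfl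
        · exact hq.label v hv hv0
    · exact ⟨by omega, .inr ⟨h0, hle⟩⟩

/-- Processes the neighbours of the vertex in register `16`. -/
def visitNeighbours : AProg :=
  .assign 20 (.input (.reg 16 +ᵃ .lit 3) -ᵃ .input (.reg 16 +ᵃ .lit 2)) ;;
  .loop 21 20 visitNeighbour

open Classical in
theorem visitNeighbours_spec (hE : E.Large n t) (hA : IsAdjacencyInput E.inp n off nb R)
    {s : AState} (hp : Parameters n t s) {u W N : ℕ} {l : ℕ → ℕ} (hu : s.reg 16 = u) (hun : u < n)
    (hW : s.reg 4 = W) (hN : N + (off (u + 1) - off u) < W)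
    (hWB : W ≤ E.B) (hWM : t * W ≤ E.M 1) (h7 : s.reg 7 = 0) (hq : QueueState n t W l (t - 1) N s) :
    AProg.WP E visitNeighbours s fun c s' => c ≤ (off (u + 1) - off u) * 9 + 3 ∧
      ((s'.reg 7 ≠ 0 ∧ ∃ x < n, R u x ∧ s.arr 3 x = 0 ∧ t ≤ l x + 1) ∨
        (s'.reg 7 = 0 ∧ QueueState n t W (fun x => l x + if R u x then 1 else 0) (t - 1)
          (N + (off (u + 1) - off u)) s')) := by
  have hio := hA.inp_off u hun.le
  have hio' := hA.inp_off (u + 1) hun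
  obtain ⟨d, hd⟩ : ∃ d, d = off (u + 1) - off u := ⟨_, rfl⟩
  have hev : AExpr.eval E s (.input (.reg 16 +ᵃ .lit 3) -ᵃ .input (.reg 16 +ᵃ .lit 2)) = d := by
    simp only [AExpr.eval, Op.eval, hu, hio]
    rw [show u + 3 = u + 1 + 2 by ring, hio', hd]
  rw [visitNeighbours, AProg.WP_seq, AProg.WP_assign, hev]
  rw [← hd] at hN ⊢
  refine ⟨⟨by simp, by omega⟩, ?_⟩
  refine AProg.WP_loop 7 (fun k s' =>
    (s'.reg 7 ≠ 0 ∧ ∃ x < n, R u x ∧ s.arr 3 x = 0 ∧ t ≤ l x + 1) ∨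
    (s'.reg 7 = 0 ∧ QueueState n t W (fun x => l x + if ∃ k' < k, nb u k' = x then 1 else 0) (t - 1)
      (N + k) s')) rfl rfl (by norm_num) ?_ ?_ ?_
  · refine .inr ⟨by simpa using h7, ?_⟩
    simpa using hq.congr (s' := (s.setReg 20 d).setReg 21 0) le_rfl (fun _ _ _ => rfl) rfl rfl rfl rfl
  · intro k s' hk h21 h20 hf hI
    simp only [AState.reg_setReg, if_true] at hk
    have hp' : Parameters n t s' := (hp.setReg (by norm_num)).of_frame hf (by decide)
    have e16 : s'.reg 16 = u := by
      rw [hf.reg 16 (by simp) rfl]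
      simpa using hu
    have e4 : s'.reg 4 = W := by
      rw [hf.reg 4 (by simp) rfl]
      simpa using hW
    have e3 : s'.arr 3 = s.arr 3 := hf.arr 3 rfl
    have hx : nb u k < n := hA.nb_lt hun (hd ▸ hk)
    have hR : R u (nb u k) := (hA.rel_iff u hun _).2 ⟨k, hd ▸ hk, rfl⟩
    -- No neighbour is listed twice, so every label grows by at most one.
    have hnot : ¬ ∃ k' < k, nb u k' = nb u k := by
      rintro ⟨k', hk', he⟩
      have := hA.nb_inj u hun k' (by omega) k (by omega) he
      omega
    refine (visitNeighbour_spec hE hA hp' e16 hun h21 (hd ▸ hk) e4 (N := N + k)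
      (l := fun x => l x + if ∃ k' < k, nb u k' = x then 1 else 0) (by omega) hWB hWM
      fun h => (hI.resolve_left fun h' => h'.1 h).2).frame fun c s'' hf' h => ?_
    obtain ⟨hc, h⟩ := h
    refine ⟨hc, ?_⟩
    simp only [AState.reg_setReg, if_neg (show ¬ 7 = 21 by norm_num)]
    rw [if_neg hnot, add_zero, e3] at h
    rcases h with ⟨h8, h | ⟨h9, h10⟩⟩ | ⟨h8, -, h9⟩
    · exact .inl ⟨h8, (hI.resolve_right fun h' => h h'.1).2⟩
    · exact .inl ⟨h8, nb u k, hx, hR, h9, h10⟩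
    · refine .inr ⟨h8, h9.congr le_rfl (fun v _ _ => ?_) rfl rfl rfl rfl⟩
      rw [Function.update_apply]
      by_cases hv : v = nb u k
      · subst hv
        rw [if_pos rfl, if_pos ⟨k, by omega, rfl⟩]
      · rw [if_neg hv]
        congr 2
        simp only [eq_iff_iff, Nat.exists_lt_succ_right]
        exact ⟨.inl, fun h => h.resolve_right fun h' => hv h'.symm⟩
  · intro c s' hc h21 hf hI
    simp only [AState.reg_setReg, if_true] at hc hI
    refine ⟨by omega, hI.imp id (And.imp_right fun h => h.congr le_rfl (fun v _ _ => ?_) rfl rfl rfl rfl)⟩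
    congr 2
    rw [eq_iff_iff, hA.rel_iff u hun, hd]

/-- Visits the vertex in register `16`. -/
def visit : AProg :=
  .store 4 (.reg 5) (.reg 16) ;; .assign 5 (.reg 5 +ᵃ .lit 1) ;; .store 3 (.reg 16) (.reg 5) ;;
  .assign 6 (.reg 0 -ᵃ .lit 1) ;; visitNeighbours

/-- One step of the search: a vertex is taken from the bucket with the number in register `6`; if
this bucket is empty, the search goes on to the next one. -/
def searchStep : AProg :=
  .ite (.reg 7) .skip
    (.ite (.arr 1 (.reg 6))
      (.store 1 (.reg 6) (.arr 1 (.reg 6) -ᵃ .lit 1) ;;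
        .assign 16 (.arr 2 (.reg 6 *ᵃ .reg 4 +ᵃ .arr 1 (.reg 6))) ;;
        .ite (.arr 3 (.reg 16)) .skip visit)
      (.assign 6 (.reg 6 -ᵃ .lit 1)))

/-- The state during the search, after `i` steps and at cost `c`. -/
structure SearchState (n t W : ℕ) (R : ℕ → ℕ → Prop) (off : ℕ → ℕ) (i c : ℕ) (s : AState) :
    Prop where
  order : IsSearchOrder n t R (s.reg 5) (s.arr 4) (s.arr 3)
  bucket_lt : s.reg 6 < t
  cost : c ≤ i * 15 + ∑ i ∈ Finset.range (s.reg 5), 9 * (off (s.arr 4 i + 1) - off (s.arr 4 i))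
  progress : (s.reg 7 ≠ 0 ∧ ∃ x < n, s.arr 3 x = 0 ∧ t ≤ visitedCount R (s.arr 4) (s.reg 5) x) ∨
    (s.reg 7 = 0 ∧ ∃ N < W, QueueState n t W (visitedCount R (s.arr 4) (s.reg 5)) (s.reg 6) N s ∧
      ((∀ u < n, s.arr 3 u ≠ 0) ∨ i + s.reg 6 + N ≤ t + n +
        ∑ i ∈ Finset.range (s.reg 5), (t + (off (s.arr 4 i + 1) - off (s.arr 4 i)))))

theorem _root_.IsSearchOrder.sum_degree_le {m : ℕ} {vert pos : ℕ → ℕ}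
    (h : IsSearchOrder n t R m vert pos) (hA : IsAdjacencyInput E.inp n off nb R) (a b : ℕ) :
    ∑ i ∈ Finset.range m, (a + b * (off (vert i + 1) - off (vert i))) ≤ n * a + b * off n := by
  refine (h.sum_le fun u => a + b * (off (u + 1) - off u)).trans ?_
  rw [Finset.sum_add_distrib, ← Finset.mul_sum]
  simpa using Nat.mul_le_mul_left b hA.sum_degree

/-- In `hq` the vertex `u` already counts as visited, because its entry has been popped before its
position is written. -/
theorem visit_spec (hE : E.Large n t) (hA : IsAdjacencyInput E.inp n off nb R) {s : AState}
    (hp : Parameters n t s) {u m W N j : ℕ} (hu : s.reg 16 = u) (hun : u < n) (hm : s.reg 5 = m)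
    (hW : s.reg 4 = W) (hN : N + (off (u + 1) - off u) < W) (ht : 0 < t)
    (hWB : W ≤ E.B) (hWM : t * W ≤ E.M 1) (h7 : s.reg 7 = 0) (h0 : s.arr 3 u = 0)
    (ho : IsSearchOrder n t R m (s.arr 4) (s.arr 3))
    (hmax : ∀ c < n, s.arr 3 c = 0 →
      visitedCount R (s.arr 4) m c ≤ visitedCount R (s.arr 4) m u)
    (hlt : visitedCount R (s.arr 4) m u < t)
    (hq : IsBucketQueue n t W (visitedCount R (s.arr 4) m) j N (s.arr 1) (s.arr 2)
      (Function.update (s.arr 3) u (m + 1)))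
    (hl : ∀ u < n, s.arr 3 u = 0 → s.arr 5 u = visitedCount R (s.arr 4) m u) :
    AProg.WP E visit s fun c s' => c ≤ (off (u + 1) - off u) * 9 + 7 ∧ s'.reg 5 = m + 1 ∧
      s'.reg 6 = t - 1 ∧ s'.arr 4 = Function.update (s.arr 4) m u ∧
      IsSearchOrder n t R (m + 1) (s'.arr 4) (s'.arr 3) ∧
      ((s'.reg 7 ≠ 0 ∧ ∃ x < n, s'.arr 3 x = 0 ∧ t ≤ visitedCount R (s'.arr 4) (m + 1) x) ∨
        (s'.reg 7 = 0 ∧ QueueState n t W (visitedCount R (s'.arr 4) (m + 1)) (t - 1)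
          (N + (off (u + 1) - off u)) s')) := by
  classical
  obtain ⟨h1, h2, h3, h4, h5⟩ := hE.le_B
  have ho' := ho.step hun h0 hmax hlt
  have hmn := ho'.card_le
  have hM4 : m < E.M 4 := hE.lt_M 3 hmn
  have hM3 : u < E.M 3 := hE.lt_M 2 hun
  have hcount : ∀ x, visitedCount R (s.arr 4) m x + (if R u x then 1 else 0) =
      visitedCount R (Function.update (s.arr 4) m u) (m + 1) x := by
    intro x
    rw [visitedCount_succ, Function.update_self,
      visitedCount_congr (vert := Function.update (s.arr 4) m u)
         (vert' := s.arr 4) fun i (hi : i < m) => Function.update_of_ne hi.ne _ _]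
    congr 2
    exact propext ⟨hA.symm _ _, hA.symm _ _⟩
  simp only [visit, AProg.WP_seq, AProg.WP_assign, AProg.WP_store]
  simp only [AExpr.eval, AExpr.Safe, Op.eval, AState.reg_setReg, AState.reg_setArr]
  norm_num
  simp only [hm, hu, hp.t_eq]
  refine ⟨⟨hM4, by omega⟩, by omega, ⟨hM3, by omega⟩, by omega, ?_⟩
  generalize hs₁ : (((s.setArr 4 m u).setReg 5 (m + 1)).setArr 3 u (m + 1)).setReg 6 (t - 1) = s₁
  have hp₁ : Parameters n t s₁ := by
    constructor <;> simp [← hs₁, hp.t_eq, hp.n_eq, hp.b_eq, hp.q_eq]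
  have e1 : s₁.arr 1 = s.arr 1 := by simp [← hs₁]
  have e2 : s₁.arr 2 = s.arr 2 := by simp [← hs₁]
  have e3 : s₁.arr 3 = Function.update (s.arr 3) u (m + 1) := by simp [← hs₁]
  have e4 : s₁.arr 4 = Function.update (s.arr 4) m u := by simp [← hs₁]
  have e5 : s₁.arr 5 = s.arr 5 := by simp [← hs₁]
  have hq₁ : QueueState n t W (visitedCount R (s.arr 4) m) (t - 1) N s₁ := by
    refine ⟨?_, fun v hv hv0 => ?_⟩
    · rw [e1, e2, e3]
      exact { hq with top := fun a ha haj => by omega }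
    · rw [e5]
      refine hl v hv ?_
      rw [e3, Function.update_apply] at hv0
      split_ifs at hv0 with h
      exact hv0
  refine (visitNeighbours_spec hE hA hp₁ (u := u) (by simp [← hs₁, hu]) hun (W := W)
    (by simp [← hs₁, hW]) hN hWB hWM (by simp [← hs₁, h7]) hq₁).frame fun c s' hf h => ?_
  obtain ⟨hc, h⟩ := h
  have d3 : s'.arr 3 = s₁.arr 3 := hf.arr 3 rfl
  have d4 : s'.arr 4 = s₁.arr 4 := hf.arr 4 rfl
  refine ⟨by omega, ?_, ?_, by rw [d4, e4], by rw [d3, d4, e3, e4]; exact ho', ?_⟩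
  · rw [hf.reg 5 (by simp) rfl]
    simp [← hs₁]
  · rw [hf.reg 6 (by simp) rfl]
    simp [← hs₁]
  · rw [d4, e4]
    refine h.imp ?_ ?_
    · rintro ⟨h8, x, hx, hR, hx0, hle⟩
      refine ⟨h8, x, hx, by rw [d3, hx0], ?_⟩
      rw [← hcount, if_pos hR]
      exact hle
    · rintro ⟨h8, hq⟩
      exact ⟨h8, hq.congr le_rfl (fun x _ _ => hcount x) rfl rfl rfl rfl⟩

/-- While unvisited vertices remain and the search has not failed, a step lowers the bucket number
or removes an entry, at cost `O(1)` apart from the adjacency list of a visited vertex. A visit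
resets the bucket number to `t - 1` and adds at most as many entries as the degree, and it happens
once for each vertex. So the number of steps plus the bucket number plus the number of entries obeys
the bound in `progress`. -/
theorem searchStep_spec (hE : E.Large n t) (hA : IsAdjacencyInput E.inp n off nb R) {s : AState}
    (hp : Parameters n t s) {W i c₀ : ℕ} (hW : s.reg 4 = W)
    (hWt : W = t + n + t * n + off n + 1) (hWB : W ≤ E.B) (hWM : t * W ≤ E.M 1)
    (hs : SearchState n t W R off i c₀ s) :
    AProg.WP E searchStep s fun c s' => SearchState n t W R off (i + 1) (c₀ + c + 2) s' := by
  obtain ⟨h1, h2, h3, h4, h5⟩ := hE.le_B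
  obtain ⟨ho, hj, hc, hpr⟩ := hs
  rw [searchStep, AProg.WP_ite]
  refine ⟨by simp, fun h7 => ?_, fun h7 => ?_⟩
  · replace h7 : s.reg 7 ≠ 0 := h7
    rw [AProg.WP_skip]
    exact ⟨ho, hj, by omega, .inl (hpr.resolve_right fun h => h7 h.1)⟩
  · replace h7 : s.reg 7 = 0 := h7
    obtain ⟨-, N, hNW, hq, hpr⟩ := hpr.resolve_left fun h => h.1 h7
    have ht : 0 < t := by omega
    have hMt : s.reg 6 < E.M 1 := by nlinarith
    have hsz := hq.queue.size_le hj
    rw [AProg.WP_ite]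
    refine ⟨by simpa using hMt, fun hne => ?_, fun he => ?_⟩
    · replace hne : s.arr 1 (s.reg 6) ≠ 0 := hne
      obtain ⟨k, hk⟩ := Nat.exists_eq_succ_of_ne_zero hne
      obtain ⟨u, hu⟩ : ∃ u, u = s.arr 2 (s.reg 6 * W + k) := ⟨_, rfl⟩
      have hun : u < n := by
        rw [hu]
        exact hq.queue.entry_lt _ hj k (by omega)
      have hMb : s.reg 6 * W + k < E.M 2 := by
        rw [hE.M_succ 1]
        exact (index_lt hj (by omega)).trans_le hWM
      have hM3 : u < E.M 3 := hE.lt_M 2 hun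
      have hpop := fun pos' h h' => hq.queue.pop hj (pos' := pos') hk h h'
      rw [← hu] at hpop
      simp only [AProg.WP_seq, AProg.WP_assign, AProg.WP_store]
      simp only [AExpr.eval, AExpr.Safe, Op.eval, AState.reg_setArr, AState.arr_setArr, hk, hW,
        Function.update_self, if_true, Nat.succ_sub_one]
      norm_num
      simp only [← hu]
      refine ⟨⟨hMt, by omega⟩, ⟨⟨hMt, hMb⟩, by omega⟩, hM3, fun h0 => ?_, fun h0 => ?_⟩
      · refine ⟨by simpa using ho, by simpa using hj, by simp; omega, .inr ⟨by simpa using h7,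
          N - 1, by omega, ⟨?_, ?_⟩, ?_⟩⟩
        · simpa using hpop (s.arr 3) (fun _ h => h) h0
        · simpa using hq.label
        · simpa using hpr.imp id fun h => by omega
      -- The label of an unvisited entry is at least its bucket number, and no unvisited label
      -- exceeds the number of the current bucket. So `u` has the maximum label, without any test
      -- for outdated entries.
      · have hle : s.reg 6 ≤ visitedCount R (s.arr 4) (s.reg 5) u := by
          have := hq.queue.entry_le _ hj k (by omega)
          rw [← hu] at this
          exact this h0
        have hsum := ho.sum_degree_le hA t 1
        have hpr' := hpr.resolve_left fun h => h u hun h0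
        -- The buckets have room for the neighbours: together with the term of `u`, the sum in the
        -- potential bound is at most `t * n + off n`.
        have hNW' : N - 1 + (off (u + 1) - off u) < W := by
          have := ho.step hun h0 (fun c hc hc0 => (hq.queue.label_le hc hc0).trans hle)
            (hq.queue.label_lt u hun h0)
          have := this.sum_degree_le hA t 1
          rw [Finset.sum_range_succ, Function.update_self,
            Finset.sum_congr rfl (g := fun i => t + 1 * (off (s.arr 4 i + 1) - off (s.arr 4 i)))
              fun i hi => by rw [Function.update_of_ne (Finset.mem_range.1 hi).ne]] at this
          simp only [one_mul] at this
          have hcomm := mul_comm n t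
          omega
        generalize hs₁ : (s.setArr 1 (s.reg 6) k).setReg 16 u = s₁
        have hp₁ : Parameters n t s₁ := by
          constructor <;> simp [← hs₁, hp.t_eq, hp.n_eq, hp.b_eq, hp.q_eq]
        have e1 : s₁.arr 1 = Function.update (s.arr 1) (s.reg 6) k := by simp [← hs₁]
        have e2 : s₁.arr 2 = s.arr 2 := by simp [← hs₁]
        have e3 : s₁.arr 3 = s.arr 3 := by simp [← hs₁]
        have e4 : s₁.arr 4 = s.arr 4 := by simp [← hs₁]
        have e5 : s₁.arr 5 = s.arr 5 := by simp [← hs₁]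
        refine (visit_spec hE hA hp₁ (u := u) (m := s.reg 5) (j := s.reg 6) (by simp [← hs₁]) hun
          (by simp [← hs₁]) (by simp [← hs₁, hW]) hNW' ht hWB hWM (by simp [← hs₁, h7])
          (by rw [e3, h0]) (by rw [e3, e4]; exact ho) (fun c hc hc0 => ?_) ?_ ?_ ?_).mono
          fun c s' h => ?_
        · rw [e3] at hc0
          rw [e4]
          exact (hq.queue.label_le hc hc0).trans hle
        · rw [e4]
          exact hq.queue.label_lt u hun h0
        · rw [e1, e2, e3, e4]
          refine hpop _ (fun c hc => ?_) (by simp)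
          rw [Function.update_apply] at hc
          split_ifs at hc with h
          exact hc
        · rw [e3, e4, e5]
          exact hq.label
        · obtain ⟨hc', d5, d6, d4, ho', h⟩ := h
          rw [e4] at d4
          have hupd : ∀ i < s.reg 5, s'.arr 4 i = s.arr 4 i := fun i hi => by
            rw [d4, Function.update_of_ne hi.ne]
          have hupd' : s'.arr 4 (s.reg 5) = u := by rw [d4, Function.update_self]
          have hsums : ∀ a b, ∑ i ∈ Finset.range (s.reg 5),
              (a + b * (off (s'.arr 4 i + 1) - off (s'.arr 4 i))) = ∑ i ∈ Finset.range (s.reg 5),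
              (a + b * (off (s.arr 4 i + 1) - off (s.arr 4 i))) := fun a b =>
            Finset.sum_congr rfl fun i hi => by rw [hupd i (Finset.mem_range.1 hi)]
          have hsums1 := hsums t 1
          have hsums9 := hsums 0 9
          simp only [one_mul, zero_add] at hsums1 hsums9
          refine ⟨by rw [d5]; exact ho', by omega, ?_, ?_⟩
          · rw [d5, Finset.sum_range_succ, hsums9, hupd']
            omega
          · rw [d5, d6]
            refine h.imp id ?_
            rintro ⟨h8, hq'⟩
            refine ⟨h8, _, hNW', hq', .inr ?_⟩
            rw [Finset.sum_range_succ, hsums1, hupd']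
            omega
    · replace he : s.arr 1 (s.reg 6) = 0 := he
      rw [AProg.WP_assign]
      simp only [AExpr.eval, AExpr.Safe, Op.eval]
      refine ⟨⟨by simp, by omega⟩, by simpa using ho, by simp; omega, by simp; omega,
        .inr ⟨by simpa using h7, N, hNW, ⟨by simpa using hq.queue.down he, by simpa using hq.label⟩,
        ?_⟩⟩
      simp only [AState.arr_setReg, AState.reg_setReg]
      norm_num
      -- At bucket `0` the number cannot be lowered, but then that bucket and all higher ones are
      -- empty, and every vertex has been visited.
      by_cases hj0 : s.reg 6 = 0
      · refine .inl fun u hu h0 => ?_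
        obtain ⟨k, hk, -⟩ := hq.queue.mem u hu h0
        have := hq.queue.label_le hu h0
        rw [show visitedCount R (s.arr 4) (s.reg 5) u = s.reg 6 by omega, he] at hk
        omega
      · exact hpr.imp id fun h => by omega

/-- Maximum cardinality search. Afterwards register `7` is zero if all vertices have been visited,
and one if a vertex with `t` visited neighbours has been found. -/
def search : AProg :=
  .assign 4 (.reg 0 +ᵃ .reg 1 +ᵃ .reg 0 *ᵃ .reg 1 +ᵃ .input (.reg 1 +ᵃ .lit 2) +ᵃ .lit 1) ;;
  .loop 21 1 (.store 2 (.reg 21) (.reg 21)) ;; .store 1 (.lit 0) (.reg 1) ;;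
  .assign 5 (.lit 0) ;; .assign 6 (.reg 0 -ᵃ .lit 1) ;; .assign 7 (.lit 0) ;;
  .loop 18 4 searchStep

theorem search_spec (hE : E.Large n t) (hA : IsAdjacencyInput E.inp n off nb R) {s : AState}
    (hp : Parameters n t s) (ht : 0 < t) (hn : 0 < n) (hoff : off n ≤ 2 * (t * n))
    (h1 : ∀ i, s.arr 1 i = 0) (h3 : ∀ i, s.arr 3 i = 0) (h5 : ∀ i, s.arr 5 i = 0) :
    AProg.WP E search s fun c s' =>
      c ≤ 15 * (t + n + t * n + off n + 1) + 9 * off n + n * 3 + 9 ∧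
      ((s'.reg 7 ≠ 0 ∧ ∃ m, IsSearchOrder n t R m (s'.arr 4) (s'.arr 3) ∧
        ∃ x < n, s'.arr 3 x = 0 ∧ t ≤ visitedCount R (s'.arr 4) m x) ∨
      (s'.reg 7 = 0 ∧ IsSearchOrder n t R n (s'.arr 4) (s'.arr 3))) := by
  obtain ⟨b1, b2, b3, b4, b5⟩ := hE.le_B
  -- One more than the largest possible potential: it serves as the number of rounds and as the
  -- capacity of a bucket.
  obtain ⟨W, hW⟩ : ∃ W, W = t + n + t * n + off n + 1 := ⟨_, rfl⟩
  have hWt : W ≤ t + n + 3 * (t * n) + 1 := by omega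
  have hWB : W ≤ E.B := by
    have := hE.B_n
    nlinarith
  have hWM : t * W ≤ E.M 1 := (Nat.mul_le_mul_left t (by omega)).trans hE.M_W
  have hM1 : 0 < E.M 1 := hE.lt_M 0 hn
  have hev : AExpr.eval E s (.reg 0 +ᵃ .reg 1 +ᵃ .reg 0 *ᵃ .reg 1 +ᵃ .input (.reg 1 +ᵃ .lit 2) +ᵃ
      .lit 1) = W := by
    simp only [AExpr.eval, Op.eval, hp.t_eq, hp.n_eq, hA.inp_off n le_rfl, hW]
  rw [← hW, search, AProg.WP_seq, AProg.WP_assign, hev, AProg.WP_seq]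
  refine ⟨⟨by simp, hWB⟩, ?_⟩
  refine AProg.WP_loop 1 (fun i s' => ∀ k < i, s'.arr 2 k = k) rfl rfl (by norm_num) (by simp) ?_ ?_
  · intro i s' hi h6 h7 hf h8
    simp [hp.n_eq] at hi
    have hM : i < E.M 2 := hE.lt_M 1 hi
    rw [AProg.WP_store]
    simp only [AExpr.eval, AExpr.Safe, h6, AState.arr_setReg, AState.arr_setArr, if_true]
    refine ⟨⟨trivial, trivial, hM, by omega⟩, le_rfl, fun k hk => ?_⟩
    rw [Function.update_apply]
    split_ifs with h
    · exact h.symm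
    · exact h8 k (by omega)
  · intro c s' hc h6 hf h7
    simp [hp.n_eq] at hc h7
    have e0 : s'.reg 0 = t := by simpa [hp.t_eq] using hf.reg 0 (by simp) rfl
    have e1 : s'.reg 1 = n := by simpa [hp.n_eq] using hf.reg 1 (by simp) rfl
    have e4 : s'.reg 4 = W := by simpa using hf.reg 4 (by simp) rfl
    have d1 : ∀ i, s'.arr 1 i = 0 := fun i => by rw [hf.arr 1 rfl]; exact h1 i
    have d3 : ∀ i, s'.arr 3 i = 0 := fun i => by rw [hf.arr 3 rfl]; exact h3 i
    have d5 : ∀ i, s'.arr 5 i = 0 := fun i => by rw [hf.arr 5 rfl]; exact h5 i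
    have hp' : Parameters n t s' := (hp.setReg (by norm_num)).of_frame hf (by decide)
    rw [AProg.WP_seq, AProg.WP_store, AProg.WP_seq, AProg.WP_assign, AProg.WP_seq,
      AProg.WP_assign, AProg.WP_seq, AProg.WP_assign]
    simp only [AExpr.eval, AExpr.Safe, Op.eval, AState.reg_setReg, AState.reg_setArr, e0, e1]
    norm_num
    refine ⟨⟨hM1, by omega⟩, by omega, ?_⟩
    refine AProg.WP_loop_cost (SearchState n t W R off) rfl rfl (by norm_num) ?_ ?_ ?_
    · have hsz : ∀ a, Function.update (s'.arr 1) 0 n a = if a = 0 then n else 0 := fun a => by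
        rw [Function.update_apply]
        split_ifs
        · rfl
        · exact d1 a
      refine ⟨?_, by simp; omega, by simp, .inr ⟨by simp, n, by omega, ⟨?_, ?_⟩, ?_⟩⟩
      · constructor <;> simp [d3]
      · simp only [AState.arr_setReg, AState.arr_setArr, AState.reg_setReg]
        norm_num
        refine ⟨fun u _ _ => by simpa using ht, fun u hu _ => ⟨u, ?_, ?_⟩,
          fun a ha k hk => ?_, fun a ha k hk _ => ?_, fun a ha haj => ?_, ?_⟩
        · rw [hsz]
          simpa using hu
        · simpa using h7 u hu
        · rw [hsz] at hk
          split_ifs at hk with h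
          · simpa [h, h7 k hk] using hk
          · omega
        · rw [hsz] at hk
          split_ifs at hk with h
          · omega
          · omega
        · rw [hsz, if_neg (by omega)]
        · simp [hsz, ht]
      · simp [d5]
      · right
        simp
    · intro i c s₁ hi h18 h4 hf₁ hI
      have f4 : s₁.reg 4 = W := by
        rw [hf₁.reg 4 (by simp) rfl]
        simpa using e4
      have hp₁ : Parameters n t s₁ := by
        have hp₀ : Parameters n t (s'.setArr 1 0 n) :=
          ⟨by simp [e0], by simp [e1], by simp [hp'.b_eq], by simp [hp'.q_eq]⟩
        exact (((hp₀.setReg (by norm_num)).setReg (by norm_num)).setReg (by norm_num)).of_frame hf₁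
          (by decide)
      refine (searchStep_spec hE hA hp₁ f4 hW hWB hWM hI).mono fun c' s₂ h => ?_
      exact ⟨by simpa using h.order, by simpa using h.bucket_lt, by simpa using h.cost,
        h.progress.imp (by simp) (by
          rintro ⟨a, N, b, ⟨q1, q2⟩, d⟩
          exact ⟨by simpa using a, N, b, ⟨by simpa using q1, by simpa using q2⟩, by simpa using d⟩)⟩
    · intro c' s₂ h18 hf₂ hI
      simp [e4] at hI
      have hc' := hI.cost
      have hcs := hI.order.sum_degree_le hA 0 9
      simp only [zero_add] at hcs
      refine ⟨by omega, ?_⟩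
      refine hI.progress.imp ?_ ?_
      · rintro ⟨h8, x, hx, h9, h10⟩
        exact ⟨h8, _, hI.order, x, hx, h9, h10⟩
      · rintro ⟨h8, N, hN, -, h⟩
        refine ⟨h8, ?_⟩
        have hcs' := hI.order.sum_degree_le hA t 1
        simp only [one_mul] at hcs'
        rw [mul_comm n t] at hcs'
        -- After `W` rounds the potential bound is violated, so every vertex has been visited.
        have hall := h.resolve_right (by omega)
        have hm := hI.order.eq_of_forall hall
        have ho := hI.order
        rwa [hm] at ho

end ArrayMachine

/-! ### Parents, colours and bags on the machine -/

namespace ArrayMachine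

open WordRAM (Op)

variable {E : Env} {n t : ℕ} {off : ℕ → ℕ} {nb : ℕ → ℕ → ℕ} {R : ℕ → ℕ → Prop}

/-- The vertex `v` with the set `T` of smaller neighbours: the array `6` holds the maximum of `T`, or
zero, and the array `8` the colours of `T`. -/
structure BagState (t v : ℕ) (T : ℕ → Prop) (s : AState) : Prop where
  lt : ∀ y, T y → y < v
  le_par : ∀ y, T y → y ≤ s.arr 6 v
  par_mem : s.arr 6 v = 0 ∨ T (s.arr 6 v)
  cs_eq_one : ∀ d < t + 2, (∃ y, T y ∧ s.arr 7 y = d) → s.arr 8 (v * (t + 2) + d) = 1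
  cs_eq_zero : ∀ d < t + 2, ¬ (∃ y, T y ∧ s.arr 7 y = d) → s.arr 8 (v * (t + 2) + d) = 0

/-- The arrays `6` and `8` are the same in `s` and `s'`, apart from the entries for the vertex `v`. -/
structure SameBags (t v : ℕ) (s s' : AState) : Prop where
  par_eq : ∀ v', v' ≠ v → s'.arr 6 v' = s.arr 6 v'
  cs_eq : ∀ v', v' ≠ v → ∀ d < t + 2, s'.arr 8 (v' * (t + 2) + d) = s.arr 8 (v' * (t + 2) + d)

/-- Processes the neighbour with the number in register `21` of the vertex in register `16`, which
has the position in register `8`. -/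
def bagNeighbour : AProg :=
  .assign 17 (.input (.reg 1 +ᵃ .lit 3 +ᵃ .input (.reg 16 +ᵃ .lit 2) +ᵃ .reg 21)) ;;
  .assign 17 (.arr 3 (.reg 17) -ᵃ .lit 1) ;;
  .ite (.reg 17 <ᵃ .reg 8)
    (.store 8 (.reg 8 *ᵃ .reg 2 +ᵃ .arr 7 (.reg 17)) (.lit 1) ;;
      .ite (.arr 6 (.reg 8) <ᵃ .reg 17) (.store 6 (.reg 8) (.reg 17)) .skip)
    .skip

theorem bagNeighbour_spec (hE : E.Large n t) (hA : IsAdjacencyInput E.inp n off nb R) {s : AState}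
    (hp : Parameters n t s) {u k v y : ℕ} (hu : s.reg 16 = u) (hun : u < n)
    (hk : s.reg 21 = k) (hkd : k < off (u + 1) - off u) (hv : s.reg 8 = v) (hvn : v < n)
    (hy : s.arr 3 (nb u k) = y + 1) (hyn : y < n) (hcol : y < v → s.arr 7 y < t + 2)
    {T : ℕ → Prop} (hT : BagState t v T s) :
    AProg.WP E bagNeighbour s fun c s' => c ≤ 6 ∧
      BagState t v (fun z => T z ∨ (z = y ∧ y < v)) s' ∧ SameBags t v s s' := by
  obtain ⟨h1, h2, h3, h4, h5⟩ := hE.le_B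
  have hx := hA.nb_lt hun hkd
  have hin := hA.inp_nb u hun k hkd
  have hio := hA.inp_off u hun.le
  have hM3 : nb u k < E.M 3 := hE.lt_M 2 hx
  have hM6 : v < E.M 6 := hE.lt_M 5 hvn
  have hM7 : y < E.M 7 := hE.lt_M 6 hyn
  have hev : AExpr.eval E s (.input (.reg 1 +ᵃ .lit 3 +ᵃ .input (.reg 16 +ᵃ .lit 2) +ᵃ .reg 21)) =
      nb u k := by
    simp only [AExpr.eval, Op.eval, hp.n_eq, hu, hk, hio, hin]
  have hev' : AExpr.eval E (s.setReg 17 (nb u k)) (.arr 3 (.reg 17) -ᵃ .lit 1) = y := by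
    simp [hy]
  rw [bagNeighbour, AProg.WP_seq, AProg.WP_assign, hev, AProg.WP_seq, AProg.WP_assign, hev']
  refine ⟨⟨by simp, by omega⟩, ⟨by simpa using hM3, by omega⟩, ?_⟩
  rw [AProg.WP_ite]
  refine ⟨by simp, fun h => ?_, fun h => ?_⟩
  · replace h : y < v := by
      by_contra h'
      simp [hv, h'] at h
    have hc := hcol h
    have hM8 : v * (t + 2) + s.arr 7 y < E.M 8 := by
      rw [hE.M_succ 7]
      exact (index_lt hvn hc).trans_le hE.M_b
    have hcs : ∀ v' d w, v' ≠ v → d < t + 2 →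
        Function.update (s.arr 8) (v * (t + 2) + s.arr 7 y) w (v' * (t + 2) + d) =
          s.arr 8 (v' * (t + 2) + d) := fun v' d w hne hd =>
      Function.update_of_ne (fun he => hne (index_inj hd hc he).1) _ _
    have hpar : s.arr 6 v ≤ max (s.arr 6 v) y ∧ y ≤ max (s.arr 6 v) y := by omega
    have key : ∀ s' : AState, s'.arr 6 = Function.update (s.arr 6) v (max (s.arr 6 v) y) →
        s'.arr 7 = s.arr 7 →
        s'.arr 8 = Function.update (s.arr 8) (v * (t + 2) + s.arr 7 y) 1 →
        BagState t v (fun z => T z ∨ (z = y ∧ y < v)) s' ∧ SameBags t v s s' := by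
      intro s' e6 e7 e8
      refine ⟨⟨?_, ?_, ?_, ?_, ?_⟩, ⟨?_, ?_⟩⟩
      · rintro z (hz | ⟨rfl, -⟩)
        exacts [hT.lt z hz, h]
      · rw [e6, Function.update_self]
        rintro z (hz | ⟨rfl, -⟩)
        · exact (hT.le_par z hz).trans hpar.1
        · exact hpar.2
      · rw [e6, Function.update_self]
        rcases le_total (s.arr 6 v) y with hle | hle
        · rw [max_eq_right hle]
          exact .inr (.inr ⟨rfl, h⟩)
        · rw [max_eq_left hle]
          exact hT.par_mem.imp id .inl
      · rintro d hd ⟨z, hz, he⟩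
        rw [e7] at he
        rw [e8, Function.update_apply]
        split_ifs with hidx
        · rfl
        · refine hT.cs_eq_one d hd ⟨z, hz.resolve_right ?_, he⟩
          rintro ⟨rfl, -⟩
          exact hidx (by rw [he])
      · intro d hd hno
        rw [e7] at hno
        rw [e8, Function.update_of_ne]
        · exact hT.cs_eq_zero d hd fun ⟨z, hz, he⟩ => hno ⟨z, .inl hz, he⟩
        · intro he
          exact hno ⟨y, .inr ⟨rfl, h⟩, (index_inj hd hc he).2.symm⟩
      · intro v' hv'
        rw [e6, Function.update_of_ne hv']
      · intro v' hv' d hd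
        rw [e8, hcs v' d 1 hv' hd]
    simp only [AProg.WP_seq, AProg.WP_store, AProg.WP_ite, AProg.WP_skip]
    simp only [AExpr.eval, AExpr.Safe, Op.eval, AState.reg_setReg, AState.arr_setReg,
      AState.reg_setArr, AState.arr_setArr]
    norm_num
    simp only [hv, hp.b_eq]
    refine ⟨⟨hM7, hM8, by omega⟩, hM6, fun hlt => ?_, fun hle => ?_⟩
    · exact ⟨⟨hM6, by omega⟩, key _ (by simp [max_eq_right hlt.le]) (by simp) (by simp)⟩
    · exact key _ (by simp [max_eq_left hle]) (by simp) (by simp)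
  · replace h : ¬ y < v := by
      intro h'
      simp [hv, h'] at h
    rw [AProg.WP_skip]
    have hiff : ∀ z, (T z ∨ (z = y ∧ y < v)) = T z := fun z => by simp [h]
    simp only [hiff]
    exact ⟨by omega, ⟨hT.1, hT.2, hT.3, hT.4, hT.5⟩, ⟨fun _ _ => rfl, fun _ _ _ _ => rfl⟩⟩

/-- Gives the vertex in register `8` a colour that none of its smaller neighbours has. -/
def colour : AProg :=
  .assign 23 (.lit 0) ;;
  .loop 21 0 (.ite (.arr 8 (.reg 8 *ᵃ .reg 2 +ᵃ (.reg 21 +ᵃ .lit 2))) .skip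
    (.assign 23 (.reg 21 +ᵃ .lit 2))) ;;
  .store 7 (.reg 8) (.reg 23) ;; .store 8 (.reg 8 *ᵃ .reg 2 +ᵃ .reg 23) (.lit 1)

theorem colour_spec (hE : E.Large n t) {s : AState} (hp : Parameters n t s) {v : ℕ}
    (hv : s.reg 8 = v) (hvn : v < n)
    (hex : ∃ d, 2 ≤ d ∧ d < t + 2 ∧ s.arr 8 (v * (t + 2) + d) = 0) :
    AProg.WP E colour s fun c s' => c ≤ t * 4 + 5 ∧
      ∃ d, 2 ≤ d ∧ d < t + 2 ∧ s.arr 8 (v * (t + 2) + d) = 0 ∧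
        s'.arr 7 = Function.update (s.arr 7) v d ∧
        s'.arr 8 = Function.update (s.arr 8) (v * (t + 2) + d) 1 := by
  obtain ⟨h1, h2, h3, h4, h5⟩ := hE.le_B
  have hM7 : v < E.M 7 := hE.lt_M 6 hvn
  have hM8 : ∀ d < t + 2, v * (t + 2) + d < E.M 8 := fun d hd => by
    rw [hE.M_succ 7]
    exact (index_lt hvn hd).trans_le hE.M_b
  rw [colour, AProg.WP_seq, AProg.WP_assign, AProg.WP_seq]
  refine ⟨⟨by simp, by simp⟩, ?_⟩
  refine AProg.WP_loop 2 (fun i s' => (∀ d, 2 ≤ d → d < i + 2 → s.arr 8 (v * (t + 2) + d) ≠ 0) ∨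
    (2 ≤ s'.reg 23 ∧ s'.reg 23 < t + 2 ∧ s.arr 8 (v * (t + 2) + s'.reg 23) = 0))
    rfl rfl (by norm_num) (.inl fun d hd hd' => by omega) ?_ ?_
  · intro i s' hi h21 h0 hf hI
    simp [hp.t_eq] at hi
    have e2 : s'.reg 2 = t + 2 := by simpa [hp.b_eq] using hf.reg 2 (by simp) rfl
    have e8 : s'.reg 8 = v := by simpa [hv] using hf.reg 8 (by simp) rfl
    have a8 : s'.arr 8 = s.arr 8 := by simpa using hf.arr 8 rfl
    have hM := hM8 (i + 2) (by omega)
    simp only [AProg.WP_ite, AProg.WP_assign, AProg.WP_skip]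
    simp only [AExpr.eval, AExpr.Safe, Op.eval, AState.reg_setReg, e2, e8, h21, a8]
    norm_num
    refine ⟨hM, fun hne => ?_, fun he => ⟨by omega, .inr ⟨hi, he⟩⟩⟩
    refine hI.imp (fun h d hd hd' => ?_) id
    by_cases hdi : d = i + 2
    · rwa [hdi]
    · exact h d hd (by omega)
  · intro c s' hc h21 hf hI
    simp [hp.t_eq] at hc hI
    have e2 : s'.reg 2 = t + 2 := by simpa [hp.b_eq] using hf.reg 2 (by simp) rfl
    have e8 : s'.reg 8 = v := by simpa [hv] using hf.reg 8 (by simp) rfl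
    have a7 : s'.arr 7 = s.arr 7 := by simpa using hf.arr 7 rfl
    have a8 : s'.arr 8 = s.arr 8 := by simpa using hf.arr 8 rfl
    obtain ⟨d, hd, hdt, hd0⟩ := hex
    obtain ⟨b1, b2, b3⟩ := hI.resolve_left fun h => h d hd hdt hd0
    have hM := hM8 _ b2
    simp only [AProg.WP_seq, AProg.WP_store]
    simp only [AExpr.eval, AExpr.Safe, Op.eval, AState.reg_setArr, e2, e8]
    norm_num
    exact ⟨⟨hM7, by omega⟩, ⟨hM, by omega⟩, by omega, s'.reg 23, b1, b2, b3, by rw [a7], by rw [a8]⟩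

/-- The vertex `v` with the set `T` of smaller neighbours has been coloured: the array `7` holds the
colours. -/
structure BagDone (t v : ℕ) (T : ℕ → Prop) (s : AState) : Prop where
  le_par : ∀ y, T y → y ≤ s.arr 6 v
  par_mem : s.arr 6 v = 0 ∨ T (s.arr 6 v)
  two_le_col : 2 ≤ s.arr 7 v
  col_lt : s.arr 7 v < t + 2
  col_ne : ∀ y, T y → s.arr 7 y ≠ s.arr 7 v
  cs_eq_one : ∀ d < t + 2, (d = s.arr 7 v ∨ ∃ y, T y ∧ s.arr 7 y = d) →
    s.arr 8 (v * (t + 2) + d) = 1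
  cs_eq_zero : ∀ d < t + 2, ¬ (d = s.arr 7 v ∨ ∃ y, T y ∧ s.arr 7 y = d) →
    s.arr 8 (v * (t + 2) + d) = 0

theorem BagDone.congr {v : ℕ} {T : ℕ → Prop} {s s' : AState} (h : BagDone t v T s)
    (hT : ∀ y, T y → y < v) (h6 : s'.arr 6 v = s.arr 6 v) (h7 : ∀ y ≤ v, s'.arr 7 y = s.arr 7 y)
    (h8 : ∀ d < t + 2, s'.arr 8 (v * (t + 2) + d) = s.arr 8 (v * (t + 2) + d)) :
    BagDone t v T s' := by
  have hiff : ∀ d, (∃ y, T y ∧ s'.arr 7 y = d) ↔ ∃ y, T y ∧ s.arr 7 y = d := fun d =>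
    exists_congr fun y => and_congr_right fun hy => by rw [h7 y (hT y hy).le]
  refine ⟨?_, ?_, ?_, ?_, fun y hy => ?_, fun d hd => ?_, fun d hd => ?_⟩
  · rw [h6]
    exact h.le_par
  · rw [h6]
    exact h.par_mem
  · rw [h7 v le_rfl]
    exact h.two_le_col
  · rw [h7 v le_rfl]
    exact h.col_lt
  · rw [h7 v le_rfl, h7 y (hT y hy).le]
    exact h.col_ne y hy
  · rw [h7 v le_rfl, hiff, h8 d hd]
    exact h.cs_eq_one d hd
  · rw [h7 v le_rfl, hiff, h8 d hd]
    exact h.cs_eq_zero d hd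

theorem BagState.done {v : ℕ} {T : ℕ → Prop} {s s' : AState} (h : BagState t v T s) {d : ℕ}
    (h2 : 2 ≤ d) (hdt : d < t + 2) (hd : s.arr 8 (v * (t + 2) + d) = 0)
    (h6 : s'.arr 6 = s.arr 6) (h7 : s'.arr 7 = Function.update (s.arr 7) v d)
    (h8 : s'.arr 8 = Function.update (s.arr 8) (v * (t + 2) + d) 1) : BagDone t v T s' := by
  have hv : s'.arr 7 v = d := by rw [h7, Function.update_self]
  have hne : ∀ y, T y → s'.arr 7 y = s.arr 7 y := fun y hy => by
    rw [h7, Function.update_of_ne (h.lt y hy).ne]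
  have hiff : ∀ d, (∃ y, T y ∧ s'.arr 7 y = d) ↔ ∃ y, T y ∧ s.arr 7 y = d := fun d =>
    exists_congr fun y => and_congr_right fun hy => by rw [hne y hy]
  refine ⟨by rw [h6]; exact h.le_par, by rw [h6]; exact h.par_mem, by rwa [hv], by rwa [hv],
    fun y hy he => ?_, fun d' hd' hor => ?_, fun d' hd' hor => ?_⟩
  · rw [hv, hne y hy] at he
    have := h.cs_eq_one d hdt ⟨y, hy, he⟩
    omega
  · rw [hv, hiff] at hor
    rw [h8, Function.update_apply]
    split_ifs with hidx
    · rfl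
    · exact h.cs_eq_one d' hd' (hor.resolve_left fun h => hidx (by rw [h]))
  · rw [hv, hiff] at hor
    rw [h8, Function.update_of_ne]
    · exact h.cs_eq_zero d' hd' fun h => hor (.inr h)
    · exact fun he => hor (.inl (index_inj hd' hdt he).2)

/-- Processes the neighbours of the vertex in register `8`. -/
def bagNeighbours : AProg :=
  .assign 16 (.arr 4 (.reg 8)) ;;
  .assign 20 (.input (.reg 16 +ᵃ .lit 3) -ᵃ .input (.reg 16 +ᵃ .lit 2)) ;;
  .loop 21 20 bagNeighbour

/-- An injective map of `0, …, n - 1` into itself is surjective. -/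
theorem _root_.IsSearchOrder.pos_ne_zero {vert pos : ℕ → ℕ} (h : IsSearchOrder n t R n vert pos)
    {u : ℕ} (hu : u < n) : ∃ y < n, pos u = y + 1 ∧ vert y = u := by
  have himage : (Finset.range n).image vert = Finset.range n := by
    refine Finset.eq_of_subset_of_card_le (fun u hu => ?_) ?_
    · obtain ⟨i, hi, rfl⟩ := Finset.mem_image.1 hu
      exact Finset.mem_range.2 (h.vert_lt i (Finset.mem_range.1 hi))
    · rw [Finset.card_image_of_injOn]
      intro i hi i' hi' he
      exact h.vert_inj (by simpa using hi) (by simpa using hi') he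
  rw [← Finset.mem_range, ← himage] at hu
  obtain ⟨y, hy, rfl⟩ := Finset.mem_image.1 hu
  rw [Finset.mem_range] at hy
  exact ⟨y, hy, h.pos_vert y hy, rfl⟩

theorem bagNeighbours_spec (hE : E.Large n t) (hA : IsAdjacencyInput E.inp n off nb R) {s : AState}
    (hp : Parameters n t s) (hoff : off n ≤ 2 * (t * n)) {vert : ℕ → ℕ} (hvert : s.arr 4 = vert)
    (ho : IsSearchOrder n t R n vert (s.arr 3)) {v : ℕ} (hv : s.reg 8 = v) (hvn : v < n)
    (hcol : ∀ y < v, s.arr 7 y < t + 2) (h6 : s.arr 6 v = 0)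
    (h8 : ∀ d < t + 2, s.arr 8 (v * (t + 2) + d) = 0) :
    AProg.WP E bagNeighbours s fun c s' => c ≤ 8 * (off (vert v + 1) - off (vert v)) + 4 ∧
      BagState t v (fun y => y < v ∧ R (vert y) (vert v)) s' ∧ SameBags t v s s' := by
  obtain ⟨h1, h2, h3, h4, h5⟩ := hE.le_B
  have hvv := ho.vert_lt v hvn
  have hoffB : off (vert v + 1) - off (vert v) ≤ E.B := by
    have h1 := hE.B_n
    have h2 := hA.off_mono (show vert v + 1 ≤ n by omega) le_rfl
    have h3 : 2 * (t * n) ≤ 4 * (n + 1) * (t + 2) := by nlinarith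
    omega
  have hM4 : v < E.M 4 := hE.lt_M 3 hvn
  obtain ⟨u, hu⟩ : ∃ u, u = vert v := ⟨_, rfl⟩
  rw [← hu] at hvv hoffB ⊢
  have hio := hA.inp_off u hvv.le
  have hio' := hA.inp_off (u + 1) hvv
  have hev : AExpr.eval E s (.arr 4 (.reg 8)) = u := by simp [hv, hvert, hu]
  have hev' : AExpr.eval E (s.setReg 16 u)
      (.input (.reg 16 +ᵃ .lit 3) -ᵃ .input (.reg 16 +ᵃ .lit 2)) = off (u + 1) - off u := by
    simp only [AExpr.eval, Op.eval, AState.reg_setReg, if_true, hio]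
    rw [show u + 3 = u + 1 + 2 by ring, hio']
  rw [bagNeighbours, AProg.WP_seq, AProg.WP_assign, hev, AProg.WP_seq, AProg.WP_assign, hev']
  refine ⟨⟨by simpa [hv] using hM4, by omega⟩, ⟨by simp, hoffB⟩, ?_⟩
  refine AProg.WP_loop 6 (fun k s' =>
    BagState t v (fun y => y < v ∧ ∃ k' < k, nb u k' = vert y) s' ∧ SameBags t v s s')
    rfl rfl (by norm_num) ?_ ?_ ?_
  · exact ⟨⟨by simp, by simp, .inl (by simpa using h6), by simp, by simpa using h8⟩,
      ⟨fun _ _ => by simp, fun _ _ _ _ => by simp⟩⟩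
  · rintro k s' hk h21 h20 hf ⟨hB, hS⟩
    simp only [AState.reg_setReg, if_true] at hk
    have hp' : Parameters n t s' := ((hp.setReg (by norm_num)).setReg (by norm_num)).of_frame hf
      (by decide)
    have e16 : s'.reg 16 = u := by
      rw [hf.reg 16 (by simp) rfl]
      simp
    have e8 : s'.reg 8 = v := by
      rw [hf.reg 8 (by simp) rfl]
      simpa using hv
    have e3 : s'.arr 3 = s.arr 3 := hf.arr 3 rfl
    have e7 : s'.arr 7 = s.arr 7 := hf.arr 7 rfl
    obtain ⟨y, hyn, hy, hvy⟩ := ho.pos_ne_zero (hA.nb_lt hvv hk)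
    refine (bagNeighbour_spec hE hA hp' e16 hvv h21 hk e8 hvn (by rw [e3, hy]) hyn
      (fun h => by rw [e7]; exact hcol y h) hB).mono fun c s'' h => ?_
    obtain ⟨hc, hB', hS'⟩ := h
    refine ⟨hc, ?_, ⟨fun v' hv' => ?_, fun v' hv' d hd => ?_⟩⟩
    · have : (fun y => y < v ∧ ∃ k' < k + 1, nb u k' = vert y) =
          fun z => (z < v ∧ ∃ k' < k, nb u k' = vert z) ∨ (z = y ∧ y < v) := by
        funext z
        simp only [eq_iff_iff, Nat.exists_lt_succ_right]
        constructor
        · rintro ⟨hz, h | h⟩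
          · exact .inl ⟨hz, h⟩
          · rw [← hvy] at h
            have := ho.vert_inj hyn (by omega) h
            exact .inr ⟨this.symm, by omega⟩
        · rintro (⟨hz, h⟩ | ⟨rfl, h⟩)
          · exact ⟨hz, .inl h⟩
          · exact ⟨h, .inr hvy.symm⟩
      rw [this]
      exact ⟨hB'.1, by simpa using hB'.2, by simpa using hB'.3, by simpa using hB'.4,
        by simpa using hB'.5⟩
    · simp [hS'.par_eq v' hv', hS.par_eq v' hv']
    · simp [hS'.cs_eq v' hv' d hd, hS.cs_eq v' hv' d hd]
  · rintro c s' hc h21 hf ⟨hB, hS⟩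
    simp only [AState.reg_setReg, if_true] at hc hB
    refine ⟨by omega, ?_, hS⟩
    convert hB using 4 with y
    exact ⟨fun h => (hA.rel_iff u hvv _).1 (hA.symm _ _ h),
      fun h => hA.symm _ _ ((hA.rel_iff u hvv _).2 h)⟩

/-- Computes the parent, the colour and the colours in the bag of every vertex. -/
def bags : AProg := .loop 8 1 (bagNeighbours ;; colour)

/-- A vertex without smaller neighbours keeps the default parent `0`, which joins the bags of all
components into one tree. Nothing remains when such a vertex is forgotten, so its merge imposes no
condition. -/
theorem bags_spec (hE : E.Large n t) (hA : IsAdjacencyInput E.inp n off nb R) {s : AState}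
    (hp : Parameters n t s) (hoff : off n ≤ 2 * (t * n)) {vert : ℕ → ℕ} (hvert : s.arr 4 = vert)
    (ho : IsSearchOrder n t R n vert (s.arr 3)) (h6 : ∀ i, s.arr 6 i = 0) (h8 : ∀ i, s.arr 8 i = 0)
    (hcl : ∀ u u' v, v < n → u < v → u' < v → u ≠ u' → R (vert u) (vert v) →
      R (vert u') (vert v) → R (vert u) (vert u')) :
    AProg.WP E bags s fun c s' => c ≤ n * (t * 4 + 12) + 8 * off n + 2 ∧
      (∀ v < n, s'.arr 6 v < n) ∧
      IsElimination n t (fun u v => R (vert u) (vert v)) (s'.arr 6) (s'.arr 7)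
        (fun v d => s'.arr 8 (v * (t + 2) + d)) := by
  refine AProg.WP_loop_cost (fun i c s' =>
    c ≤ i * (t * 4 + 12) + ∑ v ∈ Finset.range i, (0 + 8 * (off (vert v + 1) - off (vert v))) ∧
    (∀ v < i, BagDone t v (fun u => u < v ∧ R (vert u) (vert v)) s') ∧
    (∀ v, i ≤ v → v < n → s'.arr 6 v = 0 ∧ ∀ d < t + 2, s'.arr 8 (v * (t + 2) + d) = 0))
    rfl rfl (by norm_num) ?_ ?_ ?_
  · simp [h6, h8]
  · rintro v c₀ s₁ hv e8 e1 hf ⟨hc₀, hold, hnew⟩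
    rw [hp.n_eq] at hv
    have hp₁ : Parameters n t s₁ := hp.of_frame hf (by decide)
    have a3 : s₁.arr 3 = s.arr 3 := hf.arr 3 rfl
    have a4 : s₁.arr 4 = vert := by rw [hf.arr 4 rfl, hvert]
    rw [AProg.WP_seq]
    refine (bagNeighbours_spec hE hA hp₁ hoff a4 (by rwa [a3]) e8 hv
      (fun y hy => (hold y hy).col_lt) (hnew v le_rfl hv).1 (hnew v le_rfl hv).2).frame
      fun c s₂ hf₂ h => ?_
    obtain ⟨hc, hB, hS⟩ := h
    have hp₂ : Parameters n t s₂ := hp₁.of_frame hf₂ (by decide)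
    have d8 : s₂.reg 8 = v := by rw [hf₂.reg 8 (by simp) rfl, e8]
    have a7 : s₂.arr 7 = s₁.arr 7 := hf₂.arr 7 rfl
    -- There are `t` colours, and the search guarantees fewer than `t` smaller neighbours.
    have hex : ∃ d, 2 ≤ d ∧ d < t + 2 ∧ s₂.arr 8 (v * (t + 2) + d) = 0 := by
      classical
      by_contra hcon
      push Not at hcon
      have hsub : Finset.Ico 2 (t + 2) ⊆
          ((Finset.range v).filter fun i => R (vert v) (vert i)).image (s₂.arr 7) := by
        intro d hd
        rw [Finset.mem_Ico] at hd
        by_contra hd'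
        refine hcon d hd.1 hd.2 (hB.cs_eq_zero d hd.2 ?_)
        rintro ⟨y, ⟨hy, hR⟩, he⟩
        exact hd' (Finset.mem_image.2 ⟨y, by simp [hy, hA.symm _ _ hR], he⟩)
      have hcard := (Finset.card_le_card hsub).trans Finset.card_image_le
      have hlt := ho.count_lt v hv
      have : visitedCount R vert v (vert v) =
          ((Finset.range v).filter fun i => R (vert v) (vert i)).card := by
        unfold visitedCount
        congr
      simp at hcard
      omega
    refine (colour_spec hE hp₂ d8 hv hex).frame fun c' s₃ hf₃ h => ?_
    obtain ⟨hc', d, hd2, hdt, hd0, b7, b8⟩ := h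
    have b6 : s₃.arr 6 = s₂.arr 6 := hf₃.arr 6 rfl
    have hdone := hB.done hd2 hdt hd0 b6 b7 b8
    refine ⟨?_, fun v' hv' => ?_, fun v' hv' hvn' => ?_⟩
    · rw [Finset.sum_range_succ]
      linarith
    · rcases (Nat.lt_succ_iff.1 hv').lt_or_eq with h | rfl
      · refine (hold v' h).congr (fun y hy => hy.1) ?_ (fun y hy => ?_) fun d' hd' => ?_
        · simp [b6, hS.par_eq v' h.ne]
        · simp only [AState.arr_setReg]
          rw [b7, Function.update_of_ne (by omega), a7]
        · simp only [AState.arr_setReg]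
          rw [b8, Function.update_of_ne fun he => h.ne (index_inj hd' hdt he).1,
            hS.cs_eq v' h.ne d' hd']
      · exact hdone.congr (fun y hy => hy.1) rfl (fun _ _ => rfl) fun _ _ => rfl
    · have hne : v' ≠ v := by omega
      have := hnew v' (by omega) hvn'
      simp only [AState.arr_setReg]
      rw [b6, hS.par_eq v' hne]
      refine ⟨this.1, fun d' hd' => ?_⟩
      rw [b8, Function.update_of_ne fun he => hne (index_inj hd' hdt he).1, hS.cs_eq v' hne d' hd']
      exact this.2 d' hd'
  · rintro c s' - hf ⟨hc, hI, -⟩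
    rw [hp.n_eq] at hc hI
    have hsum := ho.sum_degree_le hA 0 8
    have hpar : ∀ v, 0 < v → v < n → s'.arr 6 v < v := fun v hv0 hv => by
      rcases (hI v hv).par_mem with h | h
      · omega
      · exact h.1
    refine ⟨by omega, fun v hv => ?_, fun u v h => hA.symm _ _ h, fun u => hA.irrefl _, hpar,
      fun u v hv huv hR => ?_, hcl, fun v hv => (hI v hv).two_le_col,
      fun v hv => (hI v hv).col_lt, fun u v huv hv hR => (hI v hv).col_ne u ⟨huv, hR⟩,
      fun v hv d hd h => (hI v hv).cs_eq_one d hd ?_,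
      fun v hv d hd h => (hI v hv).cs_eq_zero d hd fun h' => h ?_⟩
    · rcases (hI v hv).par_mem with h | h
      · omega
      · exact h.1.trans hv
    -- The parent is the largest smaller neighbour, and the other ones are adjacent to it because
    -- they form a clique.
    · have hle := (hI v hv).le_par u ⟨huv, hR⟩
      refine hle.eq_or_lt.imp id fun hlt => ⟨hlt, ?_⟩
      have hm := (hI v hv).par_mem.resolve_left (by omega)
      exact hcl u _ v hv huv hm.1 hlt.ne hR hm.2
    · exact h.imp id fun ⟨u, h1, h2, h3⟩ => ⟨u, ⟨h1, h2⟩, h3⟩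
    · exact h'.imp id fun ⟨u, ⟨h1, h2⟩, h3⟩ => ⟨u, h1, h2, h3⟩

end ArrayMachine

/-! ### The complete algorithm and its cost -/

namespace ArrayMachine

open WordRAM (Op)

variable {E : Env} {n t : ℕ} {off : ℕ → ℕ} {nb : ℕ → ℕ → ℕ} {R : ℕ → ℕ → Prop}

/-- Decides whether the treedepth is at most the number in register `0`, and finds a treedepth
decomposition, provided that this number and the number of vertices are positive and
the number of edges is not too large. -/
def solve : AProg :=
  search ;; .ite (.reg 7) .skip (bags ;; initTable ;; mergeAll ;; findRoot ;;
    .ite (.reg 30) (traceBack ;; output) .skip)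

/-- The array `0` holds the answer of the algorithm. -/
def IsAnswer (n t : ℕ) (G : SimpleGraph (Fin n)) (out : ℕ → ℕ) : Prop :=
  (treedepth G ≤ t ∧ ∃ (F : RootedForest (Fin (n * t))) (ψ : Fin n → Fin (n * t)),
    IsTreedepthDecomposition G F ψ ∧ F.height ≤ t ∧ out 0 = 1 ∧ out 1 = n * t ∧
    (∀ i : Fin (n * t), out (2 + i) = (F.parent i).elim 0 fun p => (p : ℕ) + 1) ∧
    ∀ v : Fin n, out (2 + n * t + v) = ψ v) ∨
  (¬ treedepth G ≤ t ∧ out 0 = 0)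

/-- The number of steps of the algorithm, up to a constant factor. -/
def costBound (n t : ℕ) : ℕ := (n + 1) * (((t + 2) ^ t) ^ 3 * (t + 2) ^ 2)

/-- The summands are the bounds for the phases of `solve` in their order, and `2` for its two
branchings. -/
theorem solve_cost_le {d : ℕ} (hd : d ≤ 2 * (t * n)) :
    15 * (t + n + t * n + d + 1) + 9 * d + n * 3 + 9 +
      (n * (t * 4 + 12) + 8 * d + 2) + (n * ((t + 2) ^ t * (20 * (t + 1) ^ 2 + 3) + 4) + 3) +
      (n * (((t + 2) ^ t) ^ 3 * (14 * (t + 1) + 11) + (t + 2) ^ t * 3 + 10) + 3) +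
      ((t + 2) ^ t * 4 + 3) + (n * 7 + 4) + (n * (t * 13 + 12) + 6) + 2 ≤ 400 * costBound n t := by
  unfold costBound
  have hq : 1 ≤ (t + 2) ^ t := Nat.one_le_pow _ _ (by omega)
  generalize (t + 2) ^ t = q at *
  have hq3 : q ≤ q ^ 3 := Nat.le_self_pow (by norm_num) q
  obtain ⟨D, hD⟩ : ∃ D, D = q ^ 3 * (t + 2) ^ 2 := ⟨_, rfl⟩
  have h1 : q ^ 3 * (t + 1) ≤ D := hD ▸ Nat.mul_le_mul_left _ (by nlinarith)
  have h2 : q * (t + 1) ^ 2 ≤ D := hD ▸ Nat.mul_le_mul hq3 (by gcongr; omega)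
  have h3 : q ^ 3 ≤ D := hD ▸ Nat.le_mul_of_pos_right _ (by positivity)
  have h4 : t + 1 ≤ D := (Nat.le_mul_of_pos_left _ (by omega)).trans h1
  rw [← hD]
  have m1 := Nat.mul_le_mul_left n h1
  have m2 := Nat.mul_le_mul_left n h2
  have m3 := Nat.mul_le_mul_left n h3
  have m4 := Nat.mul_le_mul_left n h4
  have m5 := Nat.mul_le_mul_left n hq3
  nlinarith

theorem solve_spec (hE : E.Large n t) (hA : IsAdjacencyInput E.inp n off nb R)
    {G : SimpleGraph (Fin n)} (hG : IsChordal G)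
    (hR : ∀ u v, R u v ↔ ∃ (hu : u < n) (hv : v < n), G.Adj ⟨u, hu⟩ ⟨v, hv⟩) {s : AState}
    (hp : Parameters n t s) (ht : 0 < t) (hn : 0 < n) (hoff : off n ≤ 2 * (t * n))
    (h0 : ∀ k i, s.arr k i = 0) :
    AProg.WP E solve s fun c s' => c ≤ 400 * costBound n t ∧ IsAnswer n t G (s'.arr 0) := by
  have hq0 : 0 < (t + 2) ^ t := by positivity
  have hcost := solve_cost_le hoff
  rw [solve, AProg.WP_seq]
  refine (search_spec hE hA hp ht hn hoff (h0 1) (h0 3) (h0 5)).frame fun c₁ s₁ hf₁ h => ?_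
  obtain ⟨hc₁, h⟩ := h
  have hp₁ : Parameters n t s₁ := hp.of_frame hf₁ (by decide)
  have z₁ : ∀ i, s₁.arr 0 i = 0 := fun i => by rw [hf₁.arr 0 rfl, h0]
  rw [AProg.WP_ite]
  refine ⟨by simp, fun h7 => ?_, fun h7 => ?_⟩
  · obtain ⟨-, m, ho, x, hx, hx0, hle⟩ := h.resolve_right fun h => h7 h.1
    rw [AProg.WP_skip]
    exact ⟨by omega, .inr ⟨ho.not_treedepth_le hG hR hx hx0 hle, z₁ 0⟩⟩
  obtain ⟨-, ho⟩ := h.resolve_left fun h => h.1 h7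
  clear h
  obtain ⟨vert, hvert⟩ : ∃ vert, vert = s₁.arr 4 := ⟨_, rfl⟩
  rw [← hvert] at ho
  have hcl : ∀ u u' v, v < n → u < v → u' < v → u ≠ u' → R (vert u) (vert v) →
      R (vert u') (vert v) → R (vert u) (vert u') := by
    intro u u' v hv hu hu' hne h1 h2
    have e1 := ho.pos_vert u (hu.trans hv)
    have e2 := ho.pos_vert u' (hu'.trans hv)
    have e3 := ho.pos_vert v hv
    exact ho.adj_of_adj hG hR (by omega) (by omega) (.inr (by omega)) (.inr (by omega))
      (fun he => hne (ho.vert_inj (hu.trans hv) (hu'.trans hv) he)) h1 h2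
  rw [AProg.WP_seq]
  refine (bags_spec hE hA hp₁ hoff hvert.symm ho (fun i => by rw [hf₁.arr 6 rfl, h0])
    (fun i => by rw [hf₁.arr 8 rfl, h0]) hcl).frame fun c₂ s₂ hf₂ h => ?_
  obtain ⟨hc₂, hparn, hE₂⟩ := h
  have hp₂ : Parameters n t s₂ := hp₁.of_frame hf₂ (by decide)
  obtain ⟨par, hpar⟩ : ∃ par, par = s₂.arr 6 := ⟨_, rfl⟩
  obtain ⟨col, hcol⟩ : ∃ col, col = s₂.arr 7 := ⟨_, rfl⟩
  obtain ⟨cs, hcs⟩ : ∃ cs : ℕ → ℕ → ℕ, cs = fun v d => s₂.arr 8 (v * (t + 2) + d) := ⟨_, rfl⟩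
  rw [← hpar, ← hcol, ← hcs] at hE₂
  rw [← hpar] at hparn
  have hb₂ : Bags n t par col cs s₂ :=
    ⟨fun v _ => by rw [hpar], fun v _ => by rw [hcol], fun v _ d _ => by rw [hcs]⟩
  rw [AProg.WP_seq]
  refine (initTable_spec hE hp₂ hb₂).frame fun c₃ s₃ hf₃ h => ?_
  obtain ⟨hc₃, htab₃⟩ := h
  have hp₃ : Parameters n t s₃ := hp₂.of_frame hf₃ (by decide)
  have hb₃ : Bags n t par col cs s₃ := hb₂.of_frame hf₃ rfl rfl rfl
  rw [AProg.WP_seq]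
  refine (mergeAll_spec hE hp₃ hn hb₃ hE₂.par_lt hE₂.col_lt htab₃ fun i => by
    rw [hf₃.arr 10 rfl, hf₂.arr 10 rfl, hf₁.arr 10 rfl, h0]).frame fun c₄ s₄ hf₄ h => ?_
  obtain ⟨hc₄, htab₄, horig⟩ := h
  have hp₄ : Parameters n t s₄ := hp₃.of_frame hf₄ (by decide)
  have hb₄ : Bags n t par col cs s₄ := hb₃.of_frame hf₄ rfl rfl rfl
  rw [AProg.WP_seq]
  refine (findRoot_spec hE hp₄ hn).frame fun c₅ s₅ hf₅ h => ?_
  obtain ⟨hc₅, hroot⟩ := h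
  have hp₅ : Parameters n t s₅ := hp₄.of_frame hf₅ (by decide)
  have hb₅ : Bags n t par col cs s₅ := hb₄.of_frame hf₅ rfl rfl rfl
  have z₅ : ∀ i, s₅.arr 0 i = 0 := fun i => by
    rw [hf₅.arr 0 rfl, hf₄.arr 0 rfl, hf₃.arr 0 rfl, hf₂.arr 0 rfl, z₁]
  have htab0 : ∀ x < (t + 2) ^ t, (s₄.arr 9 x ≠ 0 ↔ Reach n t par col cs (n - 1) 0 x) := by
    intro x hx
    simpa using htab₄ 0 hn x hx
  rw [AProg.WP_ite]
  refine ⟨by simp, fun h30 => ?_, fun h30 => ?_⟩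
  swap
  · obtain ⟨-, hno⟩ := hroot.resolve_right (by
      rintro ⟨x, -, hx, -⟩
      have : s₅.reg 30 = 0 := h30
      omega)
    rw [AProg.WP_skip]
    refine ⟨by omega, .inr ⟨fun htd => ?_, z₅ 0⟩⟩
    obtain ⟨N, F, ψ, h1, h2⟩ := treedepth_le_iff.1 htd
    have hψ : ∀ v (hv : v < n), ∃ x, x = ψ ⟨vert v, ho.vert_lt v hv⟩ := fun v hv => ⟨_, rfl⟩
    -- The decomposition of `G` is read along `vert`, since the dynamic program deals with
    -- positions; the value beyond `n` is arbitrary.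
    obtain ⟨x, hx, hreach, -⟩ := exists_reach hE₂ (F := F)
      (ψ := fun v => if hv : v < n then ψ ⟨vert v, ho.vert_lt v hv⟩ else ψ ⟨0, hn⟩)
      (by
        intro u v hu hv he
        rw [dif_pos hu, dif_pos hv] at he
        exact ho.vert_inj hu hv (Fin.ext_iff.1 (h1.1 he)))
      (by
        intro u v hu hv hR'
        rw [dif_pos hu, dif_pos hv]
        exact h1.comparable ((hR _ _).1 hR').2.2)
      (by
        intro v hv
        rw [dif_pos hv]
        exact (F.depth_le_height _).trans h2) (n - 1) (by omega) 0 hn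
    exact (htab0 x hx).2 hreach (hno x hx)
  · obtain ⟨x, hx, hx30, hx9⟩ := hroot.resolve_left fun h => h30 h.1
    rw [AProg.WP_seq]
    refine (traceBack_spec hE hp₅ hn hb₅ hE₂.par_lt (fun k hk hkn z hz => by
      rw [hf₅.arr 10 rfl]
      exact horig k hk hkn z hz) hx hx30 ((htab0 x hx).1 hx9)).frame fun c₆ s₆ hf₆ h => ?_
    obtain ⟨hc₆, cur, hT, hcur⟩ := h
    have hp₆ : Parameters n t s₆ := hp₅.of_frame hf₆ (by decide)
    have hb₆ : Bags n t par col cs s₆ := hb₅.of_frame hf₆ rfl rfl rfl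
    refine (output_spec hE hp₆ hb₆.par_eq hb₆.col_eq (fun v hv => (hcur v hv).1) (r := vert)
      (fun v hv => by
        rw [hf₆.arr 4 rfl, hf₅.arr 4 rfl, hf₄.arr 4 rfl, hf₃.arr 4 rfl, hf₂.arr 4 rfl, hvert])
      (fun i => by rw [hf₆.arr 0 rfl, z₅]) hparn hE₂.par_lt hE₂.col_lt
      (fun v hv => (hcur v hv).2) (fun j hj => hT.not_seen_zero hE₂ hn hj)
      (fun v hv i hi j hj h1 h2 => hT.digit_unique hE₂ hv
        (by have := hE₂.two_le_col v hv; omega) (hE₂.col_lt v hv) hi hj h1 h2)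
      ho.vert_lt fun u v hu hv he => ho.vert_inj hu hv he).mono fun c₇ s₇ h => ?_
    obtain ⟨hc₇, o0, o1, rep, hrep, ho2, ho3⟩ := h
    refine ⟨by omega, .inl ?_⟩
    obtain ⟨F, ψ, hF, hpar', hψ, hinj, hanc⟩ := hT.exists_decomposition hE₂ hrep
      (fun v => s₇.arr 0 (2 + n * t + vert v)) ho3
    -- The map `σ` from vertices back to positions turns the decomposition of the positions into one
    -- of `G`.
    have hσ : ∀ w : Fin n, ∃ v : Fin n, vert v = w := fun w => by
      obtain ⟨v, hv, -, he⟩ := ho.pos_ne_zero w.2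
      exact ⟨⟨v, hv⟩, he⟩
    choose σ hσ using hσ
    have hdec : IsTreedepthDecomposition G F (ψ ∘ σ) := by
      refine ⟨fun u v he => ?_, fun u v huv => hanc _ _ ((hR _ _).2 ?_)⟩
      · have := hinj he
        ext
        rw [← hσ u, ← hσ v, this]
      · rw [hσ, hσ]
        exact ⟨u.2, v.2, huv⟩
    refine ⟨treedepth_le_iff.2 ⟨_, F, _, hdec, hF⟩, F, ψ ∘ σ, hdec, hF, o0, o1, fun i => ?_,
      fun v => ?_⟩
    · rw [hpar' i, ← ho2 _ (Nat.div_lt_of_lt_mul (i.2.trans_eq (mul_comm n t))) _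
        (Nat.mod_lt _ ht)]
      congr 2
      exact (Nat.div_add_mod' _ _).symm
    · rw [Function.comp, hψ, hσ]

/-- Reads the parameters. -/
def setup : AProg :=
  .assign 0 (.input (.lit 0)) ;; .assign 1 (.input (.lit 1)) ;; .assign 2 (.reg 0 +ᵃ .lit 2) ;;
  .assign 3 (.lit 1) ;; .loop 15 0 (.assign 3 (.reg 3 *ᵃ .reg 2))

theorem setup_spec (hE : E.Large n t) (ht : E.inp.getD 0 0 = t) (hn : E.inp.getD 1 0 = n)
    (s : AState) :
    AProg.WP E setup s fun c s' => c ≤ t * 3 + 6 ∧ Parameters n t s' := by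
  obtain ⟨h1, h2, h3, h4, h5⟩ := hE.le_B
  simp only [setup, AProg.WP_seq, AProg.WP_assign]
  simp only [AExpr.eval, AExpr.Safe, Op.eval, ht, hn]
  refine ⟨⟨trivial, by omega⟩, ⟨trivial, by omega⟩, ⟨by simp, by simp; omega⟩,
    ⟨trivial, by omega⟩, ?_⟩
  refine AProg.WP_loop 1 (fun i s' => s'.reg 3 = (t + 2) ^ i) rfl rfl (by norm_num) (by simp) ?_ ?_
  · intro i s' hi h15 h0 hf h3
    simp at hi
    have e2 : s'.reg 2 = t + 2 := by simpa using hf.reg 2 (by simp) rfl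
    have hle : (t + 2) ^ (i + 1) ≤ (t + 2) ^ t := Nat.pow_le_pow_right (by omega) (by omega)
    rw [pow_succ] at hle
    simp [AProg.WP_assign, h3, e2, ← pow_succ]
    rw [pow_succ]
    omega
  · intro c s' hc h15 hf h3
    simp at hc h3
    exact ⟨by omega, by simpa using hf.reg 0 (by simp) rfl, by simpa using hf.reg 1 (by simp) rfl,
      by simpa using hf.reg 2 (by simp) rfl, h3⟩

/-- The whole algorithm. -/
def decideTreedepth : AProg :=
  setup ;; .ite (.reg 1)
    (.ite (.lit 2 *ᵃ (.reg 0 *ᵃ .reg 1) <ᵃ .input (.reg 1 +ᵃ .lit 2)) .skip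
      (.ite (.reg 0) solve .skip))
    (.store 0 (.lit 0) (.lit 1))

/-- Three cases are settled before `solve`. Without vertices the empty forest works. Adjacency lists
longer than `2tn` are rejected before they are read, as they could exceed the time bound. For `t =
0` a single vertex is a clique that is too large. -/
theorem decideTreedepth_spec (hE : E.Large n t) (hA : IsAdjacencyInput E.inp n off nb R)
    {G : SimpleGraph (Fin n)} (hG : IsChordal G)
    (hR : ∀ u v, R u v ↔ ∃ (hu : u < n) (hv : v < n), G.Adj ⟨u, hu⟩ ⟨v, hv⟩)
    (hoff : treedepth G ≤ t → off n ≤ 2 * (t * n))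
    (ht : E.inp.getD 0 0 = t) (hn : E.inp.getD 1 0 = n) :
    AProg.WP E decideTreedepth AState.init fun c s' =>
      c ≤ 410 * costBound n t ∧ IsAnswer n t G (s'.arr 0) := by
  have hcb : t + 1 ≤ costBound n t := by
    have h1 : 0 < ((t + 2) ^ t) ^ 3 := by positivity
    calc t + 1 ≤ (t + 2) ^ 2 := by nlinarith
      _ ≤ ((t + 2) ^ t) ^ 3 * (t + 2) ^ 2 := Nat.le_mul_of_pos_left _ h1
      _ ≤ costBound n t := Nat.le_mul_of_pos_left _ (by omega)
  rw [decideTreedepth, AProg.WP_seq]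
  refine (setup_spec hE ht hn AState.init).frame fun c₁ s₁ hf₁ h => ?_
  obtain ⟨hc₁, hp₁⟩ := h
  have z₁ : ∀ k i, s₁.arr k i = 0 := fun k i => by
    rw [hf₁.arr k rfl]
    rfl
  rw [AProg.WP_ite]
  refine ⟨by simp, fun h1 => ?_, fun h1 => ?_⟩
  · simp only [AExpr.eval, hp₁.n_eq] at h1
    rw [AProg.WP_ite]
    simp only [AExpr.eval, AExpr.Safe, Op.eval, hp₁.n_eq, hp₁.t_eq, hA.inp_off n le_rfl]
    refine ⟨by simp, fun h2 => ?_, fun h2 => ?_⟩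
    · rw [AProg.WP_skip]
      refine ⟨by omega, .inr ⟨fun h => ?_, z₁ 0 0⟩⟩
      rw [if_neg (by have := hoff h; omega)] at h2
      exact h2 rfl
    · have hle : off n ≤ 2 * (t * n) := by
        by_contra hlt
        rw [if_pos (by omega)] at h2
        omega
      rw [AProg.WP_ite]
      simp only [AExpr.eval, AExpr.Safe, hp₁.t_eq]
      refine ⟨trivial, fun h3 => ?_, fun h3 => ?_⟩
      · exact (solve_spec hE hA hG hR hp₁ (by omega) (by omega) hle z₁).mono fun c s h =>
          ⟨by omega, h.2⟩
      · rw [AProg.WP_skip]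
        refine ⟨by omega, .inr ⟨fun h => ?_, z₁ 0 0⟩⟩
        have := card_le_of_isClique h {⟨0, by omega⟩} (by simp)
        simp at this
        omega
  · simp only [AExpr.eval, hp₁.n_eq] at h1
    subst h1
    rw [AProg.WP_store]
    have hM : 0 < E.M 0 := by
      rw [hE.M_zero]
      omega
    have hB := hE.B_n
    refine ⟨⟨trivial, trivial, by simpa using hM, by simp; omega⟩, by omega, .inl ?_⟩
    have hempty : IsEmpty (Fin (0 * t)) := by
      rw [Nat.zero_mul]
      infer_instance
    obtain ⟨F, hF⟩ : ∃ F : RootedForest (Fin (0 * t)), F.height ≤ t :=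
      ⟨⟨fun x => hempty.elim x, fun x => hempty.elim x⟩, Finset.sup_le fun x _ => hempty.elim x⟩
    have hdec : IsTreedepthDecomposition G F (fun v => v.elim0) :=
      ⟨fun v => v.elim0, fun v => v.elim0⟩
    refine ⟨treedepth_le_iff.2 ⟨_, F, _, hdec, hF⟩, F, _, hdec, hF, by simp, by simp [z₁],
      fun x => hempty.elim x, fun v => v.elim0⟩

end ArrayMachine

/-! ## The encoding of the input and the output -/

theorem List.getElem?_flatten_of_take {α : Type*} (L : List (List α)) {u k : ℕ} {l : List α}
    (hu : L[u]? = some l) (hk : k < l.length) :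
    L.flatten[((L.take u).map List.length).sum + k]? = l[k]? := by
  induction L generalizing u with
  | nil => simp at hu
  | cons a L ih =>
    cases u with
    | zero =>
      simp only [List.getElem?_cons_zero, Option.some.injEq] at hu
      subst hu
      simp [List.getElem?_append, hk]
    | succ u =>
      simp only [List.getElem?_cons_succ] at hu
      rw [← ih hu]
      simp only [List.flatten_cons, List.take_succ_cons, List.map_cons, List.sum_cons]
      rw [List.getElem?_append_right (by omega)]
      congr 1
      omega

section Encoding

variable {n t : ℕ} {G : SimpleGraph (Fin n)} {adj : Fin n → List (Fin n)}

/-- The total length of the adjacency lists of the vertices less than `i`. -/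
def listOffset (adj : Fin n → List (Fin n)) (i : ℕ) : ℕ :=
  ∑ v : Fin n, if (v : ℕ) < i then (adj v).length else 0

theorem listOffset_succ {u : ℕ} (hu : u < n) :
    listOffset adj (u + 1) = listOffset adj u + (adj ⟨u, hu⟩).length := by
  have h : (adj ⟨u, hu⟩).length = ∑ v : Fin n, if v = ⟨u, hu⟩ then (adj v).length else 0 := by
    simp
  rw [listOffset, listOffset, h, ← Finset.sum_add_distrib]
  refine Finset.sum_congr rfl fun v _ => ?_
  simp only [Fin.ext_iff]
  split_ifs <;> omega

theorem encodeInput_eq : encodeInput t adj = t :: n :: ((List.range (n + 1)).map (listOffset adj) ++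
    (List.ofFn adj).flatten.map fun u : Fin n => (u : ℕ)) := by
  simp only [encodeInput, bind_pure_comp, List.map_eq_map, List.map_id']
  rfl

theorem encodeInput_getD_add_two {u : ℕ} (hu : u ≤ n) :
    (encodeInput t adj).getD (u + 2) 0 = listOffset adj u := by
  rw [encodeInput_eq, List.getD_cons_succ, List.getD_cons_succ, List.getD_append _ _ _ _ (by simp; omega)]
  rw [List.getD_eq_getElem _ _ (by simp; omega)]
  simp

theorem sum_take_lengths {u : ℕ} (hu : u ≤ n) :
    (((List.ofFn adj).take u).map List.length).sum = listOffset adj u := by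
  induction u with
  | zero => simp [listOffset]
  | succ u ih =>
    rw [listOffset_succ (by omega), ← ih (by omega), List.take_add_one]
    simp [show u < n by omega]

theorem encodeInput_getD_add {u k : ℕ} (hu : u < n) (hk : k < (adj ⟨u, hu⟩).length) :
    (encodeInput t adj).getD (n + 3 + listOffset adj u + k) 0 = (adj ⟨u, hu⟩)[k] := by
  rw [show n + 3 + listOffset adj u + k = n + 1 + (listOffset adj u + k) + 1 + 1 by ring,
    encodeInput_eq, List.getD_cons_succ, List.getD_cons_succ,
    List.getD_append_right _ _ _ _ (by simp)]
  have h := List.getElem?_flatten_of_take (List.ofFn adj) (u := u) (l := adj ⟨u, hu⟩)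
    (by simp [hu]) hk
  rw [sum_take_lengths hu.le] at h
  rw [List.length_map, List.length_range, Nat.add_sub_cancel_left, List.getD_eq_getElem?_getD,
    List.getElem?_map, h, List.getElem?_eq_getElem hk]
  rfl

theorem IsAdjacencyLists.length_le (h : IsAdjacencyLists G adj) (v : Fin n) :
    (adj v).length ≤ n := by
  simpa using (h v).1.length_le_card

theorem IsAdjacencyLists.listOffset_le (h : IsAdjacencyLists G adj) (i : ℕ) :
    listOffset adj i ≤ n * n := by
  calc listOffset adj i ≤ ∑ _v : Fin n, n := Finset.sum_le_sum fun v _ => by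
        split_ifs
        · exact h.length_le v
        · exact Nat.zero_le n
    _ = n * n := by simp

theorem IsAdjacencyLists.listOffset_le_of_treedepth_le (h : IsAdjacencyLists G adj)
    (ht : treedepth G ≤ t) : listOffset adj n ≤ 2 * (t * n) := by
  classical
  refine le_trans ?_ (sum_degree_le ht)
  refine Finset.sum_le_sum fun v _ => ?_
  rw [if_pos v.2, ← List.toFinset_card_of_nodup (h v).1]
  refine Finset.card_le_card fun u hu => ?_
  simpa [(h v).2 u] using hu

theorem IsAdjacencyLists.isAdjacencyInput (h : IsAdjacencyLists G adj) :
    IsAdjacencyInput (encodeInput t adj) n (listOffset adj)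
      (fun u k => (encodeInput t adj).getD (n + 3 + listOffset adj u + k) 0)
      (fun u v => ∃ (hu : u < n) (hv : v < n), G.Adj ⟨u, hu⟩ ⟨v, hv⟩) where
  off_le u hu := by
    rw [listOffset_succ hu]
    omega
  inp_off u hu := encodeInput_getD_add_two hu
  inp_nb u hu k hk := rfl
  rel_iff u hu x := by
    rw [listOffset_succ hu, Nat.add_sub_cancel_left]
    constructor
    · rintro ⟨_, hx, hadj⟩
      obtain ⟨k, hk, he⟩ := List.mem_iff_getElem.1 (((h ⟨u, hu⟩).2 _).2 hadj)
      exact ⟨k, hk, by rw [encodeInput_getD_add hu hk, he]⟩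
    · rintro ⟨k, hk, rfl⟩
      have hmem := ((h ⟨u, hu⟩).2 _).1 (List.getElem_mem hk)
      simp only [encodeInput_getD_add hu hk]
      exact ⟨hu, Fin.is_lt _, hmem⟩
  nb_inj u hu k hk k' hk' he := by
    rw [listOffset_succ hu, Nat.add_sub_cancel_left] at hk hk'
    rw [encodeInput_getD_add hu hk, encodeInput_getD_add hu hk'] at he
    exact (h ⟨u, hu⟩).1.getElem_inj_iff.1 (Fin.ext he)
  rel_lt u x := fun ⟨_, hx, _⟩ => hx
  symm u x := fun ⟨hu, hx, hadj⟩ => ⟨hx, hu, hadj.symm⟩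
  irrefl u := fun ⟨_, _, hadj⟩ => G.loopless.irrefl _ hadj

theorem IsAdjacencyLists.encodeInput_getD_le (h : IsAdjacencyLists G adj) (a : ℕ) :
    (encodeInput t adj).getD a 0 ≤ t + n + n * n := by
  have key : ∀ x ∈ encodeInput t adj, x ≤ t + n + n * n := by
    intro x hx
    rw [encodeInput_eq, List.mem_cons, List.mem_cons, List.mem_append, List.mem_map,
      List.mem_map] at hx
    rcases hx with rfl | rfl | ⟨i, -, rfl⟩ | ⟨u, -, rfl⟩
    · omega
    · omega
    · exact (h.listOffset_le i).trans (by omega)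
    · have := u.2
      omega
  rw [List.getD_eq_getElem?_getD]
  rcases ho : (encodeInput t adj)[a]? with _ | x
  · simp
  · exact key x (List.mem_of_getElem? ho)

theorem getElem_encodeDecomposition {N : ℕ} {F : RootedForest (Fin N)} {ψ : Fin n → Fin N}
    {out : ℕ → ℕ} (h0 : out 0 = 1) (h1 : out 1 = N)
    (h2 : ∀ i : Fin N, out (2 + i) = (F.parent i).elim 0 fun p => (p : ℕ) + 1)
    (h3 : ∀ v : Fin n, out (2 + N + v) = ψ v) (i : ℕ)
    (hi : i < (1 :: encodeDecomposition F ψ).length) :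
    out i = (1 :: encodeDecomposition F ψ)[i] := by
  rcases i with _ | _ | i
  · exact h0
  · exact h1
  · have hlen : i < N + n := by simpa [encodeDecomposition] using hi
    by_cases hiN : i < N
    · have := h2 ⟨i, hiN⟩
      simp only [encodeDecomposition, List.getElem_cons_succ]
      rw [List.getElem_append_left (by simp; omega), List.getElem_append_right (by simp)]
      rw [show 2 + ((⟨i, hiN⟩ : Fin N) : ℕ) = i + 1 + 1 by simp; omega] at this
      rw [this]
      simp
    · have := h3 ⟨i - N, by omega⟩
      simp only [encodeDecomposition, List.getElem_cons_succ]
      rw [List.getElem_append_right (by simp; omega)]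
      simp only [List.length_append, List.length_cons, List.length_nil, List.length_ofFn,
        List.getElem_ofFn]
      rw [show 2 + N + ((⟨i - N, by omega⟩ : Fin n) : ℕ) = i + 1 + 1 by simp; omega] at this
      rw [this]
      congr 3
      omega

end Encoding

/-! ## The resource bounds -/

open ArrayMachine WordRAM

section Bounds

variable {n t : ℕ}

/-- For `t = 0` both sides are `1`, as `0 ^ 0 = 1`. This turns the real bounds into statements on
natural numbers. -/
theorem two_rpow_mul_logb (t : ℕ) : (2 : ℝ) ^ ((t : ℝ) * Real.logb 2 t) = ((t ^ t : ℕ) : ℝ) := by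
  rcases Nat.eq_zero_or_pos t with rfl | ht
  · simp
  · have ht' : (0 : ℝ) < t := by exact_mod_cast ht
    rw [mul_comm, Real.rpow_mul (by norm_num), Real.rpow_logb (by norm_num) (by norm_num) ht',
      Real.rpow_natCast]
    push_cast
    rfl

theorem two_rpow_logb (n : ℕ) : (2 : ℝ) ^ Real.logb 2 n = ((max n 1 : ℕ) : ℝ) := by
  rcases Nat.eq_zero_or_pos n with rfl | hn
  · simp
  · rw [Real.rpow_logb (by norm_num) (by norm_num) (by exact_mod_cast hn), max_eq_left hn]

theorem resourceBound_eq (C t n : ℕ) :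
    resourceBound C t n = ((C * (t ^ t) ^ C * max n 1 : ℕ) : ℝ) := by
  rw [resourceBound, mul_comm (C : ℝ) (t * Real.logb 2 t), Real.rpow_mul (by norm_num),
    two_rpow_mul_logb, Real.rpow_natCast]
  push_cast
  rfl

theorem pow_le_two_pow_of_le_word {C w : ℕ}
    (h : (C : ℝ) * (t * Real.logb 2 t + Real.logb 2 n + 1) ≤ w) :
    (2 * t ^ t * max n 1) ^ C ≤ 2 ^ w := by
  have h1 : (2 : ℝ) ^ ((C : ℝ) * (t * Real.logb 2 t + Real.logb 2 n + 1)) ≤ (2 : ℝ) ^ (w : ℝ) :=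
    Real.rpow_le_rpow_of_exponent_le (by norm_num) h
  rw [mul_comm, Real.rpow_mul (by norm_num), Real.rpow_add (by norm_num),
    Real.rpow_add (by norm_num), two_rpow_mul_logb, two_rpow_logb, Real.rpow_one,
    Real.rpow_natCast, Real.rpow_natCast] at h1
  have h2 : ((t ^ t * max n 1 * 2) ^ C : ℕ) ≤ 2 ^ w := by exact_mod_cast h1
  rwa [show 2 * t ^ t * max n 1 = t ^ t * max n 1 * 2 by ring]

theorem one_le_self_pow_self (t : ℕ) : 1 ≤ t ^ t := by
  rcases Nat.eq_zero_or_pos t with rfl | ht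
  · simp
  · exact Nat.one_le_pow _ _ ht

theorem add_two_le (t : ℕ) : t + 2 ≤ 3 * t ^ t := by
  rcases t with _ | t
  · simp
  · have := Nat.le_self_pow (n := t + 1) (by omega) (t + 1)
    omega

/-- For `t ≥ 2` this is `t + 2 ≤ t ^ 2`. A constant factor is needed for `t = 1`, where `t ^ t = 1`.
-/
theorem add_two_pow_le (t : ℕ) : (t + 2) ^ t ≤ 9 * (t ^ t) ^ 2 := by
  rcases t with _ | _ | t
  · simp
  · simp
  · calc (t + 2 + 2) ^ (t + 2) ≤ ((t + 2) ^ 2) ^ (t + 2) := by gcongr; nlinarith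
      _ = ((t + 2) ^ (t + 2)) ^ 2 := by rw [← pow_mul, ← pow_mul, mul_comm]
      _ ≤ _ := Nat.le_mul_of_pos_left _ (by norm_num)

/-- The size of the arrays other than the array of the output. -/
def arraySize (n t : ℕ) : ℕ := n * (t + 2) ^ t + n * (t + 2) + t * (t + n + 3 * (t * n) + 2)

/-- A bound for all values that are stored. -/
def valueBound (n t : ℕ) : ℕ := ((t + 2) ^ t) ^ 3 + 1 + 4 * (n + 1) * (t + 2) + n * n + 16

theorem arraySize_le (n t : ℕ) : arraySize n t ≤ 51 * ((t ^ t) ^ 2 * max n 1) := by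
  have hN : n ≤ max n 1 := le_max_left _ _
  have hN1 : 1 ≤ max n 1 := le_max_right _ _
  have h1 := one_le_self_pow_self t
  have h2 := add_two_le t
  have h3 := add_two_pow_le t
  unfold arraySize
  generalize max n 1 = N at *
  generalize (t + 2) ^ t = q at *
  generalize t ^ t = X at *
  calc n * q + n * (t + 2) + t * (t + n + 3 * (t * n) + 2)
      = n * q + n * (t + 2) + t * ((t + 2) * 1 + 1 * n + 3 * (t * n)) := by ring
    _ ≤ N * (9 * X ^ 2) + N * (3 * X) + 3 * X * (3 * X * N + X * N + 3 * (3 * X * N)) := by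
        gcongr <;> omega
    _ = 48 * (X ^ 2 * N) + 3 * (X * 1 * N) := by ring
    _ ≤ 48 * (X ^ 2 * N) + 3 * (X * X * N) := by gcongr
    _ = 51 * (X ^ 2 * N) := by ring

theorem valueBound_le (n t : ℕ) : valueBound n t ≤ (2 * t ^ t * max n 1) ^ 10 := by
  have hN : n ≤ max n 1 := le_max_left _ _
  have hN1 : 1 ≤ max n 1 := le_max_right _ _
  have h1 := one_le_self_pow_self t
  have h2 := add_two_le t
  have h3 := add_two_pow_le t
  unfold valueBound
  generalize max n 1 = N at *
  generalize (t + 2) ^ t = q at *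
  generalize t ^ t = X at *
  have e1 : X ^ 6 ≤ X ^ 10 * N ^ 10 :=
    (Nat.pow_le_pow_right h1 (by norm_num)).trans (Nat.le_mul_of_pos_right _ (by positivity))
  have e2 : N * X ≤ X ^ 10 * N ^ 10 := by
    rw [mul_comm]
    exact Nat.mul_le_mul (Nat.le_self_pow (by norm_num) X) (Nat.le_self_pow (by norm_num) N)
  have e3 : N * N ≤ X ^ 10 * N ^ 10 := by
    rw [← sq]
    exact (Nat.pow_le_pow_right hN1 (by norm_num)).trans
      (Nat.le_mul_of_pos_left _ (by positivity))
  have e4 : 1 ≤ X ^ 10 * N ^ 10 := Nat.one_le_iff_ne_zero.2 (by positivity)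
  calc q ^ 3 + 1 + 4 * (n + 1) * (t + 2) + n * n + 16
      ≤ (9 * X ^ 2) ^ 3 + 1 + 4 * (N + N) * (3 * X) + N * N + 16 := by gcongr
    _ = 729 * X ^ 6 + 24 * (N * X) + N * N + 17 * 1 := by ring
    -- The coefficients add up to `771`, and the exponent `10` is chosen so that `2 ^ 10` absorbs
    -- them.
    _ ≤ 1024 * (X ^ 10 * N ^ 10) := by omega
    _ = (2 * X * N) ^ 10 := by ring

theorem costBound_le (n t : ℕ) : costBound n t ≤ 13122 * ((t ^ t) ^ 8 * max n 1) := by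
  have hN : n ≤ max n 1 := le_max_left _ _
  have hN1 : 1 ≤ max n 1 := le_max_right _ _
  have h2 := add_two_le t
  have h3 := add_two_pow_le t
  unfold costBound
  generalize max n 1 = N at *
  generalize (t + 2) ^ t = q at *
  generalize t ^ t = X at *
  calc (n + 1) * (q ^ 3 * (t + 2) ^ 2)
      ≤ (N + N) * ((9 * X ^ 2) ^ 3 * (3 * X) ^ 2) := by gcongr
    _ = 13122 * (X ^ 8 * N) := by ring

/-- The size of the memory. -/
def memorySize (n t : ℕ) : ℕ := 2 + n * t + n + (16 * arraySize n t + 16)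

theorem memorySize_le (n t : ℕ) : memorySize n t ≤ 1000 * ((t ^ t) ^ 2 * max n 1) := by
  have hN : n ≤ max n 1 := le_max_left _ _
  have hN1 : 1 ≤ max n 1 := le_max_right _ _
  have h1 := one_le_self_pow_self t
  have h2 := add_two_le t
  have h3 := arraySize_le n t
  unfold memorySize
  generalize max n 1 = N at *
  generalize t ^ t = X at *
  have e1 : 1 ≤ X ^ 2 * N := Nat.one_le_iff_ne_zero.2 (by positivity)
  have e2 : n * t + n ≤ 3 * (X ^ 2 * N) :=
    calc n * t + n ≤ n * (t + 2) := by rw [mul_add]; omega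
      _ ≤ N * (3 * X ^ 2) := Nat.mul_le_mul hN
          (h2.trans (Nat.mul_le_mul_left _ (Nat.le_self_pow (by norm_num) X)))
      _ = 3 * (X ^ 2 * N) := by ring
  omega

theorem le_resourceBound {C a k : ℕ} (haC : a ≤ C) (hkC : k ≤ C) {x : ℕ}
    (hx : x ≤ a * ((t ^ t) ^ k * max n 1)) : (x : ℝ) ≤ resourceBound C t n := by
  rw [resourceBound_eq, mul_assoc]
  exact_mod_cast hx.trans (Nat.mul_le_mul haC (Nat.mul_le_mul_right _
    (Nat.pow_le_pow_right (one_le_self_pow_self t) hkC)))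

end Bounds

/-! ### The program of the word RAM and the main theorem -/

theorem WordRAM.Outputs.zero {S : ℕ} {s : State} (hS : 0 < S) (h : s.mem 0 = 0) :
    Outputs S s [0] :=
  ⟨hS, fun i hi => by
    obtain rfl : i = 0 := by simpa using hi
    exact h⟩

/-- Puts the length of the output into the first register, which is the offset of the other arrays
in the memory, and then runs the algorithm. -/
def treedepthProgram : Program :=
  .seq (.assign 0 (.op .add (.op .add (.lit 2) (.op .mul (.input (.lit 1)) (.input (.lit 0))))
    (.input (.lit 1)))) decideTreedepth.compile

theorem decideTreedepth_wf : decideTreedepth.wf = true := by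
  decide

/-- The environment for the input given by adjacency lists. -/
def inputEnv {n : ℕ} (t : ℕ) (adj : Fin n → List (Fin n)) : Env where
  inp := encodeInput t adj
  M k := if k = 0 then 2 + n * t + n else arraySize n t
  B := valueBound n t

theorem inputEnv_large {n : ℕ} (t : ℕ) (adj : Fin n → List (Fin n)) :
    (inputEnv t adj).Large n t := by
  constructor <;> simp [inputEnv, arraySize, valueBound] <;> omega

/-- Stored values are at most the tenth power of `2 * t ^ t * max n 1`, and expressions raise them
to less than the 24th power. So `241 = 10 * 24 + 1` leaves a strict inequality. -/
theorem inputEnv_fits {n t w : ℕ} {G : SimpleGraph (Fin n)} {adj : Fin n → List (Fin n)}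
    (h : IsAdjacencyLists G adj) (hw : (2 * t ^ t * max n 1) ^ 241 ≤ 2 ^ w) :
    (inputEnv t adj).Fits (2 + n * t + n) w (memorySize n t) := by
  have hN1 : 1 ≤ max n 1 := le_max_right _ _
  have h1 := one_le_self_pow_self t
  have hY : 1 < 2 * t ^ t * max n 1 := by nlinarith
  refine ⟨by simp [inputEnv, valueBound], by simp [inputEnv], by simp [memorySize],
    fun k => by simp [inputEnv, memorySize], ?_, ?_, fun a => ?_⟩
  · refine lt_of_lt_of_le ?_ hw
    calc memorySize n t ≤ 1000 * ((t ^ t) ^ 2 * max n 1) := memorySize_le n t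
      _ ≤ 2 ^ 10 * ((t ^ t) ^ 10 * max n 1 ^ 10) := by
          refine Nat.mul_le_mul (by norm_num) (Nat.mul_le_mul ?_ ?_)
          · exact Nat.pow_le_pow_right h1 (by norm_num)
          · exact Nat.le_self_pow (by norm_num) _
      _ = (2 * t ^ t * max n 1) ^ 10 := by rw [mul_pow, mul_pow, mul_assoc]
      _ < (2 * t ^ t * max n 1) ^ 241 := Nat.pow_lt_pow_right hY (by norm_num)
  · calc valueBound n t ^ 24 ≤ ((2 * t ^ t * max n 1) ^ 10) ^ 24 :=
          Nat.pow_le_pow_left (valueBound_le n t) _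
      _ = (2 * t ^ t * max n 1) ^ 240 := (pow_mul _ _ _).symm
      _ < (2 * t ^ t * max n 1) ^ 241 := Nat.pow_lt_pow_right hY (by norm_num)
      _ ≤ 2 ^ w := hw
  · refine (h.encodeInput_getD_le a).trans ?_
    simp only [inputEnv, valueBound]
    nlinarith [Nat.zero_le (n * t), Nat.zero_le (((t + 2) ^ t) ^ 3)]

/-- The program halts within the time bound, and the memory then starts with the answer. -/
theorem treedepthProgram_spec {n t w : ℕ} {G : SimpleGraph (Fin n)} (hG : IsChordal G)
    {adj : Fin n → List (Fin n)} (h : IsAdjacencyLists G adj)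
    (hw : (2 * t ^ t * max n 1) ^ 241 ≤ 2 ^ w) :
    ∃ T s out, Exec w (memorySize n t) (encodeInput t adj) treedepthProgram State.init T s ∧
      T ≤ 11 + 164000 * costBound n t ∧ IsAnswer n t G out ∧
      ∀ i < 2 + n * t + n, s.mem i = out i := by
  have hF := inputEnv_fits h hw
  obtain ⟨hok, hcost, hans⟩ := decideTreedepth_spec (inputEnv_large t adj)
    (h.isAdjacencyInput (t := t)) hG (fun _ _ => Iff.rfl) h.listOffset_le_of_treedepth_le
    (congrArg (List.getD · 0 0) encodeInput_eq) (congrArg (List.getD · 1 0) encodeInput_eq)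
  have h0 : (encodeInput t adj).getD 0 0 = t := congrArg (List.getD · 0 0) encodeInput_eq
  have h1 : (encodeInput t adj).getD 1 0 = n := congrArg (List.getD · 1 0) encodeInput_eq
  obtain ⟨⟨T, c, hx, hT, hr⟩, -⟩ := AProg.compile_spec hF decideTreedepth decideTreedepth_wf
    AState.init ⟨fun _ => Nat.zero_le _, fun _ _ => Nat.zero_le _⟩
    ⟨Function.update (fun _ => 0) 0 (2 + n * t + n), fun _ => 0⟩
    ⟨rfl, fun _ => rfl, fun _ _ => rfl, fun _ _ _ _ => rfl⟩ hok
  have hL : 2 + n * t + n < 2 ^ w := hF.L_le.trans_lt hF.S_lt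
  have ht : t < 2 ^ w := by
    have := (hF.inp_le 0).trans_lt ((Nat.le_self_pow (by norm_num) _).trans_lt hF.B_lt)
    rwa [show (inputEnv t adj).inp.getD 0 0 = t from h0] at this
  -- The initial assignment takes `11` steps. The rest takes at most `400` steps for each of at most
  -- `410 * costBound n t` elementary statements.
  refine ⟨11 + T, c, _, .seq _ ⟨Function.update (fun _ => 0) 0 (2 + n * t + n), fun _ => 0⟩ _ _ _ _ _
    ?_ hx, ?_, hans, hr.mem_zero⟩
  · have hassign := Exec.assign (w := w) (S := memorySize n t) (inp := encodeInput t adj) State.init 0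
      (.op .add (.op .add (.lit 2) (.op .mul (.input (.lit 1)) (.input (.lit 0)))) (.input (.lit 1)))
      (by
        simp only [Expr.Fits, Expr.eval, Op.eval, h0, h1]
        omega)
    simp only [Expr.eval, Op.eval, h0, h1] at hassign
    exact hassign
  · omega

theorem mainTheorem4 :
    ∃ (P : WordRAM.Program) (C : ℕ),
      ∀ (n t : ℕ) (G : SimpleGraph (Fin n)), IsChordal G →
      ∀ adj : Fin n → List (Fin n), IsAdjacencyLists G adj →
      ∀ w : ℕ, (C : ℝ) * (t * Real.logb 2 t + Real.logb 2 n + 1) ≤ w →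
      ∃ (S T : ℕ) (s : WordRAM.State),
        (S : ℝ) ≤ resourceBound C t n ∧ (T : ℝ) ≤ resourceBound C t n ∧
        WordRAM.Exec w S (encodeInput t adj) P WordRAM.State.init T s ∧
        ((treedepth G ≤ t ∧
            ∃ (N : ℕ) (F : RootedForest (Fin N)) (ψ : Fin n → Fin N),
              IsTreedepthDecomposition G F ψ ∧ F.height ≤ t ∧
              WordRAM.Outputs S s (1 :: encodeDecomposition F ψ)) ∨
          (¬ treedepth G ≤ t ∧ WordRAM.Outputs S s [0])) := by
  -- The time bound needs `11 + 164000 * 13122`; the memory bound needs only `1000`, and the word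
  -- length `241`. Just the inequality is kept, so that no power with this exponent is ever
  -- evaluated.
  obtain ⟨C, hC⟩ : ∃ C : ℕ, 3000000000 ≤ C := ⟨_, le_rfl⟩
  refine ⟨treedepthProgram, C, fun n t G hG adj hadj w hw => ?_⟩
  have hN1 : 1 ≤ max n 1 := le_max_right _ _
  have h1 := one_le_self_pow_self t
  obtain ⟨T, s, out, hx, hT, hans, hout⟩ := treedepthProgram_spec hG hadj
    ((Nat.pow_le_pow_right (Nat.one_le_iff_ne_zero.2 (by positivity)) (by omega)).trans
      (pow_le_two_pow_of_le_word hw))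
  refine ⟨memorySize n t, T, s, le_resourceBound (by omega) (by omega) (memorySize_le n t),
    le_resourceBound hC (by omega) (k := 8) ?_, hx, ?_⟩
  · have h2 := costBound_le n t
    have h3 : 1 ≤ (t ^ t) ^ 8 * max n 1 := Nat.one_le_iff_ne_zero.2 (by positivity)
    omega
  · rcases hans with ⟨htd, F, ψ, hdec, hheight, ho0, ho1, ho2, ho3⟩ | ⟨htd, ho0⟩
    · have hlen : (1 :: encodeDecomposition F ψ).length = 2 + n * t + n := by
        simp [encodeDecomposition]
        omega
      refine .inl ⟨htd, n * t, F, ψ, hdec, hheight, ?_, fun i hi => ?_⟩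
      · rw [hlen, memorySize]
        omega
      · rw [hout i (hlen ▸ hi)]
        exact getElem_encodeDecomposition ho0 ho1 ho2 ho3 i hi
    · exact .inr ⟨htd, .zero (by unfold memorySize; omega) ((hout 0 (by omega)).trans ho0)⟩
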